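/- A \emph{countable word} over a finite alphabet $A$ is a map $w:\alpha\to A$ from a countable (possibly finite or empty) linear order $\alpha$, taken up to isomorphism; $A^{\circledast}$ denotes the set of these words. A $\circledast$-\emph{monoid} is a set $M$ with a product $\pi:M^{\circledast}\to M$ such that $\pi(a)=a$ for one-letter words and $\pi\big(\prod_{i\in\alpha}\pi(u_i)\big)=\pi\big(\prod_{i\in\alpha}u_i\big)$ for every family $(u_i)_{i\in\alpha}$ of words over $M$ indexed by a countable linear order $\alpha$. A morphism $h:A^{\circledast}\to(M,\pi)$ is a map with $h\big(\prod_{i\in\alpha}w_i\big)=\pi\big(\prod_{i\in\alpha}h(w_i)\big)$ for all such families of words over $A$. A language $L\subseteq A^{\circledast}$ is \emph{recognizable} if $L=h^{-1}(F)$ for some morphism $h$ to a finite $\circledast$-monoid $(M,\pi)$ and some $F\subseteq M$. Monadic second-order (MSO) sentences are interpreted over words using the order, letter predicates, equality and membership; the $\exists\forall$-fragment consists of the formulas made of a block of existential set quantifiers, then a block of universal set quantifiers, then a first-order formula (blocks may be empty). \textbf{Theorem.} Every recognizable language of countable words is definable by an MSO sentence in the $\exists\forall$-fragment. Moreover this is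 effective: there is an algorithm which, given the size of $A$, the finite set $M$ with the neutral element $1=\pi(\varepsilon)$ and the tables of the operations $a\cdot b=\pi(ab)$, $a^{\tau}=\pi(a^{\omega})$, $a^{\tau^*}=\pi(a^{\omega^*})$ (for $a,b\in M$) and $P^{\kappa}=\pi(P^{\eta})$ (for $\emptyset\ne P\subseteq M$) induced by $\pi$, together with the images $h(a)$ of the letters $a\in A$ and the subset $F$, outputs an MSO sentence of the $\exists\forall$-fragment that defines $L=h^{-1}(F)$. Here $\omega$, $\omega^*$ are the order types of $(\mathbb N,<)$ and $(\mathbb N,>)$, and $P^{\eta}$ is the word, unique up to isomorphism, over the alphabet $P$ with domain of order type $(\mathbb Q,<)$ in which every letter of $P$ occurs densely. -/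

import Mathlib

/-! ### Countable words -/

universe u v

/-- A word over `A` whose domain is a countable (possibly finite or empty) linear order. Words are
meant up to isomorphism (`Word.Iso`); every countable order has a copy in `Type`. -/
structure Word (A : Type u) where
  dom : Type
  [ord : LinearOrder dom]
  [ctbl : Countable dom]
  letter : dom → A

attribute [instance] Word.ord Word.ctbl

namespace Word

/-- Isomorphism of words: an order isomorphism of the domains preserving the letters. -/
def Iso {A : Type u} (w w' : Word A) : Prop :=
  ∃ e : w.dom ≃o w'.dom, ∀ x, w'.letter (e x) = w.letter x

/-- The empty word. -/
def empty (A : Type u) : Word A := ⟨Fin 0, Fin.elim0⟩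

/-- The one-letter word `a`. -/
def single {A : Type u} (a : A) : Word A := ⟨Fin 1, fun _ => a⟩

/-- The two-letter word `a b`. -/
def pair {A : Type u} (a b : A) : Word A := ⟨Fin 2, ![a, b]⟩

/-- The word `a^ω`. -/
def omega {A : Type u} (a : A) : Word A := ⟨ℕ, fun _ => a⟩

/-- The word `a^(ω*)`, where `ω*` is the reverse of `ω`. -/
def omegaRev {A : Type u} (a : A) : Word A := ⟨ℕᵒᵈ, fun _ => a⟩

/-- `w` is an `η`-shuffle of the set `P` of letters: its domain has the order type of `ℚ`, its
letters are in `P`, and the positions carrying any given letter of `P` are dense. -/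
structure IsShuffle {A : Type u} (w : Word A) (P : Set A) : Prop where
  orderType : Nonempty (w.dom ≃o ℚ)
  letter_mem : ∀ x, w.letter x ∈ P
  dense : ∀ a ∈ P, ∀ x y : w.dom, x < y → ∃ z, x < z ∧ z < y ∧ w.letter z = a

instance countableLexSigma {ι : Type} [Countable ι] (α : ι → Type) [∀ i, Countable (α i)] :
    Countable (Σₗ i, α i) :=
  inferInstanceAs (Countable (Σ i, α i))

/-- The concatenation `∏_{i ∈ ι} w i`; its domain is the ordered sum of the domains. -/
def concat {A : Type u} {ι : Type} [LinearOrder ι] [Countable ι] (w : ι → Word A) : Word A where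
  dom := Σₗ i, (w i).dom
  letter p := (w (ofLex p).1).letter (ofLex p).2

end Word

/-! ### `⊛`-monoids, morphisms, recognizable languages -/

/-- A `⊛`-monoid on `S`: a product defined on all countable words over `S`, words being taken up to
isomorphism, with generalized associativity. -/
structure CountableMonoid (S : Type u) where
  prod : Word S → S
  prod_iso : ∀ w w' : Word S, w.Iso w' → prod w = prod w'
  prod_single : ∀ a, prod (Word.single a) = a
  prod_concat : ∀ (ι : Type) [LinearOrder ι] [Countable ι] (w : ι → Word S),
    prod ⟨ι, fun i => prod (w i)⟩ = prod (Word.concat w)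

namespace CountableMonoid

variable {S : Type u} (C : CountableMonoid S)

/-- The neutral element induced by the product. -/
def one : S := C.prod (Word.empty S)

/-- The binary product induced by the product. -/
def mul (a b : S) : S := C.prod (Word.pair a b)

/-- The `τ`-iteration induced by the product. -/
def tau (a : S) : S := C.prod (Word.omega a)

/-- The `τ*`-iteration induced by the product. -/
def tauRev (a : S) : S := C.prod (Word.omegaRev a)

end CountableMonoid

/-- A morphism from the free `⊛`-monoid of countable words over `A` to a `⊛`-monoid: a map on words
up to isomorphism that sends concatenations to products. -/
structure WordMorphism (A : Type u) {M : Type v} (C : CountableMonoid M) where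
  toFun : Word A → M
  map_iso : ∀ w w' : Word A, w.Iso w' → toFun w = toFun w'
  map_concat : ∀ (ι : Type) [LinearOrder ι] [Countable ι] (w : ι → Word A),
    toFun (Word.concat w) = C.prod ⟨ι, fun i => toFun (w i)⟩

/-- `L` is recognizable by a finite `⊛`-monoid. -/
def IsRecognizable {A : Type u} (L : Set (Word A)) : Prop :=
  ∃ (M : Type) (_ : Finite M) (C : CountableMonoid M) (h : WordMorphism A C) (F : Set M),
    L = {w | h.toFun w ∈ F}

/-! ### Monadic second-order logic over words -/

/-- MSO formulas over words on the alphabet `A`. First-order variables and set variables are both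
named by natural numbers. -/
inductive MSO (A : Type u) : Type u
  | falsum : MSO A
  | letter (a : A) (x : ℕ) : MSO A
  | lt (x y : ℕ) : MSO A
  | eq (x y : ℕ) : MSO A
  | mem (x X : ℕ) : MSO A
  | not (φ : MSO A) : MSO A
  | and (φ ψ : MSO A) : MSO A
  | or (φ ψ : MSO A) : MSO A
  | ex (x : ℕ) (φ : MSO A) : MSO A
  | all (x : ℕ) (φ : MSO A) : MSO A
  | exSet (X : ℕ) (φ : MSO A) : MSO A
  | allSet (X : ℕ) (φ : MSO A) : MSO A

namespace MSO

/-- Free first-order variables. -/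
def freeVar {A : Type u} : MSO A → Finset ℕ
  | falsum => ∅
  | letter _ x => {x}
  | lt x y => {x, y}
  | eq x y => {x, y}
  | mem x _ => {x}
  | not φ => φ.freeVar
  | and φ ψ => φ.freeVar ∪ ψ.freeVar
  | or φ ψ => φ.freeVar ∪ ψ.freeVar
  | ex x φ => φ.freeVar.erase x
  | all x φ => φ.freeVar.erase x
  | exSet _ φ => φ.freeVar
  | allSet _ φ => φ.freeVar

/-- Free set variables. -/
def freeSetVar {A : Type u} : MSO A → Finset ℕ
  | falsum => ∅
  | letter _ _ => ∅
  | lt _ _ => ∅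
  | eq _ _ => ∅
  | mem _ X => {X}
  | not φ => φ.freeSetVar
  | and φ ψ => φ.freeSetVar ∪ ψ.freeSetVar
  | or φ ψ => φ.freeSetVar ∪ ψ.freeSetVar
  | ex _ φ => φ.freeSetVar
  | all _ φ => φ.freeSetVar
  | exSet X φ => φ.freeSetVar.erase X
  | allSet X φ => φ.freeSetVar.erase X

/-- A sentence has no free variable of either kind. -/
def IsSentence {A : Type u} (φ : MSO A) : Prop := φ.freeVar = ∅ ∧ φ.freeSetVar = ∅

/-- Satisfaction in `w` under partial first-order valuations `ν` and set valuations `μ`. Valuations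
of first-order variables are partial because the domain may be empty; an atom with an unassigned
variable is false, which never happens while evaluating a sentence. -/
def Sat {A : Type u} (w : Word A) : MSO A → (ℕ → Option w.dom) → (ℕ → Set w.dom) → Prop
  | falsum, _, _ => False
  | letter a x, ν, _ => ∃ p, ν x = some p ∧ w.letter p = a
  | lt x y, ν, _ => ∃ p q, ν x = some p ∧ ν y = some q ∧ p < q
  | eq x y, ν, _ => ∃ p q, ν x = some p ∧ ν y = some q ∧ p = q
  | mem x X, ν, μ => ∃ p, ν x = some p ∧ p ∈ μ X
  | not φ, ν, μ => ¬ Sat w φ ν μ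
  | and φ ψ, ν, μ => Sat w φ ν μ ∧ Sat w ψ ν μ
  | or φ ψ, ν, μ => Sat w φ ν μ ∨ Sat w ψ ν μ
  | ex x φ, ν, μ => ∃ p : w.dom, Sat w φ (Function.update ν x (some p)) μ
  | all x φ, ν, μ => ∀ p : w.dom, Sat w φ (Function.update ν x (some p)) μ
  | exSet X φ, ν, μ => ∃ P : Set w.dom, Sat w φ ν (Function.update μ X P)
  | allSet X φ, ν, μ => ∀ P : Set w.dom, Sat w φ ν (Function.update μ X P)

/-- `w` is a model of the sentence `φ`. -/
def Models {A : Type u} (w : Word A) (φ : MSO A) : Prop :=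
  φ.Sat w (fun _ => none) (fun _ => ∅)

/-- `φ` is a sentence whose models are the words in `L`. -/
def Defines {A : Type u} (φ : MSO A) (L : Set (Word A)) : Prop :=
  φ.IsSentence ∧ ∀ w, Models w φ ↔ w ∈ L

/-- First-order formulas: no set quantifier (set variables may occur in atoms). -/
def IsFirstOrder {A : Type u} : MSO A → Prop
  | falsum => True
  | letter _ _ => True
  | lt _ _ => True
  | eq _ _ => True
  | mem _ _ => True
  | not φ => φ.IsFirstOrder
  | and φ ψ => φ.IsFirstOrder ∧ ψ.IsFirstOrder
  | or φ ψ => φ.IsFirstOrder ∧ ψ.IsFirstOrder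
  | ex _ φ => φ.IsFirstOrder
  | all _ φ => φ.IsFirstOrder
  | exSet _ _ => False
  | allSet _ _ => False

/-- The `∀`-fragment: a block of universal set quantifiers, then a first-order formula. -/
inductive IsForall {A : Type u} : MSO A → Prop
  | base {φ : MSO A} : φ.IsFirstOrder → IsForall φ
  | allSet {X : ℕ} {φ : MSO A} : IsForall φ → IsForall (MSO.allSet X φ)

/-- The `∃∀`-fragment: a block of existential set quantifiers, then a formula of the
`∀`-fragment. -/
inductive IsExistsForall {A : Type u} : MSO A → Prop
  | base {φ : MSO A} : IsForall φ → IsExistsForall φ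
  | exSet {X : ℕ} {φ : MSO A} : IsExistsForall φ → IsExistsForall (MSO.exSet X φ)

/-- Renaming of letters. -/
def mapLetter {A : Type u} {B : Type v} (f : A → B) : MSO A → MSO B
  | falsum => falsum
  | letter a x => letter (f a) x
  | lt x y => lt x y
  | eq x y => eq x y
  | mem x X => mem x X
  | not φ => not (φ.mapLetter f)
  | and φ ψ => and (φ.mapLetter f) (ψ.mapLetter f)
  | or φ ψ => or (φ.mapLetter f) (ψ.mapLetter f)
  | ex x φ => ex x (φ.mapLetter f)
  | all x φ => all x (φ.mapLetter f)
  | exSet X φ => exSet X (φ.mapLetter f)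
  | allSet X φ => allSet X (φ.mapLetter f)

/-- Gödel numbering of the formulas whose letters are natural numbers. -/
def code : MSO ℕ → ℕ
  | falsum => Nat.pair 0 0
  | letter a x => Nat.pair 1 (Nat.pair a x)
  | lt x y => Nat.pair 2 (Nat.pair x y)
  | eq x y => Nat.pair 3 (Nat.pair x y)
  | mem x X => Nat.pair 4 (Nat.pair x X)
  | not φ => Nat.pair 5 φ.code
  | and φ ψ => Nat.pair 6 (Nat.pair φ.code ψ.code)
  | or φ ψ => Nat.pair 7 (Nat.pair φ.code ψ.code)
  | ex x φ => Nat.pair 8 (Nat.pair x φ.code)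
  | all x φ => Nat.pair 9 (Nat.pair x φ.code)
  | exSet X φ => Nat.pair 10 (Nat.pair X φ.code)
  | allSet X φ => Nat.pair 11 (Nat.pair X φ.code)

theorem code_injective : Function.Injective code := by
  intro φ
  induction φ with
  | not φ ih =>
    intro χ h
    cases χ <;> simp [code, Nat.pair_eq_pair] at h ⊢
    exact ih h
  | and φ ψ ih1 ih2 | or φ ψ ih1 ih2 =>
    intro χ h
    cases χ <;> simp [code, Nat.pair_eq_pair] at h ⊢
    exact ⟨ih1 h.1, ih2 h.2⟩
  | ex x φ ih | all x φ ih | exSet x φ ih | allSet x φ ih =>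
    intro χ h
    cases χ <;> simp [code, Nat.pair_eq_pair] at h ⊢
    exact ⟨h.1, ih h.2⟩
  | _ =>
    intro χ h
    cases χ <;> simp_all [code, Nat.pair_eq_pair]

end MSO

/-! ### Finite presentations of recognizers -/

/-- The finite data handed to an algorithm: the size of the alphabet, the size of the `⊛`-algebra,
its neutral element, the tables of its operations `·`, `τ`, `τ*`, `κ`, the table of images of the
letters, and the list of accepting elements. -/
structure Presentation where
  letters : ℕ
  size : ℕ
  one : ℕ
  mul : List ℕ
  tau : List ℕ
  tauRev : List ℕ
  kappa : List ℕ
  image : List ℕ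
  accept : List ℕ

namespace Presentation

def equivProd : Presentation ≃
    ℕ × ℕ × ℕ × List ℕ × List ℕ × List ℕ × List ℕ × List ℕ × List ℕ where
  toFun d := (d.letters, d.size, d.one, d.mul, d.tau, d.tauRev, d.kappa, d.image, d.accept)
  invFun t := ⟨t.1, t.2.1, t.2.2.1, t.2.2.2.1, t.2.2.2.2.1, t.2.2.2.2.2.1, t.2.2.2.2.2.2.1,
    t.2.2.2.2.2.2.2.1, t.2.2.2.2.2.2.2.2⟩

instance : Primcodable Presentation := Primcodable.ofEquiv _ equivProd

/-- `d` presents the recognizer `(C, h, F)`, with letters and elements numbered by `eA` and `eM`: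
it tabulates the operations induced by the product of `C`, the images of the letters under `h`, and
`F`. The entry of the table of `κ` for a non-empty set `P` has index `∑ a ∈ P, 2 ^ eM a`, and its
value is the product of the `η`-shuffle of `P`, which is unique up to isomorphism. -/
structure Presents (d : Presentation) {A : Type u} {M : Type v}
    (eA : A ≃ Fin d.letters) (eM : M ≃ Fin d.size)
    (C : CountableMonoid M) (h : WordMorphism A C) (F : Set M) : Prop where
  one : d.one = (eM C.one : ℕ)
  mul : ∀ a b, d.mul[d.size * (eM a : ℕ) + (eM b : ℕ)]? = some (eM (C.mul a b) : ℕ)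
  tau : ∀ a, d.tau[(eM a : ℕ)]? = some (eM (C.tau a) : ℕ)
  tauRev : ∀ a, d.tauRev[(eM a : ℕ)]? = some (eM (C.tauRev a) : ℕ)
  kappa : ∀ P : Finset M, P.Nonempty → ∀ w : Word M, w.IsShuffle (P : Set M) →
    d.kappa[∑ a ∈ P, 2 ^ (eM a : ℕ)]? = some (eM (C.prod w) : ℕ)
  image : ∀ a, d.image[(eA a : ℕ)]? = some (eM (h.toFun (Word.single a)) : ℕ)
  accept : ∀ a, (eM a : ℕ) ∈ d.accept ↔ a ∈ F

end Presentation

/-! ### Values of subsets of the domain of a word -/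

namespace Word

/-- The restriction of a word to a set of positions. -/
def restrict {A : Type u} (w : Word A) (S : Set w.dom) : Word A := ⟨S, fun x => w.letter x⟩

instance subsingletonSingle {A : Type u} (a : A) : Subsingleton (single a).dom :=
  inferInstanceAs (Subsingleton (Fin 1))

end Word

namespace CountableMonoid

variable {M : Type v} (C : CountableMonoid M) (w : Word M)

/-- The product of the restriction of `w` to `S`. -/
def val (S : Set w.dom) : M := C.prod (w.restrict S)

theorem val_iUnion {ι : Type} [LinearOrder ι] [Countable ι] (S : ι → Set w.dom)
    (hS : ∀ i j, i < j → ∀ x ∈ S i, ∀ y ∈ S j, x < y) :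
    C.val w (⋃ i, S i) = C.prod ⟨ι, fun i => C.val w (S i)⟩ := by
  unfold val
  rw [C.prod_concat ι (fun i => w.restrict (S i))]
  symm
  apply C.prod_iso
  let φ : (Word.concat fun i => w.restrict (S i)).dom → (w.restrict (⋃ i, S i)).dom :=
    fun p => ⟨(ofLex p).2.1, Set.mem_iUnion.2 ⟨(ofLex p).1, (ofLex p).2.2⟩⟩
  have hφ : StrictMono φ := by
    intro p q hpq
    rcases (Sigma.Lex.lt_def (a := p) (b := q)).1 hpq with h | ⟨h, h'⟩
    · exact hS _ _ h _ (ofLex p).2.2 _ (ofLex q).2.2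
    · obtain ⟨i, x⟩ := p
      obtain ⟨j, y⟩ := q
      cases h
      exact h'
  have hsurj : Function.Surjective φ := by
    rintro ⟨x, hx⟩
    obtain ⟨i, hi⟩ := Set.mem_iUnion.1 hx
    exact ⟨toLex ⟨i, ⟨x, hi⟩⟩, rfl⟩
  exact ⟨hφ.orderIsoOfSurjective φ hsurj, fun _ => rfl⟩

theorem val_union (S T : Set w.dom) (h : ∀ x ∈ S, ∀ y ∈ T, x < y) :
    C.val w (S ∪ T) = C.mul (C.val w S) (C.val w T) := by
  have e : S ∪ T = ⋃ i : Fin 2, (![S, T] i) := by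
    ext x; simp [Fin.exists_fin_two]
  rw [e, C.val_iUnion]
  · unfold mul Word.pair
    congr 2
    funext i
    fin_cases i <;> rfl
  · intro i j hij
    fin_cases i <;> fin_cases j <;> simp_all

theorem val_empty : C.val w ∅ = C.one := by
  apply C.prod_iso
  exact ⟨⟨⟨fun x => x.2.elim, fun x => x.elim0, fun x => x.2.elim, fun x => x.elim0⟩,
    fun {x} => x.2.elim⟩, fun x => x.2.elim⟩

theorem val_singleton (x : w.dom) : C.val w {x} = w.letter x := by
  conv_rhs => rw [← C.prod_single (w.letter x)]
  apply C.prod_iso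
  refine ⟨⟨⟨fun _ => (0 : Fin 1), fun _ => ⟨x, rfl⟩, fun y => Subtype.ext y.2.symm,
    fun y => Subsingleton.elim (α := Fin 1) _ _⟩, fun {y z} => ?_⟩, fun y => ?_⟩
  · have : y = z := Subtype.ext (y.2.trans z.2.symm)
    simp [this]
  · exact congrArg w.letter y.2.symm

theorem val_univ : C.val w Set.univ = C.prod w := by
  apply C.prod_iso
  exact ⟨OrderIso.Set.univ, fun _ => rfl⟩

theorem mul_one' (a : M) : C.mul a C.one = a := by
  have h := C.val_union (Word.single a) Set.univ ∅ (by simp)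
  rw [Set.union_empty, val_univ, val_empty, C.prod_single] at h
  exact h.symm

theorem one_mul' (a : M) : C.mul C.one a = a := by
  have h := C.val_union (Word.single a) ∅ Set.univ (by simp)
  rw [Set.empty_union, val_univ, val_empty, C.prod_single] at h
  exact h.symm

theorem mul_assoc' (a b c : M) : C.mul (C.mul a b) c = C.mul a (C.mul b c) := by
  let w : Word M := ⟨Fin 3, ![a, b, c]⟩
  have h (i : Fin 3) : C.val w {i} = ![a, b, c] i := C.val_singleton w i
  have l01 : (0 : Fin 3) < 1 := by decide
  have l02 : (0 : Fin 3) < 2 := by decide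
  have l12 : (1 : Fin 3) < 2 := by decide
  have h1 := C.val_union w ({(0 : Fin 3)} ∪ {(1 : Fin 3)}) {(2 : Fin 3)} (by
    rintro x (rfl | rfl) y rfl
    exacts [l02, l12])
  have h2 := C.val_union w {(0 : Fin 3)} ({(1 : Fin 3)} ∪ {(2 : Fin 3)}) (by
    rintro x rfl y (rfl | rfl)
    exacts [l01, l02])
  rw [C.val_union w {(0 : Fin 3)} {(1 : Fin 3)} (by rintro x rfl y rfl; exact l01)] at h1
  rw [C.val_union w {(1 : Fin 3)} {(2 : Fin 3)} (by rintro x rfl y rfl; exact l12)] at h2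
  rw [h, h, h] at h1 h2
  rw [Set.union_assoc] at h1
  exact h1.symm.trans h2

/-- The monoid underlying a `⊛`-monoid. -/
abbrev toMonoid : Monoid M where
  mul := C.mul
  one := C.one
  mul_assoc := C.mul_assoc'
  one_mul := C.one_mul'
  mul_one := C.mul_one'

end CountableMonoid

/-- The value of a word under a morphism is the product of the images of its letters. -/
theorem WordMorphism.toFun_eq_prod {A : Type u} {M : Type v} {C : CountableMonoid M}
    (h : WordMorphism A C) (w : Word A) :
    h.toFun w = C.prod ⟨w.dom, fun x => h.toFun (Word.single (w.letter x))⟩ := by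
  rw [← h.map_concat w.dom (fun x => Word.single (w.letter x))]
  apply h.map_iso
  let φ : (Word.concat fun x => Word.single (w.letter x)).dom → w.dom := fun p => (ofLex p).1
  have hφ : StrictMono φ := by
    intro p q hpq
    rcases (Sigma.Lex.lt_def (a := p) (b := q)).1 hpq with h | ⟨h, h'⟩
    · exact h
    · obtain ⟨i, x⟩ := p
      obtain ⟨j, y⟩ := q
      cases h
      exact absurd h' (by
        rw [Subsingleton.elim (α := (Word.single (w.letter i)).dom) x y]
        exact lt_irrefl _)
  have hs : Function.Surjective φ := fun x => ⟨toLex ⟨x, (0 : Fin 1)⟩, rfl⟩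
  refine ⟨(hφ.orderIsoOfSurjective φ hs).symm, fun x => ?_⟩
  have : φ ((hφ.orderIsoOfSurjective φ hs).symm x) = x :=
    (hφ.orderIsoOfSurjective φ hs).apply_symm_apply x
  change w.letter (φ _) = _
  rw [this]

/-! ### Cofinal sequences and homogeneous subsequences -/

theorem exists_strictMono_cofinal {X : Type*} [LinearOrder X] [Countable X] {T : Set X} {t : X}
    (ht : t ∈ T) (hT : ∀ x ∈ T, ∃ y ∈ T, x < y) :
    ∃ z : ℕ → X, StrictMono z ∧ z 0 = t ∧ (∀ i, z i ∈ T) ∧ ∀ x ∈ T, ∃ i, x < z i := by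
  have : Nonempty T := ⟨⟨t, ht⟩⟩
  obtain ⟨g, hg⟩ := exists_surjective_nat T
  have hnext : ∀ a b : T, ∃ c : T, a < c ∧ b < c := by
    intro a b
    obtain ⟨c, hc, hlt⟩ := hT _ (max a b).2
    exact ⟨⟨c, hc⟩, (le_max_left a b).trans_lt hlt, (le_max_right a b).trans_lt hlt⟩
  choose nx hnx using hnext
  let z : ℕ → T := fun i => Nat.rec ⟨t, ht⟩ (fun i a => nx a (g i)) i
  have hzm : StrictMono z := strictMono_nat_of_lt_succ fun i => (hnx (z i) (g i)).1
  refine ⟨fun i => (z i).1, fun i j h => hzm h, rfl, fun i => (z i).2, fun x hx => ?_⟩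
  obtain ⟨i, hi⟩ := hg ⟨x, hx⟩
  refine ⟨i + 1, ?_⟩
  have this : g i < z (i + 1) := (hnx (z i) (g i)).2
  rw [hi] at this
  exact this

theorem exists_strictAnti_coinitial {X : Type*} [LinearOrder X] [Countable X] {T : Set X} {t : X}
    (ht : t ∈ T) (hT : ∀ x ∈ T, ∃ y ∈ T, y < x) :
    ∃ z : ℕ → X, StrictAnti z ∧ z 0 = t ∧ (∀ i, z i ∈ T) ∧ ∀ x ∈ T, ∃ i, z i < x := by
  have : Countable Xᵒᵈ := inferInstanceAs (Countable X)
  obtain ⟨z, h1, h2, h3, h4⟩ := exists_strictMono_cofinal (X := Xᵒᵈ) (T := OrderDual.ofDual ⁻¹' T)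
    (t := OrderDual.toDual t) ht hT
  exact ⟨fun i => OrderDual.ofDual (z i), fun i j h => h1 h, h2, h3, h4⟩

/-- Infinite Ramsey theorem for pairs and finitely many colours. -/
theorem exists_homogeneous_subsequence {M : Type*} [Finite M] (c : ℕ → ℕ → M) :
    ∃ (g : ℕ → ℕ) (e : M), StrictMono g ∧ ∀ i j, i < j → c (g i) (g j) = e := by
  let U : Ultrafilter ℕ := Filter.hyperfilter ℕ
  have hcol : ∀ f : ℕ → M, ∃ e, ∀ᶠ j in (U : Filter ℕ), f j = e := by
    intro f
    by_contra h
    push Not at h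
    have h' : ∀ e, ∀ᶠ j in (U : Filter ℕ), f j ≠ e := h
    obtain ⟨j, hj⟩ := (Filter.eventually_all.2 h').exists
    exact hj (f j) rfl
  choose b hb using fun i => hcol (c i)
  obtain ⟨e, he⟩ := hcol b
  have hgt : ∀ i : ℕ, ∀ᶠ j in (U : Filter ℕ), i < j := by
    intro i
    have h1 : ∀ᶠ j in (Filter.cofinite : Filter ℕ), i < j := by
      rw [Nat.cofinite_eq_atTop]
      exact Filter.eventually_gt_atTop i
    exact h1.filter_mono (Filter.hyperfilter_le_cofinite)
  obtain ⟨g, _, hg⟩ := exists_seq_of_forall_finset_exists (fun i => b i = e)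
    (fun i j => i < j ∧ c i j = e) (by
      intro s hs
      have h1 : ∀ᶠ j in (U : Filter ℕ), ∀ i ∈ s, i < j ∧ c i j = e := by
        rw [Filter.eventually_all_finset]
        intro i hi
        filter_upwards [hgt i, hb i] with j h1 h2
        exact ⟨h1, h2.trans (hs i hi)⟩
      obtain ⟨j, hj1, hj2⟩ := (he.and h1).exists
      exact ⟨j, hj1, hj2⟩)
  exact ⟨g, e, fun i j h => (hg i j h).1, fun i j h => (hg i j h).2⟩

/-! ### One-sided values of convex sets -/

open Set

namespace CountableMonoid

variable {M : Type v} (C : CountableMonoid M) (w : Word M)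

theorem val_Ico_mul_Ico {x y z : w.dom} (hxy : x ≤ y) (hyz : y ≤ z) :
    C.val w (Ico x z) = C.mul (C.val w (Ico x y)) (C.val w (Ico y z)) := by
  rw [← C.val_union, Ico_union_Ico_eq_Ico hxy hyz]
  exact fun a ha b hb => ha.2.trans_le hb.1

theorem val_inter_Ici {S : Set w.dom} [hS : S.OrdConnected] {x y : w.dom} (hx : x ∈ S)
    (hy : y ∈ S) (hxy : x ≤ y) :
    C.val w (S ∩ Ici x) = C.mul (C.val w (Ico x y)) (C.val w (S ∩ Ici y)) := by
  rw [← C.val_union]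
  · congr 1
    ext t
    simp only [mem_inter_iff, mem_Ici, mem_union, mem_Ico]
    constructor
    · rintro ⟨h1, h2⟩
      rcases lt_or_ge t y with h | h
      · exact Or.inl ⟨h2, h⟩
      · exact Or.inr ⟨h1, h⟩
    · rintro (⟨h1, h2⟩ | ⟨h1, h2⟩)
      · exact ⟨hS.out hx hy ⟨h1, h2.le⟩, h1⟩
      · exact ⟨h1, hxy.trans h2⟩
  · exact fun a ha b hb => ha.2.trans_le hb.2

theorem val_inter_Iio {S : Set w.dom} [hS : S.OrdConnected] {x y : w.dom} (hx : x ∈ S)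
    (hy : y ∈ S) (hxy : x ≤ y) :
    C.val w (S ∩ Iio y) = C.mul (C.val w (S ∩ Iio x)) (C.val w (Ico x y)) := by
  rw [← C.val_union]
  · congr 1
    ext t
    simp only [mem_inter_iff, mem_Iio, mem_union, mem_Ico]
    constructor
    · rintro ⟨h1, h2⟩
      rcases lt_or_ge t x with h | h
      · exact Or.inl ⟨h1, h⟩
      · exact Or.inr ⟨h, h2⟩
    · rintro (⟨h1, h2⟩ | ⟨h1, h2⟩)
      · exact ⟨h1, h2.trans_le hxy⟩
      · exact ⟨hS.out hx hy ⟨h1, h2.le⟩, h2⟩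
  · exact fun a ha b hb => ha.2.trans_le hb.1

theorem val_split (S : Set w.dom) (x : w.dom) :
    C.val w S = C.mul (C.val w (S ∩ Iio x)) (C.val w (S ∩ Ici x)) := by
  rw [← C.val_union, ← inter_union_distrib_left]
  · simp
  · exact fun a ha b hb => lt_of_lt_of_le ha.2 hb.2

theorem val_Ici_eq_tau {S : Set w.dom} [hS : S.OrdConnected] {z : ℕ → w.dom} {e : M}
    (hz : StrictMono z) (hzS : ∀ i, z i ∈ S) (hcof : ∀ x ∈ S, ∃ i, x < z i)
    (he : ∀ i, C.val w (Ico (z i) (z (i + 1))) = e) : C.val w (S ∩ Ici (z 0)) = C.tau e := by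
  have hU : S ∩ Ici (z 0) = ⋃ i : ℕ, Ico (z i) (z (i + 1)) := by
    ext x
    simp only [mem_inter_iff, mem_Ici, mem_iUnion, mem_Ico]
    constructor
    · rintro ⟨hx, h0⟩
      classical
      have hex := hcof x hx
      rcases Nat.exists_eq_succ_of_ne_zero (n := Nat.find hex) (fun h => by
        have := Nat.find_spec hex
        rw [h] at this
        exact absurd this (not_lt.2 h0)) with ⟨i, hi⟩
      refine ⟨i, not_lt.1 fun h => Nat.find_min hex (by omega) h, ?_⟩
      have := Nat.find_spec hex
      rwa [hi] at this
    · rintro ⟨i, h1, h2⟩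
      exact ⟨hS.out (hzS _) (hzS _) ⟨h1, h2.le⟩, (hz.monotone (Nat.zero_le i)).trans h1⟩
  rw [hU, C.val_iUnion]
  · simp only [he]
    rfl
  · intro i j hij x hx y hy
    exact hx.2.trans_le ((hz.monotone hij).trans hy.1)

theorem val_Iio_eq_tauRev {S : Set w.dom} [hS : S.OrdConnected] {z : ℕ → w.dom} {e : M}
    (hz : StrictAnti z) (hzS : ∀ i, z i ∈ S) (hcof : ∀ x ∈ S, ∃ i, z i < x)
    (he : ∀ i, C.val w (Ico (z (i + 1)) (z i)) = e) :
    C.val w (S ∩ Iio (z 0)) = C.tauRev e := by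
  have hU : S ∩ Iio (z 0) = ⋃ i : ℕᵒᵈ, Ico (z (OrderDual.ofDual i + 1)) (z (OrderDual.ofDual i)) := by
    ext x
    simp only [mem_inter_iff, mem_Iio, mem_iUnion, mem_Ico]
    constructor
    · rintro ⟨hx, h0⟩
      classical
      have hex : ∃ i, z i ≤ x := (hcof x hx).imp fun i h => h.le
      rcases Nat.exists_eq_succ_of_ne_zero (n := Nat.find hex) (fun h => by
        have := Nat.find_spec hex
        rw [h] at this
        exact absurd this (not_le.2 h0)) with ⟨i, hi⟩
      refine ⟨OrderDual.toDual i, ?_, not_le.1 fun h => Nat.find_min hex (m := i) (by omega) h⟩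
      have := Nat.find_spec hex
      rwa [hi] at this
    · rintro ⟨i, h1, h2⟩
      exact ⟨hS.out (hzS _) (hzS _) ⟨h1, h2.le⟩, h2.trans_le (hz.antitone (Nat.zero_le _))⟩
  rw [hU, C.val_iUnion]
  · simp only [he]
    rfl
  · intro i j hij x hx y hy
    exact hx.2.trans_le ((hz.antitone (show OrderDual.ofDual j + 1 ≤ OrderDual.ofDual i from hij)).trans
      hy.1)

variable (F : M → w.dom → w.dom → Prop)

/-- The relation `F` gives the correct value of the intervals `[x, y)` with `x < y` in `S`. -/
def Correct (S : Set w.dom) : Prop :=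
  ∀ x ∈ S, ∀ y ∈ S, x < y → ∀ m, F m x y ↔ C.val w (Ico x y) = m

/-- The extension of `F` to empty intervals. -/
def Closed (m : M) (x y : w.dom) : Prop := (x = y ∧ m = C.one) ∨ (x < y ∧ F m x y)

/-- According to `F`, the part of `S` before `x` has value `m`; a coinitial homogeneous subset of
`S`, where needed, is taken from `Z`. -/
def LeftVal (S Z : Set w.dom) (x : w.dom) (m : M) : Prop :=
  (∃ y ∈ S, (∀ u ∈ S, y ≤ u) ∧ C.Closed w F m y x) ∨
  ((∀ y ∈ S, ∃ u ∈ S, u ∈ Z ∧ u < y) ∧ ∃ e,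
    (∀ y ∈ S, y ∈ Z → ∀ u ∈ S, u ∈ Z → y < u → F e y u) ∧
    ∃ b, C.mul (C.tauRev e) b = m ∧ ∃ y ∈ S, y ∈ Z ∧ y < x ∧ F b y x)

/-- According to `F`, the part of `S` from `x` on has value `m`; a cofinal homogeneous subset of
`S`, where needed, is taken from `Z`. -/
def RightVal (S Z : Set w.dom) (x : w.dom) (m : M) : Prop :=
  (∃ y ∈ S, (∀ u ∈ S, u ≤ y) ∧ ∃ b, C.mul b (w.letter y) = m ∧ C.Closed w F b x y) ∨
  ((∀ y ∈ S, ∃ u ∈ S, u ∈ Z ∧ y < u) ∧ ∃ e,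
    (∀ y ∈ S, y ∈ Z → ∀ u ∈ S, u ∈ Z → y < u → F e y u) ∧
    ∃ b, C.mul b (C.tau e) = m ∧ ∃ y ∈ S, y ∈ Z ∧ x < y ∧ F b x y)

variable {F} {C} {w}

theorem Correct.mono {S T : Set w.dom} (h : C.Correct w F T) (hST : S ⊆ T) : C.Correct w F S :=
  fun x hx y hy => h x (hST hx) y (hST hy)

theorem Correct.closed_iff {S : Set w.dom} (h : C.Correct w F S) {x y : w.dom} (hx : x ∈ S)
    (hy : y ∈ S) (hxy : x ≤ y) (m : M) : C.Closed w F m x y ↔ C.val w (Ico x y) = m := by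
  unfold Closed
  rcases hxy.eq_or_lt with rfl | hlt
  · simp [val_empty, eq_comm]
  · simp [hlt, hlt.ne, h x hx y hy hlt m]

theorem val_inter_Ici_max {S : Set w.dom} [hS : S.OrdConnected] {x y : w.dom} (hx : x ∈ S)
    (hy : y ∈ S) (hmax : ∀ u ∈ S, u ≤ y) :
    C.val w (S ∩ Ici x) = C.mul (C.val w (Ico x y)) (w.letter y) := by
  rw [C.val_inter_Ici w hx hy (hmax x hx)]
  have : S ∩ Ici y = {y} := by
    ext t
    simp only [mem_inter_iff, mem_Ici, mem_singleton_iff]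
    exact ⟨fun h => le_antisymm (hmax t h.1) h.2, by rintro rfl; exact ⟨hy, le_rfl⟩⟩
  rw [this, val_singleton]

theorem val_inter_Iio_min {S : Set w.dom} [hS : S.OrdConnected] {x y : w.dom} (hx : x ∈ S)
    (hy : y ∈ S) (hmin : ∀ u ∈ S, y ≤ u) :
    C.val w (S ∩ Iio x) = C.val w (Ico y x) := by
  congr 1
  ext t
  exact ⟨fun h => ⟨hmin t h.1, h.2⟩, fun h => ⟨hS.out hy hx ⟨h.1, h.2.le⟩, h.2⟩⟩

theorem RightVal.eq_val {S Z : Set w.dom} [hS : S.OrdConnected] {x : w.dom} {m : M}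
    (h : C.RightVal w F S Z x m) (hx : x ∈ S) (hF : C.Correct w F (S ∩ Ici x)) :
    C.val w (S ∩ Ici x) = m := by
  rcases h with ⟨y, hy, hmax, b, hbm, hb⟩ | ⟨hcof, e, hhom, b, hbm, y, hy, hyZ, hxy, hb⟩
  · have hle := hmax x hx
    rw [hF.closed_iff ⟨hx, self_mem_Ici⟩ ⟨hy, hle⟩ hle] at hb
    rw [val_inter_Ici_max hx hy hmax, hb, hbm]
  · rw [hF x ⟨hx, self_mem_Ici⟩ y ⟨hy, hxy.le⟩ hxy] at hb
    rw [C.val_inter_Ici w hx hy hxy.le, hb]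
    obtain ⟨z, hz, hz0, hzT, hzc⟩ := exists_strictMono_cofinal (T := (S ∩ Z) ∩ Ici y) (t := y)
      ⟨⟨hy, hyZ⟩, self_mem_Ici⟩ (by
        rintro a ⟨⟨haS, haZ⟩, hya⟩
        obtain ⟨u, hu, huZ, hau⟩ := hcof a haS
        exact ⟨u, ⟨⟨hu, huZ⟩, le_trans hya hau.le⟩, hau⟩)
    have := C.val_Ici_eq_tau w (S := S) (e := e) hz (fun i => (hzT i).1.1) (by
        intro a ha
        obtain ⟨u, hu, huZ, hau⟩ := hcof (max a y) (by
          rcases max_choice a y with h | h <;> rw [h] <;> assumption)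
        obtain ⟨i, hi⟩ := hzc u ⟨⟨hu, huZ⟩, (le_max_right a y).trans hau.le⟩
        exact ⟨i, ((le_max_left a y).trans_lt hau).trans hi⟩) (by
        intro i
        have hlt := hz (Nat.lt_succ_self i)
        have hle : ∀ i, x ≤ z i := fun i => hxy.le.trans (hzT i).2
        exact (hF _ ⟨(hzT i).1.1, hle _⟩ _ ⟨(hzT (i + 1)).1.1, hle _⟩ hlt e).1
          (hhom _ (hzT i).1.1 (hzT i).1.2 _ (hzT (i + 1)).1.1 (hzT (i + 1)).1.2 hlt))
    rw [hz0] at this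
    rw [this, hbm]

theorem LeftVal.eq_val {S Z : Set w.dom} [hS : S.OrdConnected] {x : w.dom} {m : M}
    (h : C.LeftVal w F S Z x m) (hx : x ∈ S) (hF : C.Correct w F (S ∩ Iic x)) :
    C.val w (S ∩ Iio x) = m := by
  rcases h with ⟨y, hy, hmin, hb⟩ | ⟨hcof, e, hhom, b, hbm, y, hy, hyZ, hxy, hb⟩
  · have hle := hmin x hx
    rw [hF.closed_iff ⟨hy, hle⟩ ⟨hx, self_mem_Iic⟩ hle] at hb
    rw [val_inter_Iio_min hx hy hmin, hb]
  · rw [hF y ⟨hy, hxy.le⟩ x ⟨hx, self_mem_Iic⟩ hxy] at hb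
    rw [C.val_inter_Iio w hy hx hxy.le, hb]
    obtain ⟨z, hz, hz0, hzT, hzc⟩ := exists_strictAnti_coinitial (T := (S ∩ Z) ∩ Iic y) (t := y)
      ⟨⟨hy, hyZ⟩, self_mem_Iic⟩ (by
        rintro a ⟨⟨haS, haZ⟩, hya⟩
        obtain ⟨u, hu, huZ, hau⟩ := hcof a haS
        exact ⟨u, ⟨⟨hu, huZ⟩, le_trans hau.le hya⟩, hau⟩)
    have := C.val_Iio_eq_tauRev w (S := S) (e := e) hz (fun i => (hzT i).1.1) (by
        intro a ha
        obtain ⟨u, hu, huZ, hau⟩ := hcof (min a y) (by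
          rcases min_choice a y with h | h <;> rw [h] <;> assumption)
        obtain ⟨i, hi⟩ := hzc u ⟨⟨hu, huZ⟩, hau.le.trans (min_le_right a y)⟩
        exact ⟨i, hi.trans (hau.trans_le (min_le_left a y))⟩) (by
        intro i
        have hlt := hz (Nat.lt_succ_self i)
        have hle : ∀ i, z i ≤ x := fun i => (hzT i).2.trans hxy.le
        exact (hF _ ⟨(hzT (i + 1)).1.1, hle _⟩ _ ⟨(hzT i).1.1, hle _⟩ hlt e).1
          (hhom _ (hzT (i + 1)).1.1 (hzT (i + 1)).1.2 _ (hzT i).1.1 (hzT i).1.2 hlt))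
    rw [hz0] at this
    rw [this, hbm]

theorem exists_rightVal [Finite M] {S T : Set w.dom} [hS : S.OrdConnected] (hTS : T ⊆ S)
    (hup : ∀ x ∈ T, ∀ y ∈ S, x ≤ y → y ∈ T) (hF : C.Correct w F T) :
    ∃ Z ⊆ T, ∀ x ∈ T, C.RightVal w F S Z x (C.val w (S ∩ Ici x)) := by
  by_cases hmax : ∃ y ∈ S, ∀ u ∈ S, u ≤ y
  · obtain ⟨y, hy, hmax⟩ := hmax
    refine ⟨∅, by simp, fun x hx => Or.inl ⟨y, hy, hmax, C.val w (Ico x y), ?_, ?_⟩⟩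
    · exact (val_inter_Ici_max (hTS hx) hy hmax).symm
    · exact (hF.closed_iff hx (hup x hx y hy (hmax x (hTS hx))) (hmax x (hTS hx)) _).2 rfl
  rcases T.eq_empty_or_nonempty with rfl | ⟨t, ht⟩
  · exact ⟨∅, by simp, by simp⟩
  push Not at hmax
  obtain ⟨z, hz, -, hzT, hzc⟩ := exists_strictMono_cofinal ht (fun x hx => by
    obtain ⟨y, hy, hlt⟩ := hmax x (hTS hx)
    exact ⟨y, hup x hx y hy hlt.le, hlt⟩)
  obtain ⟨g, e, hg, hge⟩ := exists_homogeneous_subsequence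
    (fun i j => C.val w (Ico (z i) (z j)))
  have hcof : ∀ x ∈ S, ∃ i, x < z (g i) := by
    intro x hx
    obtain ⟨i, hi⟩ : ∃ i, x < z i := by
      rcases le_total x t with h | h
      · obtain ⟨i, hi⟩ := hzc t ht
        exact ⟨i, h.trans_lt hi⟩
      · exact hzc x (hup t ht x hx h)
    exact ⟨i, hi.trans_le (hz.monotone (hg.id_le i))⟩
  refine ⟨range (z ∘ g), by rintro _ ⟨i, rfl⟩; exact hzT _, fun x hx => Or.inr ⟨?_, e, ?_, ?_⟩⟩
  · intro y hy
    obtain ⟨i, hi⟩ := hcof y hy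
    exact ⟨_, hTS (hzT _), ⟨i, rfl⟩, hi⟩
  · rintro _ - ⟨i, rfl⟩ _ - ⟨j, rfl⟩ hlt
    exact (hF _ (hzT _) _ (hzT _) hlt e).2 (hge i j ((hz.comp hg).lt_iff_lt.1 hlt))
  · obtain ⟨i, hi⟩ := hcof x (hTS hx)
    refine ⟨C.val w (Ico x (z (g i))), ?_, z (g i), hTS (hzT _), ⟨i, rfl⟩, hi,
      (hF x hx _ (hzT _) hi _).2 rfl⟩
    rw [C.val_inter_Ici w (hTS hx) (hTS (hzT (g i))) hi.le]
    congr 1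
    symm
    have := C.val_Ici_eq_tau w (S := S) (z := fun j => z (g (i + j))) (e := e)
      (fun a b h => hz (hg (by omega))) (fun j => hTS (hzT _)) (by
        intro a ha
        obtain ⟨j, hj⟩ := hcof a ha
        exact ⟨j, hj.trans_le (hz.monotone (hg.monotone (by omega)))⟩)
      (fun j => hge _ _ (by omega))
    exact this

theorem exists_leftVal [Finite M] {S T : Set w.dom} [hS : S.OrdConnected] (hTS : T ⊆ S)
    (hdown : ∀ x ∈ T, ∀ y ∈ S, y ≤ x → y ∈ T) (hF : C.Correct w F T) :
    ∃ Z ⊆ T, ∀ x ∈ T, C.LeftVal w F S Z x (C.val w (S ∩ Iio x)) := by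
  by_cases hmin : ∃ y ∈ S, ∀ u ∈ S, y ≤ u
  · obtain ⟨y, hy, hmin⟩ := hmin
    refine ⟨∅, by simp, fun x hx => Or.inl ⟨y, hy, hmin, ?_⟩⟩
    rw [val_inter_Iio_min (hTS hx) hy hmin]
    exact (hF.closed_iff (hdown x hx y hy (hmin x (hTS hx))) hx (hmin x (hTS hx)) _).2 rfl
  rcases T.eq_empty_or_nonempty with rfl | ⟨t, ht⟩
  · exact ⟨∅, by simp, by simp⟩
  push Not at hmin
  obtain ⟨z, hz, -, hzT, hzc⟩ := exists_strictAnti_coinitial ht (fun x hx => by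
    obtain ⟨y, hy, hlt⟩ := hmin x (hTS hx)
    exact ⟨y, hdown x hx y hy hlt.le, hlt⟩)
  obtain ⟨g, e, hg, hge⟩ := exists_homogeneous_subsequence
    (fun i j => C.val w (Ico (z j) (z i)))
  have hcof : ∀ x ∈ S, ∃ i, z (g i) < x := by
    intro x hx
    obtain ⟨i, hi⟩ : ∃ i, z i < x := by
      rcases le_total t x with h | h
      · obtain ⟨i, hi⟩ := hzc t ht
        exact ⟨i, hi.trans_le h⟩
      · exact hzc x (hdown t ht x hx h)
    exact ⟨i, (hz.antitone (hg.id_le i)).trans_lt hi⟩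
  refine ⟨range (z ∘ g), by rintro _ ⟨i, rfl⟩; exact hzT _, fun x hx => Or.inr ⟨?_, e, ?_, ?_⟩⟩
  · intro y hy
    obtain ⟨i, hi⟩ := hcof y hy
    exact ⟨_, hTS (hzT _), ⟨i, rfl⟩, hi⟩
  · rintro _ - ⟨i, rfl⟩ _ - ⟨j, rfl⟩ hlt
    exact (hF _ (hzT _) _ (hzT _) hlt e).2 (hge j i ((hz.comp_strictMono hg).lt_iff_gt.1 hlt))
  · obtain ⟨i, hi⟩ := hcof x (hTS hx)
    refine ⟨C.val w (Ico (z (g i)) x), ?_, z (g i), hTS (hzT _), ⟨i, rfl⟩, hi,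
      (hF _ (hzT _) x hx hi _).2 rfl⟩
    rw [C.val_inter_Iio w (hTS (hzT (g i))) (hTS hx) hi.le]
    congr 1
    symm
    have := C.val_Iio_eq_tauRev w (S := S) (z := fun j => z (g (i + j))) (e := e)
      (fun a b h => hz (hg (by omega))) (fun j => hTS (hzT _)) (by
        intro a ha
        obtain ⟨j, hj⟩ := hcof a ha
        exact ⟨j, (hz.antitone (hg.monotone (by omega))).trans_lt hj⟩)
      (fun j => hge _ _ (by omega))
    exact this

end CountableMonoid

/-! ### Convex equivalence relations -/

/-- An equivalence relation on a linear order whose classes are convex. -/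
structure ConvexEquiv {X : Type*} [LinearOrder X] (R : X → X → Prop) : Prop where
  refl : ∀ x, R x x
  symm : ∀ {x y}, R x y → R y x
  trans : ∀ {x y z}, R x y → R y z → R x z
  convex : ∀ {x t y}, x ≤ t → t ≤ y → R x y → R x t

namespace ConvexEquiv

variable {X : Type*} [LinearOrder X] {R : X → X → Prop}

theorem ordConnected (hR : ConvexEquiv R) (x : X) : {y | R x y}.OrdConnected := by
  refine ⟨fun a ha b hb t ht => ?_⟩
  have hab : R a b := hR.trans (hR.symm ha) hb
  exact hR.trans ha (hR.convex ht.1 ht.2 hab)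

theorem convex' (hR : ConvexEquiv R) {x t y : X} (h1 : x ≤ t) (h2 : t ≤ y) (h : R x y) : R t y :=
  hR.trans (hR.symm (hR.convex h1 h2 h)) h

/-- Inequivalent points have classes in the same order. -/
theorem lt_of_lt (hR : ConvexEquiv R) {x y x' y' : X} (hxy : x < y) (h : ¬ R x y)
    (hx : R x x') (hy : R y y') : x' < y' := by
  by_contra hle
  rw [not_lt] at hle
  rcases le_or_gt x y' with h1 | h1
  · exact h (hR.trans (hR.convex h1 hle hx) (hR.symm hy))
  · exact h (hR.convex' h1.le hxy.le (hR.symm hy))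

theorem exists_rep (hR : ConvexEquiv R) :
    ∃ rep : X → X, (∀ x, R x (rep x)) ∧ ∀ x y, R x y ↔ rep x = rep y := by
  let s : Setoid X := ⟨R, hR.refl, hR.symm, hR.trans⟩
  have h1 : ∀ x, R x ((Quotient.mk s x).out) := fun x => hR.symm (Quotient.mk_out (s := s) x)
  refine ⟨fun x => (Quotient.mk s x).out, h1, fun x y => ⟨fun h => ?_, fun h => ?_⟩⟩
  · have : Quotient.mk s x = Quotient.mk s y := Quotient.sound h
    simp only [this]
  · have h2 := h1 x
    simp only [h] at h2
    exact hR.trans h2 (hR.symm (h1 y))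

end ConvexEquiv

/-- Membership in `S` and in `T` is constant on the interval between `x` and `y`. -/
def SameColour {X : Type*} [LinearOrder X] (S T : Set X) (x y : X) : Prop :=
  ∀ t, (x ≤ t ∧ t ≤ y ∨ y ≤ t ∧ t ≤ x) → ((t ∈ S ↔ x ∈ S) ∧ (t ∈ T ↔ x ∈ T))

theorem SameColour.convexEquiv {X : Type*} [LinearOrder X] (S T : Set X) :
    ConvexEquiv (SameColour S T) where
  refl x t ht := by
    have : t = x := by rcases ht with h | h <;> exact le_antisymm (by tauto) (by tauto)
    simp [this]
  symm {x y} h t ht := by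
    have h1 := h t ht.symm
    have h2 := h y (by rcases le_total x y with h | h <;> simp [h])
    exact ⟨h1.1.trans h2.1.symm, h1.2.trans h2.2.symm⟩
  trans {x y z} h h' t ht := by
    have h2 := h y (by rcases le_total x y with h | h <;> simp [h])
    by_cases hc : x ≤ t ∧ t ≤ y ∨ y ≤ t ∧ t ≤ x
    · exact h t hc
    · have h1 := h' t (by
        rcases le_total t y with h3 | h3 <;> rcases le_total x t with h4 | h4 <;> tauto)
      exact ⟨h1.1.trans h2.1, h1.2.trans h2.2⟩
  convex {x t y} h1 h2 h s hs := by
    refine h s (Or.inl ?_)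
    rcases hs with h3 | h3
    · exact ⟨h3.1, h3.2.trans h2⟩
    · exact ⟨h1.trans h3.1, (h3.2.trans h1).trans h2⟩

/-- The points of a countable linear order can be coloured with three colours so that no interval
with at least two points is monochromatic. -/
theorem exists_colouring (X : Type*) [LinearOrder X] [Countable X] :
    ∃ c : X → Fin 3, ∀ x y, x < y → ∃ t, x ≤ t ∧ t ≤ y ∧ c t ≠ c x := by
  obtain ⟨e, he⟩ := exists_injective_nat X
  let N : X → X → Prop := fun s t => e s < e t ∧
    ∀ u, e u < e t → ¬ (s < u ∧ u < t) ∧ ¬ (t < u ∧ u < s)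
  have wf : WellFounded fun s t : X => e s < e t := (measure e).wf
  let c : X → Fin 3 := wf.fix fun t ih =>
    Classical.epsilon fun col => ∀ s (h : N s t), ih s h.1 ≠ col
  have hc : ∀ t s, N s t → c s ≠ c t := by
    intro t
    have hfix : c t = Classical.epsilon fun col => ∀ s, N s t → c s ≠ col :=
      wf.fix_eq _ t
    have hex : ∃ col, ∀ s, N s t → c s ≠ col := by
      have key : ∀ s s', N s t → N s' t → (s < t ↔ s' < t) → s = s' := by
        intro s s' hs hs' hiff
        have h0 : s ≠ t := fun h => absurd hs.1 (by simp [h])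
        have h0' : s' ≠ t := fun h => absurd hs'.1 (by simp [h])
        have h1 := hs.2 s' hs'.1
        have h2 := hs'.2 s hs.1
        rcases lt_trichotomy s s' with h | h | h
        · rcases lt_or_gt_of_ne h0' with h3 | h3
          · exact absurd ⟨h, h3⟩ h1.1
          · rcases lt_or_gt_of_ne h0 with h4 | h4
            · exact absurd (hiff.1 h4) h3.not_gt
            · exact absurd ⟨h4, h⟩ h2.2
        · exact h
        · rcases lt_or_gt_of_ne h0 with h3 | h3
          · exact absurd ⟨h, h3⟩ h2.1
          · rcases lt_or_gt_of_ne h0' with h4 | h4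
            · exact absurd (hiff.2 h4) h3.not_gt
            · exact absurd ⟨h4, h⟩ h1.2
      have side : ∀ b : Prop, ∃ col : Fin 3, ∀ s, N s t → (s < t ↔ b) → c s = col := by
        intro b
        by_cases h : ∃ s, N s t ∧ (s < t ↔ b)
        · obtain ⟨s, hs, hb⟩ := h
          exact ⟨c s, fun s' hs' hb' => congrArg c (key s' s hs' hs (hb'.trans hb.symm))⟩
        · exact ⟨0, fun s hs hb => absurd ⟨s, hs, hb⟩ h⟩
      obtain ⟨c1, h1⟩ := side True
      obtain ⟨c2, h2⟩ := side False
      obtain ⟨c3, h3, h4⟩ : ∃ c3 : Fin 3, c1 ≠ c3 ∧ c2 ≠ c3 :=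
        (by decide : ∀ a b : Fin 3, ∃ d : Fin 3, a ≠ d ∧ b ≠ d) c1 c2
      refine ⟨c3, fun s hs => ?_⟩
      by_cases hst : s < t
      · rw [h1 s hs (by simp [hst])]; exact h3
      · rw [h2 s hs (by simp [hst])]; exact h4
    rw [hfix]
    exact Classical.epsilon_spec hex
  refine ⟨c, fun x y hxy => ?_⟩
  obtain ⟨m, hm, hmin⟩ := (measure e).wf.has_min (Set.Icc x y) ⟨x, le_rfl, hxy.le⟩
  obtain ⟨m', hm', hmin'⟩ := (measure e).wf.has_min (Set.Icc x y \ {m}) (by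
    by_cases h : x = m
    · exact ⟨y, ⟨hxy.le, le_rfl⟩, fun h' => hxy.ne (h.trans h'.symm)⟩
    · exact ⟨x, ⟨le_rfl, hxy.le⟩, h⟩)
  have hlt : e m < e m' :=
    lt_of_le_of_ne (not_lt.1 (hmin m' hm'.1)) fun h => hm'.2 (he h).symm
  have hN : N m m' := by
    refine ⟨hlt, fun u hu => ⟨?_, ?_⟩⟩
    · rintro ⟨h1, h2⟩
      exact hmin' u ⟨⟨hm.1.trans h1.le, h2.le.trans hm'.1.2⟩, h1.ne'⟩ hu
    · rintro ⟨h1, h2⟩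
      exact hmin' u ⟨⟨hm'.1.1.trans h1.le, h2.le.trans hm.2⟩, h2.ne⟩ hu
  have hne := hc _ _ hN
  by_cases h : c m = c x
  · exact ⟨m', hm'.1.1, hm'.1.2, fun h' => hne (h.trans h'.symm)⟩
  · exact ⟨m, hm.1, hm.2, h⟩

/-- On a countable linear order, a convex equivalence relation is coded by two sets. -/
theorem ConvexEquiv.exists_sameColour {X : Type*} [LinearOrder X] [Countable X]
    {R : X → X → Prop} (hR : ConvexEquiv R) : ∃ S T : Set X, R = SameColour S T := by
  obtain ⟨rep, h1, h2⟩ := hR.exists_rep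
  obtain ⟨c, hc⟩ := exists_colouring (Set.range rep)
  let d : X → Fin 3 := fun x => c ⟨rep x, x, rfl⟩
  have hd : ∀ x y, R x y → d x = d y := by
    intro x y h
    have := (h2 x y).1 h
    simp only [d, this]
  have key : ∀ x y, x < y → ¬ R x y → ∃ t, x ≤ t ∧ t ≤ y ∧ d t ≠ d x := by
    intro x y hxy h
    have hlt := hR.lt_of_lt hxy h (h1 x) (h1 y)
    obtain ⟨⟨t, s, rfl⟩, h3, h4, h5⟩ := hc ⟨rep x, x, rfl⟩ ⟨rep y, y, rfl⟩ hlt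
    change rep x ≤ rep s at h3
    change rep s ≤ rep y at h4
    have h5 : d s ≠ d x := h5
    have hs : ¬ R s x := fun h' => h5 (hd _ _ h')
    by_cases hsy : R s y
    · exact ⟨y, hxy.le, le_rfl, by rwa [← hd s y hsy]⟩
    · refine ⟨s, ?_, ?_, h5⟩
      · by_contra hlt'
        exact absurd (hR.lt_of_lt (not_le.1 hlt') hs (h1 s) (h1 x)) h3.not_gt
      · by_contra hlt'
        exact absurd (hR.lt_of_lt (not_le.1 hlt') (fun h' => hsy (hR.symm h')) (h1 y) (h1 s))
          h4.not_gt
  refine ⟨{x | d x = 0}, {x | d x = 1}, ?_⟩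
  have hfin : ∀ a b : Fin 3, ((a = 0 ↔ b = 0) ∧ (a = 1 ↔ b = 1)) → a = b := by decide
  have hback : ∀ x y, x < y → SameColour {x | d x = 0} {x | d x = 1} x y → R x y := by
    intro x y hxy h
    by_contra hn
    obtain ⟨t, h3, h4, h5⟩ := key x y hxy hn
    exact h5 (hfin _ _ (h t (Or.inl ⟨h3, h4⟩)))
  funext x y
  refine propext ⟨fun h t ht => ?_, fun h => ?_⟩
  · have : R x t := by
      rcases ht with ht | ht
      · exact hR.convex ht.1 ht.2 h
      · exact hR.symm (hR.convex' ht.1 ht.2 (hR.symm h))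
    simp [hd x t this]
  · rcases lt_trichotomy x y with hlt | rfl | hlt
    · exact hback x y hlt h
    · exact hR.refl x
    · exact hR.symm (hback y x hlt ((SameColour.convexEquiv _ _).symm h))

/-- The interval `[x, y]` meets at most two classes of `R`. -/
def MeetsTwo {X : Type*} [LinearOrder X] (R : X → X → Prop) (x y : X) : Prop :=
  ∀ u, x ≤ u → u ≤ y → R x u ∨ R u y

/-- The interval `[x, y]` meets at most three classes of `R`. -/
def MeetsThree {X : Type*} [LinearOrder X] (R : X → X → Prop) (x y : X) : Prop :=
  ∃ z, x ≤ z ∧ z ≤ y ∧ ∀ u, x ≤ u → u ≤ y → R x u ∨ R u y ∨ R z u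

/-- A relation `g` inherited by subintervals contains a convex equivalence relation such that
every interval in `g` meets at most three of its classes. -/
theorem exists_maximal_convexEquiv {X : Type*} [LinearOrder X] {g : X → X → Prop}
    (hg : ∀ x x' y' y, x ≤ x' → x' ≤ y' → y' ≤ y → g x y → g x' y') :
    ∃ R : X → X → Prop, ConvexEquiv R ∧ (∀ x y, x < y → R x y → g x y) ∧
      (∀ x y, x < y → g x y → MeetsThree R x y) ∧ ((∀ x y, g x y) → ∀ x y, R x y) := by
  obtain ⟨R, -, hmax⟩ := zorn_le_nonempty₀
    {R : X → X → Prop | ConvexEquiv R ∧ ∀ x y, x < y → R x y → g x y} (by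
      intro c hc hchain R₁ hR₁
      have hdir : ∀ R ∈ c, ∀ S ∈ c, R ≤ S ∨ S ≤ R := fun R hR S hS => hchain.total hR hS
      refine ⟨fun x y => ∃ R ∈ c, R x y, ⟨⟨fun x => ⟨R₁, hR₁, (hc hR₁).1.refl x⟩, ?_, ?_, ?_⟩, ?_⟩,
        fun R hR x y h => ⟨R, hR, h⟩⟩
      · rintro x y ⟨R, hR, h⟩
        exact ⟨R, hR, (hc hR).1.symm h⟩
      · rintro x y z ⟨R, hR, h⟩ ⟨S, hS, h'⟩
        rcases hdir R hR S hS with hle | hle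
        · exact ⟨S, hS, (hc hS).1.trans (hle _ _ h) h'⟩
        · exact ⟨R, hR, (hc hR).1.trans h (hle _ _ h')⟩
      · rintro x t y h1 h2 ⟨R, hR, h⟩
        exact ⟨R, hR, (hc hR).1.convex h1 h2 h⟩
      · rintro x y hxy ⟨R, hR, h⟩
        exact (hc hR).2 x y hxy h) Eq
    ⟨⟨fun _ => rfl, Eq.symm, Eq.trans, by rintro x t y h1 h2 rfl; exact le_antisymm h1 h2⟩,
      fun x y hxy h => absurd h hxy.ne⟩
  obtain ⟨⟨hR, hRg⟩, hmax⟩ := hmax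
  refine ⟨R, hR, hRg, fun x y hxy hgxy => ?_, fun hall x y => ?_⟩
  · let D : X → Prop := fun t => (x < t ∧ t < y) ∧ ¬ R x t ∧ ¬ R t y
    have hDR : ∀ {t t'}, D t → R t t' → D t' := by
      intro t t' ht htt'
      refine ⟨⟨?_, ?_⟩, fun h => ht.2.1 (hR.trans h (hR.symm htt')),
        fun h => ht.2.2 (hR.trans htt' h)⟩
      · exact hR.lt_of_lt ht.1.1 ht.2.1 (hR.refl x) htt'
      · exact hR.lt_of_lt ht.1.2 ht.2.2 htt' (hR.refl y)
    have hDc : ∀ {p t q}, D p → D q → p ≤ t → t ≤ q → D t := by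
      intro p t q hp hq h1 h2
      exact ⟨⟨hp.1.1.trans_le h1, h2.trans_lt hq.1.2⟩,
        fun h => hp.2.1 (hR.convex hp.1.1.le h1 h), fun h => hq.2.2 (hR.convex' h2 hq.1.2.le h)⟩
    have hmerge := @hmax (fun p q => R p q ∨ (D p ∧ D q)) (by
      refine ⟨⟨fun p => Or.inl (hR.refl p), ?_, ?_, ?_⟩, ?_⟩
      · rintro p q (h | h)
        · exact Or.inl (hR.symm h)
        · exact Or.inr h.symm
      · rintro p q r (h | h) (h' | h')
        · exact Or.inl (hR.trans h h')
        · exact Or.inr ⟨hDR h'.1 (hR.symm h), h'.2⟩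
        · exact Or.inr ⟨h.1, hDR h.2 h'⟩
        · exact Or.inr ⟨h.1, h'.2⟩
      · rintro p t q h1 h2 (h | h)
        · exact Or.inl (hR.convex h1 h2 h)
        · exact Or.inr ⟨h.1, hDc h.1 h.2 h1 h2⟩
      · rintro p q hpq (h | h)
        · exact hRg p q hpq h
        · exact hg x p q y h.1.1.1.le hpq.le h.2.1.2.le hgxy) (fun p q h => Or.inl h)
    have hD : ∀ p q, D p → D q → R p q := fun p q hp hq => hmerge p q (Or.inr ⟨hp, hq⟩)
    have hcases : ∀ u, x ≤ u → u ≤ y → R x u ∨ R u y ∨ D u := by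
      intro u h1 h2
      by_cases h3 : R x u
      · exact Or.inl h3
      by_cases h4 : R u y
      · exact Or.inr (Or.inl h4)
      refine Or.inr (Or.inr ⟨⟨lt_of_le_of_ne h1 ?_, lt_of_le_of_ne h2 ?_⟩, h3, h4⟩)
      · rintro rfl; exact h3 (hR.refl x)
      · rintro rfl; exact h4 (hR.refl u)
    by_cases hne : ∃ z, D z
    · obtain ⟨z, hz⟩ := hne
      exact ⟨z, hz.1.1.le, hz.1.2.le, fun u h1 h2 =>
        (hcases u h1 h2).imp_right (Or.imp_right fun h => hD z u hz h)⟩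
    · refine ⟨x, le_rfl, hxy.le, fun u h1 h2 =>
        (hcases u h1 h2).imp_right (Or.imp_right fun h => absurd ⟨u, h⟩ hne)⟩
  · exact @hmax (fun _ _ => True) ⟨⟨fun _ => trivial, fun _ => trivial, fun _ _ => trivial,
      fun _ _ _ => trivial⟩, fun x y _ _ => hall x y⟩ (fun _ _ _ => trivial) x y trivial

namespace CountableMonoid

variable {M : Type v} (C : CountableMonoid M) (w : Word M)

/-! ### Values of shuffles of convex classes -/

theorem exists_shuffle_of_dense {R : w.dom → w.dom → Prop} (hR : ConvexEquiv R) {x y : w.dom}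
    (hxy : x < y) (hn : ¬ R x y) {P : Set M} (hP : P.Nonempty)
    (hmem : ∀ z, x < z → z < y → ¬ R x z → ¬ R z y → C.val w {t | R z t} ∈ P)
    (hdense : ∀ u v, x ≤ u → u < v → v ≤ y → ¬ R u v → ∀ p ∈ P, ∃ z, u < z ∧ z < v ∧
      ¬ R u z ∧ ¬ R z v ∧ C.val w {t | R z t} = p) :
    ∃ W : Word M, W.IsShuffle P ∧ C.val w (Ico x y) =
      C.mul (C.val w ({t | R x t} ∩ Ici x))
        (C.mul (C.prod W) (C.val w ({t | R y t} ∩ Iio y))) := by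
  obtain ⟨rep, h1, h2⟩ := hR.exists_rep
  let D : w.dom → Prop := fun z => x < z ∧ z < y ∧ ¬ R x z ∧ ¬ R z y
  have hDR : ∀ {t t'}, D t → R t t' → D t' := by
    intro t t' ht htt'
    exact ⟨hR.lt_of_lt ht.1 ht.2.2.1 (hR.refl x) htt', hR.lt_of_lt ht.2.1 ht.2.2.2 htt' (hR.refl y),
      fun h => ht.2.2.1 (hR.trans h (hR.symm htt')), fun h => ht.2.2.2 (hR.trans htt' h)⟩
  let ι : Type := {t : w.dom // rep t = t ∧ D t}
  have hrr : ∀ t, rep (rep t) = rep t := fun t => ((h2 t (rep t)).1 (h1 t)).symm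
  let mk : ∀ z, D z → ι := fun z hz => ⟨rep z, hrr z, hDR hz (h1 z)⟩
  have hne : ∀ i j : ι, i < j → ¬ R i.1 j.1 := by
    intro i j hij h
    have := (h2 _ _).1 h
    rw [i.2.1, j.2.1] at this
    exact hij.ne (Subtype.ext this)
  have hcls : ∀ z t, R z t → {s | R z s} = {s | R t s} := by
    intro z t hzt
    ext s
    exact ⟨fun h => hR.trans (hR.symm hzt) h, fun h => hR.trans hzt h⟩
  let W : Word M := ⟨ι, fun i => C.val w {t | R i.1 t}⟩
  have key : ∀ u v, x ≤ u → u < v → v ≤ y → ¬ R u v → ∀ p ∈ P, ∃ k : ι, u < k.1 ∧ k.1 < v ∧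
      W.letter k = p := by
    intro u v hu huv hv hn p hp
    obtain ⟨z, hz1, hz2, hz3, hz4, hz5⟩ := hdense u v hu huv hv hn p hp
    have hxz : x < z := hu.trans_lt hz1
    have hzy : z < y := hz2.trans_le hv
    refine ⟨mk z ⟨hxz, hzy, fun h => hz3 (hR.convex' hu hz1.le h),
      fun h => hz4 (hR.convex hz2.le hv h)⟩, hR.lt_of_lt hz1 hz3 (hR.refl u) (h1 z),
      hR.lt_of_lt hz2 hz4 (h1 z) (hR.refl v), ?_⟩
    change C.val w {t | R (rep z) t} = p
    rw [← hcls z _ (h1 z), hz5]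
  obtain ⟨p₀, hp₀⟩ := hP
  have hW : W.IsShuffle P := by
    refine ⟨?_, fun i => hmem i.1 i.2.2.1 i.2.2.2.1 i.2.2.2.2.1 i.2.2.2.2.2, ?_⟩
    · have : Nonempty ι := by
        obtain ⟨k, -⟩ := key x y le_rfl hxy le_rfl hn p₀ hp₀
        exact ⟨k⟩
      have : NoMinOrder ι := ⟨fun i => by
        obtain ⟨k, -, hk, -⟩ := key x i.1 le_rfl i.2.2.1 i.2.2.2.1.le i.2.2.2.2.1 p₀ hp₀
        exact ⟨k, hk⟩⟩
      have : NoMaxOrder ι := ⟨fun i => by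
        obtain ⟨k, hk, -⟩ := key i.1 y i.2.2.1.le i.2.2.2.1 le_rfl i.2.2.2.2.2 p₀ hp₀
        exact ⟨k, hk⟩⟩
      have : DenselyOrdered ι := ⟨fun i j hij => by
        obtain ⟨k, hk, hk', -⟩ := key i.1 j.1 i.2.2.1.le hij j.2.2.2.1.le (hne i j hij) p₀ hp₀
        exact ⟨k, hk, hk'⟩⟩
      exact Order.iso_of_countable_dense ι ℚ
    · intro p hp i j hij
      exact key i.1 j.1 i.2.2.1.le hij j.2.2.2.1.le (hne i j hij) p hp
  refine ⟨W, hW, ?_⟩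
  have hprod : C.prod W = C.val w (⋃ i : ι, {t | R i.1 t}) := by
    rw [C.val_iUnion]
    intro i j hij a ha b hb
    exact hR.lt_of_lt hij (hne i j hij) ha hb
  have hU : (⋃ i : ι, {t | R i.1 t}) = {z | D z} := by
    ext z
    simp only [mem_iUnion, mem_ofPred_eq]
    exact ⟨fun ⟨i, hi⟩ => hDR i.2.2 hi, fun hz => ⟨mk z hz, hR.symm (h1 z)⟩⟩
  rw [hprod, hU, ← C.val_union, ← C.val_union]
  · congr 1
    ext z
    simp only [mem_Ico, mem_union, mem_inter_iff, mem_ofPred_eq, mem_Ici, mem_Iio, D]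
    constructor
    · rintro ⟨h3, h4⟩
      by_cases h5 : R x z
      · exact Or.inl ⟨h5, h3⟩
      by_cases h6 : R z y
      · exact Or.inr (Or.inr ⟨hR.symm h6, h4⟩)
      · refine Or.inr (Or.inl ⟨lt_of_le_of_ne h3 ?_, h4, h5, h6⟩)
        rintro rfl; exact h5 (hR.refl x)
    · rintro (⟨h3, h4⟩ | ⟨h3, h4, -⟩ | ⟨h3, h4⟩)
      · exact ⟨h4, hR.lt_of_lt hxy hn h3 (hR.refl y)⟩
      · exact ⟨h3.le, h4⟩
      · exact ⟨(hR.lt_of_lt hxy hn (hR.refl x) h3).le, h4⟩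
  · rintro a ⟨ha, -⟩ b (hb | ⟨hb, -⟩)
    · exact hR.lt_of_lt hb.1 hb.2.2.1 ha (hR.refl b)
    · exact hR.lt_of_lt hxy hn ha hb
  · rintro a ha b ⟨hb, -⟩
    exact hR.lt_of_lt ha.2.1 ha.2.2.2 (hR.refl a) hb

/-! ### The consistency conditions -/

variable (F : M → w.dom → w.dom → Prop) (X Y₁ Y₂ Z₁ Z₂ : Set w.dom)

/-- According to `F`, the class of `z` for the relation coded by `Y₁, Y₂` has value `m`. -/
def ClassVal (z : w.dom) (m : M) : Prop :=
  ∃ a b, C.mul a b = m ∧ C.LeftVal w F {t | SameColour Y₁ Y₂ z t} Z₁ z a ∧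
    C.RightVal w F {t | SameColour Y₁ Y₂ z t} Z₂ z b

/-- According to `F`, the classes strictly between those of `x` and `y` form a shuffle of `P`. -/
def ShuffleBetween (P : Set M) (x y : w.dom) : Prop :=
  (∀ z, x < z → z < y → ¬ SameColour Y₁ Y₂ x z → ¬ SameColour Y₁ Y₂ z y →
    ∃ m ∈ P, C.ClassVal w F Y₁ Y₂ Z₁ Z₂ z m) ∧
  ∀ u v, x ≤ u → u < v → v ≤ y → ¬ SameColour Y₁ Y₂ u v → ∀ m ∈ P, ∃ z, u < z ∧ z < v ∧
    ¬ SameColour Y₁ Y₂ u z ∧ ¬ SameColour Y₁ Y₂ z v ∧ C.ClassVal w F Y₁ Y₂ Z₁ Z₂ z m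

/-- The conditions characterizing the relations `F` that give the correct values of all intervals,
and asking for the value of the word to be in `Acc`. The map `K` gives the values of shuffles. -/
structure Consistent (K : Set M → M) (Acc : Set M) : Prop where
  unique : ∀ x y, x < y → ∀ m m', F m x y → F m' x y → m = m'
  add : ∀ x y z, x < y → y < z → ∀ a b, F a x y → F b y z → F (C.mul a b) x z
  cut : (∀ x y, y ∈ X → x < y → x ∈ X) → ∀ x, x ∈ X → ∀ y, y ∉ X → ∀ a b,
    C.RightVal w F X Z₂ x a → C.LeftVal w F Xᶜ Z₁ y b → F (C.mul a b) x y
  shuffle : ∀ x y, x < y → ¬ SameColour Y₁ Y₂ x y → ∀ P : Set M, P.Nonempty →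
    C.ShuffleBetween w F Y₁ Y₂ Z₁ Z₂ P x y → ∀ a b,
    C.RightVal w F {t | SameColour Y₁ Y₂ x t} Z₂ x a →
    C.LeftVal w F {t | SameColour Y₁ Y₂ y t} Z₁ y b → F (C.mul a (C.mul (K P) b)) x y
  accept : ∀ x a b, C.LeftVal w F univ Z₁ x a → C.RightVal w F univ Z₂ x b → C.mul a b ∈ Acc

variable {C w F} {K : Set M → M} {Acc : Set M}

theorem ClassVal.eq_val (hF : C.Correct w F univ) {z : w.dom} {m : M}
    (h : C.ClassVal w F Y₁ Y₂ Z₁ Z₂ z m) : C.val w {t | SameColour Y₁ Y₂ z t} = m := by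
  have hE := SameColour.convexEquiv Y₁ Y₂
  obtain ⟨a, b, hab, ha, hb⟩ := h
  have := hE.ordConnected z
  rw [C.val_split w _ z, ha.eq_val (hE.refl z) (hF.mono (subset_univ _)),
    hb.eq_val (hE.refl z) (hF.mono (subset_univ _)), hab]

/-- A correct relation satisfies the consistency conditions. -/
theorem Correct.consistent (hF : C.Correct w F univ)
    (hK : ∀ P : Set M, P.Nonempty → ∀ W : Word M, W.IsShuffle P → K P = C.prod W)
    (hacc : C.prod w ∈ Acc) : C.Consistent w F X Y₁ Y₂ Z₁ Z₂ K Acc where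
  unique x y hxy m m' h h' := by
    rw [hF x trivial y trivial hxy] at h h'
    exact h.symm.trans h'
  add x y z hxy hyz a b ha hb := by
    rw [hF _ trivial _ trivial (by order)] at ha hb ⊢
    rw [C.val_Ico_mul_Ico w hxy.le hyz.le, ha, hb]
  cut hX x hx y hy a b ha hb := by
    have hxy : x < y := by
      by_contra h
      rcases (not_lt.1 h).eq_or_lt with rfl | h
      · exact hy hx
      · exact hy (hX _ _ hx h)
    have h1 : X.OrdConnected := ⟨fun p hp q hq t ht => by
      rcases ht.2.eq_or_lt with rfl | h
      · exact hq
      · exact hX _ _ hq h⟩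
    have h2 : Xᶜ.OrdConnected := ⟨fun p hp q hq t ht htX => by
      rcases ht.1.eq_or_lt with rfl | h
      · exact hp htX
      · exact hp (hX _ _ htX h)⟩
    have h3 := ha.eq_val hx (hF.mono (subset_univ _))
    have h4 := hb.eq_val hy (hF.mono (subset_univ _))
    rw [hF _ trivial _ trivial hxy, ← h3, ← h4, ← C.val_union]
    · congr 1
      ext t
      simp only [mem_Ico, mem_union, mem_inter_iff, mem_Ici, mem_compl_iff, mem_Iio]
      constructor
      · intro ht
        by_cases htX : t ∈ X
        · exact Or.inl ⟨htX, ht.1⟩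
        · exact Or.inr ⟨htX, ht.2⟩
      · rintro (⟨h5, h6⟩ | ⟨h5, h6⟩)
        · refine ⟨h6, lt_of_not_ge fun h => ?_⟩
          rcases h.eq_or_lt with rfl | h
          · exact hy h5
          · exact hy (hX _ _ h5 h)
        · refine ⟨le_of_not_gt fun h => h5 (hX _ _ hx h), h6⟩
    · rintro p ⟨hp, -⟩ q ⟨hq, -⟩
      by_contra h
      rcases (not_lt.1 h).eq_or_lt with rfl | h
      · exact hq hp
      · exact hq (hX _ _ hp h)
  shuffle x y hxy hn P hP hsh a b ha hb := by
    have hE := SameColour.convexEquiv Y₁ Y₂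
    obtain ⟨W, hW, hval⟩ := C.exists_shuffle_of_dense w hE hxy hn hP
      (fun z h1 h2 h3 h4 => by
        obtain ⟨m, hm, h⟩ := hsh.1 z h1 h2 h3 h4
        rwa [h.eq_val _ _ _ _ hF])
      (fun u v h1 h2 h3 h4 p hp => by
        obtain ⟨z, h5, h6, h7, h8, h9⟩ := hsh.2 u v h1 h2 h3 h4 p hp
        exact ⟨z, h5, h6, h7, h8, h9.eq_val _ _ _ _ hF⟩)
    have := hE.ordConnected x
    have := hE.ordConnected y
    rw [hF _ trivial _ trivial hxy, hval, hK P hP W hW,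
      ha.eq_val (hE.refl x) (hF.mono (subset_univ _)),
      hb.eq_val (hE.refl y) (hF.mono (subset_univ _))]
  accept x a b ha hb := by
    have h1 := ha.eq_val trivial (hF.mono (subset_univ _))
    have h2 := hb.eq_val trivial (hF.mono (subset_univ _))
    rw [← h1, ← h2, ← C.val_split, C.val_univ]
    exact hacc

/-- The consistency conditions, for all set parameters, imply correctness. -/
theorem correct_of_consistent [Finite M]
    (hK : ∀ P : Set M, P.Nonempty → ∀ W : Word M, W.IsShuffle P → K P = C.prod W)
    (hc : ∀ X Y₁ Y₂ Z₁ Z₂, C.Consistent w F X Y₁ Y₂ Z₁ Z₂ K Acc) : C.Correct w F univ := by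
  have hone : ∀ x y, x < y → F (C.val w (Ico x y)) x y →
      ∀ m, F m x y ↔ C.val w (Ico x y) = m := fun x y hxy h m =>
    ⟨fun h' => (hc ∅ ∅ ∅ ∅ ∅).unique x y hxy _ _ h h', fun h' => h' ▸ h⟩
  let R : w.dom → w.dom → Prop := fun x y => C.Correct w F (uIcc x y)
  have hRF : ∀ {x y}, x < y → R x y → F (C.val w (Ico x y)) x y := fun {x y} hxy h =>
    (h x left_mem_uIcc y right_mem_uIcc hxy _).2 rfl
  have hsub : ∀ {x y x' y'}, x' ∈ uIcc x y → y' ∈ uIcc x y → R x y → R x' y' :=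
    fun {x y x' y'} h1 h2 h => h.mono (uIcc_subset_uIcc h1 h2)
  have hadd : ∀ {x y z}, x < y → y < z → R x y → R y z → F (C.val w (Ico x z)) x z := by
    intro x y z hxy hyz h1 h2
    rw [C.val_Ico_mul_Ico w hxy.le hyz.le]
    exact (hc ∅ ∅ ∅ ∅ ∅).add x y z hxy hyz _ _ (hRF hxy h1) (hRF hyz h2)
  have htrans : ∀ {x y z}, R x y → R y z → R x z := by
    intro x y z h1 h2 p hp q hq hpq
    have hmem : ∀ t, t ∈ uIcc x z → t ∈ uIcc x y ∨ t ∈ uIcc y z := fun t ht =>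
      uIcc_subset_uIcc_union_uIcc ht
    have hy1 : y ∈ uIcc x y := right_mem_uIcc
    have hy2 : y ∈ uIcc y z := left_mem_uIcc
    have hcase : ∀ a b c d : w.dom, p ∈ uIcc a b → q ∈ uIcc c d → R a b → R c d →
        y ∈ uIcc a b → y ∈ uIcc c d → ∀ m, F m p q ↔ C.val w (Ico p q) = m := by
      intro a b c d hp hq hab hcd hy hy'
      rcases lt_or_ge p y with h3 | h3
      · rcases lt_or_ge y q with h4 | h4
        · exact hone p q hpq (hadd h3 h4 (hsub hp hy hab) (hsub hy' hq hcd))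
        · have : q ∈ uIcc a b := (uIcc_subset_uIcc hp hy) (by
            rw [uIcc_of_le h3.le]; exact ⟨hpq.le, h4⟩)
          exact hab p hp q this hpq
      · have : p ∈ uIcc c d := (uIcc_subset_uIcc hy' hq) (by
            rw [uIcc_of_le (h3.trans hpq.le)]; exact ⟨h3, hpq.le⟩)
        exact hcd p this q hq hpq
    rcases hmem p hp with h3 | h3 <;> rcases hmem q hq with h4 | h4
    · exact h1 p h3 q h4 hpq
    · exact hcase x y y z h3 h4 h1 h2 hy1 hy2
    · exact hcase y z x y h3 h4 h2 h1 hy2 hy1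
    · exact h2 p h3 q h4 hpq
  have hR : ConvexEquiv R := by
    refine ⟨fun x p hp q hq hpq => ?_, fun {x y} h => ?_, htrans, fun {x t y} h1 h2 h => ?_⟩
    · rw [uIcc_self] at hp hq
      exact absurd (hp.trans hq.symm) hpq.ne
    · change C.Correct w F (uIcc y x)
      rwa [uIcc_comm]
    · exact hsub left_mem_uIcc (by rw [uIcc_of_le (h1.trans h2)]; exact ⟨h1, h2⟩) h
  have hclass : ∀ x, C.Correct w F {t | R x t} := fun x p hp q hq hpq =>
    hR.trans (hR.symm hp) hq p left_mem_uIcc q right_mem_uIcc hpq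
  -- no two classes are adjacent
  have hbetween : ∀ x y, x < y → ¬ R x y → ∃ z, x < z ∧ z < y ∧ ¬ R x z ∧ ¬ R z y := by
    intro x y hxy hn
    by_contra hno
    push Not at hno
    apply hn
    have hcov : ∀ t, x ≤ t → t ≤ y → R x t ∨ R t y := by
      intro t h1 h2
      rcases h1.eq_or_lt with rfl | h1
      · exact Or.inl (hR.refl _)
      rcases h2.eq_or_lt with rfl | h2
      · exact Or.inr (hR.refl _)
      by_cases h3 : R x t
      · exact Or.inl h3
      · exact Or.inr (hno t h1 h2 h3)
    let X : Set w.dom := {u | ∃ c, R x c ∧ u ≤ c}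
    have hX1 : X.OrdConnected := ⟨fun p hp q ⟨c, h1, h2⟩ t ht => ⟨c, h1, ht.2.trans h2⟩⟩
    have hX2 : Xᶜ.OrdConnected := ⟨fun p hp q hq t ht ⟨c, h1, h2⟩ =>
      hp ⟨c, h1, ht.1.trans h2⟩⟩
    have hT1 : {t | R x t} ⊆ X := fun t ht => ⟨t, ht, le_rfl⟩
    have hT2 : {t | R y t} ⊆ Xᶜ := by
      rintro t ht ⟨c, h1, h2⟩
      exact absurd (hR.lt_of_lt hxy hn h1 ht) h2.not_gt
    obtain ⟨Z₂, -, hZ₂⟩ := exists_rightVal hT1 (by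
      rintro a ha b ⟨c, h1, h2⟩ hab
      exact hR.trans ha (hR.convex hab h2 (hR.trans (hR.symm ha) h1))) (hclass x)
    obtain ⟨Z₁, -, hZ₁⟩ := exists_leftVal hT2 (by
      intro a ha b hb hab
      rcases le_total b y with h | h
      · have hxb : x ≤ b := le_of_not_ge fun h' => hb ⟨x, hR.refl x, h'⟩
        rcases hcov b hxb h with h3 | h3
        · exact absurd (hT1 h3) hb
        · exact hR.symm h3
      · exact hR.convex h hab ha) (hclass y)
    intro p hp q hq hpq
    rw [uIcc_of_le hxy.le] at hp hq
    rcases hcov p hp.1 hp.2 with h1 | h1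
    · rcases hcov q hq.1 hq.2 with h2 | h2
      · exact hclass x p h1 q h2 hpq
      · apply hone p q hpq
        have h2 := hR.symm h2
        have hq' := hT2 h2
        have := (hc X ∅ ∅ Z₁ Z₂).cut (fun a b ⟨c, h3, h4⟩ hab => ⟨c, h3, hab.le.trans h4⟩)
          p (hT1 h1) q hq' _ _ (hZ₂ p h1) (hZ₁ q h2)
        rw [← C.val_union] at this
        · convert this using 2
          ext t
          simp only [mem_Ico, mem_union, mem_inter_iff, mem_Ici, mem_compl_iff, mem_Iio]
          constructor
          · intro ht
            by_cases htX : t ∈ X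
            · exact Or.inl ⟨htX, ht.1⟩
            · exact Or.inr ⟨htX, ht.2⟩
          · rintro (⟨⟨c, h3, h5⟩, h6⟩ | ⟨h5, h6⟩)
            · exact ⟨h6, h5.trans_lt (hR.lt_of_lt hxy hn h3 h2)⟩
            · exact ⟨le_of_not_ge fun h => h5 ⟨p, h1, h⟩, h6⟩
        · rintro a ⟨⟨c, h3, h4⟩, -⟩ b ⟨hb, -⟩
          exact h4.trans_lt (lt_of_not_ge fun h => hb ⟨c, h3, h⟩)
    · have h1' := hR.symm h1
      exact hclass y p h1' q (by
        refine hR.symm (hR.convex' hpq.le hq.2 h1)) hpq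
  by_contra hbad
  obtain ⟨x₀, y₀, hxy₀, hn₀⟩ : ∃ x y, x < y ∧ ¬ R x y := by
    by_contra hall
    push Not at hall
    exact hbad fun x _ y _ hxy => hall x y hxy x left_mem_uIcc y right_mem_uIcc hxy
  -- an interval for which the set of values of the classes inside is minimal
  let Q : w.dom × w.dom → Set M := fun p =>
    {m | ∃ z, p.1 < z ∧ z < p.2 ∧ ¬ R p.1 z ∧ ¬ R z p.2 ∧ C.val w {t | R z t} = m}
  obtain ⟨⟨x, y⟩, ⟨hxy, hn⟩, hmin⟩ := (measure fun p => (Q p).ncard).wf.has_min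
    {p : w.dom × w.dom | p.1 < p.2 ∧ ¬ R p.1 p.2} ⟨(x₀, y₀), hxy₀, hn₀⟩
  have hQsub : ∀ u v, x ≤ u → v ≤ y → Q (u, v) ⊆ Q (x, y) := by
    rintro u v hu hv m ⟨z, h1, h2, h3, h4, h5⟩
    exact ⟨z, hu.trans_lt h1, h2.trans_le hv, fun h => h3 (hR.convex' hu h1.le h),
      fun h => h4 (hR.convex h2.le hv h), h5⟩
  have hQeq : ∀ u v, x ≤ u → u < v → v ≤ y → ¬ R u v → Q (u, v) = Q (x, y) :=
    fun u v h1 h2 h3 h4 => Set.eq_of_subset_of_ncard_le (hQsub u v h1 h3)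
      (not_lt.1 (hmin (u, v) ⟨h2, h4⟩)) (Set.toFinite _)
  obtain ⟨Y₁, Y₂, hY⟩ := hR.exists_sameColour
  obtain ⟨rep, hrep1, hrep2⟩ := hR.exists_rep
  have hcls : ∀ z t, R z t → {s | R z s} = {s | R t s} := by
    intro z t hzt
    ext s
    exact ⟨fun h => hR.trans (hR.symm hzt) h, fun h => hR.trans hzt h⟩
  have hZ₁ : ∃ Z₁, ∀ z, C.LeftVal w F {t | R z t} Z₁ z (C.val w ({t | R z t} ∩ Iio z)) := by
    have := fun x => hR.ordConnected x
    choose Z hZ hZ' using fun x => exists_leftVal (S := {t | R x t}) (T := {t | R x t}) subset_rfl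
      (fun _ _ _ hy _ => hy) (hclass x)
    refine ⟨{z | z ∈ Z (rep z)}, fun z => ?_⟩
    have h := hZ' (rep z) z (hR.symm (hrep1 z))
    rw [← hcls z _ (hrep1 z)] at h
    have hiff : ∀ u ∈ {t | R z t}, (u ∈ {z | z ∈ Z (rep z)} ↔ u ∈ Z (rep z)) := by
      intro u hu
      rw [mem_ofPred_eq, (hrep2 z u).1 hu]
    rcases h with h | ⟨h1, e, h2, b, h3, y, h4, h5, h6⟩
    · exact Or.inl h
    · refine Or.inr ⟨fun y hy => ?_, e, fun y hy hyZ u hu huZ => ?_, b, h3, y, h4, ?_, h6⟩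
      · obtain ⟨u, hu, huZ, hlt⟩ := h1 y hy
        exact ⟨u, hu, (hiff u hu).2 huZ, hlt⟩
      · exact h2 y hy ((hiff y hy).1 hyZ) u hu ((hiff u hu).1 huZ)
      · exact (hiff y h4).2 h5
  have hZ₂ : ∃ Z₂, ∀ z, C.RightVal w F {t | R z t} Z₂ z (C.val w ({t | R z t} ∩ Ici z)) := by
    have := fun x => hR.ordConnected x
    choose Z hZ hZ' using fun x => exists_rightVal (S := {t | R x t}) (T := {t | R x t}) subset_rfl
      (fun _ _ _ hy _ => hy) (hclass x)
    refine ⟨{z | z ∈ Z (rep z)}, fun z => ?_⟩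
    have h := hZ' (rep z) z (hR.symm (hrep1 z))
    rw [← hcls z _ (hrep1 z)] at h
    have hiff : ∀ u ∈ {t | R z t}, (u ∈ {z | z ∈ Z (rep z)} ↔ u ∈ Z (rep z)) := by
      intro u hu
      rw [mem_ofPred_eq, (hrep2 z u).1 hu]
    rcases h with h | ⟨h1, e, h2, b, h3, y, h4, h5, h6⟩
    · exact Or.inl h
    · refine Or.inr ⟨fun y hy => ?_, e, fun y hy hyZ u hu huZ => ?_, b, h3, y, h4, ?_, h6⟩
      · obtain ⟨u, hu, huZ, hlt⟩ := h1 y hy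
        exact ⟨u, hu, (hiff u hu).2 huZ, hlt⟩
      · exact h2 y hy ((hiff y hy).1 hyZ) u hu ((hiff u hu).1 huZ)
      · exact (hiff y h4).2 h5
  obtain ⟨Z₁, hZ₁⟩ := hZ₁
  obtain ⟨Z₂, hZ₂⟩ := hZ₂
  apply hn
  intro p hp q hq hpq
  rw [uIcc_of_le hxy.le] at hp hq
  by_cases hpqR : R p q
  · exact hpqR p left_mem_uIcc q right_mem_uIcc hpq
  apply hone p q hpq
  have hP : (Q (x, y)).Nonempty := by
    obtain ⟨z, h1, h2, h3, h4⟩ := hbetween x y hxy hn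
    exact ⟨_, z, h1, h2, h3, h4, rfl⟩
  have hmem : ∀ z, p < z → z < q → ¬ R p z → ¬ R z q → C.val w {t | R z t} ∈ Q (x, y) :=
    fun z h1 h2 h3 h4 => hQsub p q hp.1 hq.2 ⟨z, h1, h2, h3, h4, rfl⟩
  have hdense : ∀ u v, p ≤ u → u < v → v ≤ q → ¬ R u v → ∀ m ∈ Q (x, y), ∃ z, u < z ∧ z < v ∧
      ¬ R u z ∧ ¬ R z v ∧ C.val w {t | R z t} = m := by
    intro u v h1 h2 h3 h4 m hm
    rw [← hQeq u v (hp.1.trans h1) h2 (h3.trans hq.2) h4] at hm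
    exact hm
  obtain ⟨W, hW, hval⟩ := C.exists_shuffle_of_dense w hR hpq hpqR hP hmem hdense
  have hcv : ∀ z, C.ClassVal w F Y₁ Y₂ Z₁ Z₂ z (C.val w {t | R z t}) := by
    intro z
    refine ⟨_, _, (C.val_split w _ z).symm, ?_, ?_⟩
    · rw [← hY]; exact hZ₁ z
    · rw [← hY]; exact hZ₂ z
  have := (hc ∅ Y₁ Y₂ Z₁ Z₂).shuffle p q hpq (by rw [← hY]; exact hpqR) (Q (x, y)) hP (by
    unfold ShuffleBetween
    rw [← hY]
    refine ⟨fun z h1 h2 h3 h4 => ⟨_, hmem z h1 h2 h3 h4, hcv z⟩, fun u v h1 h2 h3 h4 m hm => ?_⟩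
    obtain ⟨z, h5, h6, h7, h8, h9⟩ := hdense u v h1 h2 h3 h4 m hm
    exact ⟨z, h5, h6, h7, h8, h9 ▸ hcv z⟩) _ _ (by rw [← hY]; exact hZ₂ p)
    (by rw [← hY]; exact hZ₁ q)
  rw [hval, ← hK _ hP W hW]
  exact this

/-- The consistency conditions, for all set parameters, imply that a non-empty word is accepted. -/
theorem prod_mem_of_consistent [Finite M] [Nonempty w.dom]
    (hK : ∀ P : Set M, P.Nonempty → ∀ W : Word M, W.IsShuffle P → K P = C.prod W)
    (hc : ∀ X Y₁ Y₂ Z₁ Z₂, C.Consistent w F X Y₁ Y₂ Z₁ Z₂ K Acc) : C.prod w ∈ Acc := by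
  have hF := correct_of_consistent hK hc
  obtain ⟨Z₁, -, h1⟩ := exists_leftVal (S := univ) (T := univ) subset_rfl (by simp) hF
  obtain ⟨Z₂, -, h2⟩ := exists_rightVal (S := univ) (T := univ) subset_rfl (by simp) hF
  obtain ⟨x⟩ := ‹Nonempty w.dom›
  have := (hc ∅ ∅ ∅ Z₁ Z₂).accept x _ _ (h1 x trivial) (h2 x trivial)
  rwa [← C.val_split, C.val_univ] at this

end CountableMonoid

/-! ### The rank of an element of a finite monoid -/

section Rank

variable {M : Type*} [Monoid M]

/-- The number of factors of `m`. -/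
noncomputable def factorRank (m : M) : ℕ := {t | ∃ u v, m = u * t * v}.ncard

theorem pow_mul_mul_pow_eq {u m a : M} (h : u * m * a = m) (i : ℕ) : u ^ i * m * a ^ i = m := by
  induction i with
  | zero => simp
  | succ i ih =>
    calc u ^ (i + 1) * m * a ^ (i + 1) = u ^ i * (u * m * a) * a ^ i := by
          rw [pow_succ u, pow_succ' a]; simp only [mul_assoc]
      _ = m := by rw [h, ih]

variable [Finite M]

theorem factorRank_le_card (m : M) : factorRank m ≤ Nat.card M := Set.ncard_le_card _

theorem factorRank_pos (m : M) : 0 < factorRank m :=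
  (Set.ncard_pos (Set.toFinite _)).2 ⟨m, 1, 1, by simp⟩

theorem factorRank_le (u m v : M) : factorRank m ≤ factorRank (u * m * v) := by
  refine Set.ncard_le_ncard ?_ (Set.toFinite _)
  rintro t ⟨a, b, rfl⟩
  exact ⟨u * a, b * v, by simp only [mul_assoc]⟩

theorem factorRank_le_mul_left (u m : M) : factorRank m ≤ factorRank (u * m) := by
  simpa using factorRank_le u m 1

theorem exists_mul_eq_of_factorRank {m t : M} (h : factorRank (m * t) ≤ factorRank m) :
    ∃ s, m * t * s = m := by
  have hsub : {c | ∃ u v, m = u * c * v} ⊆ {c | ∃ u v, m * t = u * c * v} := by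
    rintro c ⟨a, b, hc⟩
    exact ⟨a, b * t, by rw [hc]; simp only [mul_assoc]⟩
  have heq := Set.eq_of_subset_of_ncard_le hsub h (Set.toFinite _)
  have hmem : m * t ∈ {c | ∃ u v, m = u * c * v} := by
    rw [heq]
    exact ⟨1, 1, by simp⟩
  obtain ⟨u, v, huv⟩ := hmem
  have h1 : u * m * (t * v) = m := by
    conv_rhs => rw [huv]
    simp only [mul_assoc]
  obtain ⟨i, j, hij, hpow⟩ := Finite.exists_ne_map_eq_of_infinite fun i : ℕ => (t * v) ^ i
  wlog hlt : i < j generalizing i j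
  · exact this j i hij.symm hpow.symm (by omega)
  obtain ⟨d, rfl⟩ := Nat.exists_eq_add_of_lt hlt
  refine ⟨v * (t * v) ^ d, ?_⟩
  have hpow : (t * v) ^ i = (t * v) ^ (i + d + 1) := hpow
  calc m * t * (v * (t * v) ^ d) = m * (t * v) ^ (d + 1) := by
        rw [pow_succ']; simp only [mul_assoc]
    _ = u ^ i * m * (t * v) ^ i * (t * v) ^ (d + 1) := by rw [pow_mul_mul_pow_eq h1]
    _ = u ^ i * m * (t * v) ^ (i + d + 1) := by rw [mul_assoc _ (_ ^ i), ← pow_add]; rfl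
    _ = m := by rw [← hpow, pow_mul_mul_pow_eq h1]

theorem exists_mul_eq_of_factorRank' {m t : M} (h : factorRank (t * m) ≤ factorRank m) :
    ∃ s, s * (t * m) = m := by
  have hsub : {c | ∃ u v, m = u * c * v} ⊆ {c | ∃ u v, t * m = u * c * v} := by
    rintro c ⟨a, b, hc⟩
    exact ⟨t * a, b, by rw [hc]; simp only [mul_assoc]⟩
  have heq := Set.eq_of_subset_of_ncard_le hsub h (Set.toFinite _)
  have hmem : t * m ∈ {c | ∃ u v, m = u * c * v} := by
    rw [heq]
    exact ⟨1, 1, by simp⟩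
  obtain ⟨u, v, huv⟩ := hmem
  have h1 : (u * t) * m * v = m := by
    conv_rhs => rw [huv]
    simp only [mul_assoc]
  obtain ⟨i, j, hij, hpow⟩ := Finite.exists_ne_map_eq_of_infinite fun i : ℕ => (u * t) ^ i
  wlog hlt : i < j generalizing i j
  · exact this j i hij.symm hpow.symm (by omega)
  obtain ⟨d, rfl⟩ := Nat.exists_eq_add_of_lt hlt
  refine ⟨(u * t) ^ d * u, ?_⟩
  have hpow : (u * t) ^ i = (u * t) ^ (i + d + 1) := hpow
  calc (u * t) ^ d * u * (t * m) = (u * t) ^ (d + 1) * m := by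
        rw [pow_succ]; simp only [mul_assoc]
    _ = (u * t) ^ (d + 1) * ((u * t) ^ i * m * v ^ i) := by rw [pow_mul_mul_pow_eq h1]
    _ = (u * t) ^ (i + d + 1) * m * v ^ i := by
        rw [show i + d + 1 = d + 1 + i by omega, pow_add _ (d + 1) i]; simp only [mul_assoc]
    _ = m := by rw [← hpow, pow_mul_mul_pow_eq h1]

/-- Left cancellation inside an `R`-class. -/
theorem eq_of_mul_left_eq {a m m' r : M} (h : a * m = a * m')
    (hm : factorRank (a * m) ≤ factorRank m) (hr : ∃ s, m * s = r) (hr' : ∃ s, r * s = m') :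
    m = m' := by
  obtain ⟨c, hc⟩ := exists_mul_eq_of_factorRank' hm
  obtain ⟨s, rfl⟩ := hr
  obtain ⟨s', rfl⟩ := hr'
  calc m = c * (a * (m * s * s')) := by rw [← h, hc]
    _ = c * (a * m) * s * s' := by simp only [mul_assoc]
    _ = m * s * s' := by rw [hc]

/-- Right cancellation inside an `L`-class. -/
theorem eq_of_mul_right_eq {a m m' r : M} (h : m * a = m' * a)
    (hm : factorRank (m * a) ≤ factorRank m) (hr : ∃ s, s * m = r) (hr' : ∃ s, s * r = m') :
    m = m' := by
  obtain ⟨c, hc⟩ := exists_mul_eq_of_factorRank hm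
  obtain ⟨s, rfl⟩ := hr
  obtain ⟨s', rfl⟩ := hr'
  calc m = s' * (s * m) * a * c := by rw [← h, hc]
    _ = s' * s * (m * a * c) := by simp only [mul_assoc]
    _ = s' * (s * m) := by rw [hc, mul_assoc]

end Rank

/-! ### Labels determining the values of intervals -/

section Labels

variable {M : Type*} [Monoid M] {X : Type*} [LinearOrder X]

/-- A monoid-valued function on sets that turns ordered unions into products. -/
structure IsAdditive (V : Set X → M) : Prop where
  empty : V ∅ = 1
  union : ∀ S T : Set X, (∀ x ∈ S, ∀ y ∈ T, x < y) → V (S ∪ T) = V S * V T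

theorem IsAdditive.Ico_mul {V : Set X → M} (hV : IsAdditive V) {x y z : X} (hxy : x ≤ y)
    (hyz : y ≤ z) : V (Ico x z) = V (Ico x y) * V (Ico y z) := by
  rw [← hV.union, Ico_union_Ico_eq_Ico hxy hyz]
  exact fun a ha b hb => ha.2.trans_le hb.1

/-- The pairs `(x, y)` and `(x', y')` meet the same number of classes, counted up to four. -/
def SameType (R : X → X → Prop) (x y x' y' : X) : Prop :=
  (MeetsTwo R x y ↔ MeetsTwo R x' y') ∧ (MeetsThree R x y ↔ MeetsThree R x' y')

/-- Labels that take finitely many values. -/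
abbrev Label (M : Type*) := (M × M × M) × (Bool × M × M × M)

theorem IsAdditive.Ico_eq_of_meetsTwo {V : Set X → M} (hV : IsAdditive V) {R : X → X → Prop}
    (hR : ConvexEquiv R) {x y : X} (hxy : x < y) (hn : ¬ R x y) (h : MeetsTwo R x y) :
    V (Ico x y) = V ({t | R x t} ∩ Ici x) * V ({t | R y t} ∩ Iio y) := by
  rw [← hV.union]
  · congr 1
    ext t
    simp only [mem_Ico, mem_union, mem_inter_iff, mem_ofPred_eq, mem_Ici, mem_Iio]
    constructor
    · rintro ⟨h1, h2⟩
      rcases h t h1 h2.le with h3 | h3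
      · exact Or.inl ⟨h3, h1⟩
      · exact Or.inr ⟨hR.symm h3, h2⟩
    · rintro (⟨h1, h2⟩ | ⟨h1, h2⟩)
      · exact ⟨h2, hR.lt_of_lt hxy hn h1 (hR.refl y)⟩
      · exact ⟨(hR.lt_of_lt hxy hn (hR.refl x) h1).le, h2⟩
  · rintro a ⟨ha, -⟩ b ⟨hb, -⟩
    exact hR.lt_of_lt hxy hn ha hb

theorem IsAdditive.Ico_eq_of_meetsThree {V : Set X → M} (hV : IsAdditive V) {R : X → X → Prop}
    (hR : ConvexEquiv R) {x y : X} (h2 : ¬ MeetsTwo R x y) (h3 : MeetsThree R x y) :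
    V (Ico x y) = V ({t | R x t} ∩ Ici x) *
      V {t | ∃ z, x < z ∧ ¬ R x z ∧ MeetsTwo R x z ∧ R z t} * V ({t | R y t} ∩ Iio y) := by
  obtain ⟨z, hxz, hzy, hz⟩ := h3
  unfold MeetsTwo at h2
  push Not at h2
  obtain ⟨u, hxu, huy, hu1, hu2⟩ := h2
  have hzu : R z u := by
    rcases hz u hxu huy with h | h | h
    · exact absurd h hu1
    · exact absurd h hu2
    · exact h
  have hz1 : ¬ R x z := fun h => hu1 (hR.trans h hzu)
  have hz2 : ¬ R z y := fun h => hu2 (hR.trans (hR.symm hzu) h)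
  have hxz : x < z := lt_of_le_of_ne hxz fun h => hz1 (h ▸ hR.refl x)
  have hzy : z < y := lt_of_le_of_ne hzy fun h => hz2 (h ▸ hR.refl z)
  have hcls : {t | ∃ z, x < z ∧ ¬ R x z ∧ MeetsTwo R x z ∧ R z t} = {t | R z t} := by
    ext t
    constructor
    · rintro ⟨z', h1, h2, h3, h4⟩
      refine hR.trans ?_ h4
      rcases le_total z z' with h | h
      · exact (h3 z hxz.le h).resolve_left hz1
      · rcases hz z' h1.le (h.trans hzy.le) with h5 | h5 | h5
        · exact absurd h5 h2
        · exact absurd (hR.convex' h hzy.le h5) hz2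
        · exact h5
    · intro ht
      refine ⟨z, hxz, hz1, fun v h1 h2 => ?_, ht⟩
      rcases hz v h1 (h2.trans hzy.le) with h5 | h5 | h5
      · exact Or.inl h5
      · exact absurd (hR.convex' h2 hzy.le h5) hz2
      · exact Or.inr (hR.symm h5)
  rw [hcls, ← hV.union, ← hV.union]
  · congr 1
    ext t
    simp only [mem_Ico, mem_union, mem_inter_iff, mem_ofPred_eq, mem_Ici, mem_Iio]
    constructor
    · rintro ⟨h1, h2⟩
      rcases hz t h1 h2.le with h3 | h3 | h3
      · exact Or.inl (Or.inl ⟨h3, h1⟩)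
      · exact Or.inr ⟨hR.symm h3, h2⟩
      · exact Or.inl (Or.inr h3)
    · rintro ((⟨h1, h2⟩ | h1) | ⟨h1, h2⟩)
      · exact ⟨h2, (hR.lt_of_lt hxz hz1 h1 (hR.refl z)).trans hzy⟩
      · exact ⟨(hR.lt_of_lt hxz hz1 (hR.refl x) h1).le, hR.lt_of_lt hzy hz2 h1 (hR.refl y)⟩
      · exact ⟨(hxz.trans (hR.lt_of_lt hzy hz2 (hR.refl z) h1)).le, h2⟩
  · rintro a (⟨ha, -⟩ | ha) b ⟨hb, -⟩
    · exact (hR.lt_of_lt hxz hz1 ha (hR.refl z)).trans (hR.lt_of_lt hzy hz2 (hR.refl z) hb)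
    · exact hR.lt_of_lt hzy hz2 ha hb
  · rintro a ⟨ha, -⟩ b hb
    exact hR.lt_of_lt hxz hz1 ha hb

variable [Finite M]

theorem exists_label {V : Set X → M} (hV : IsAdditive V) {R R' : X → X → Prop} {k : ℕ}
    (hR : ConvexEquiv R) (hR' : ConvexEquiv R')
    (hle : ∀ x y, x < y → R' x y → factorRank (V (Ico x y)) ≤ k + 1)
    (hthree : ∀ x y, x < y → factorRank (V (Ico x y)) ≤ k → MeetsThree R x y) :
    ∃ l : X → Label M, ∀ x y x' y', x < y → x' < y' → R' x y → R' x' y' → ¬ R x y → ¬ R x' y' →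
      SameType R x y x' y' → l x = l x' → l y = l y' → V (Ico x y) = V (Ico x' y') := by
  classical
  obtain ⟨o, ho1, ho2⟩ := hR'.exists_rep
  let f : X → X → M := fun x y => V (Ico x y)
  have hf0 : ∀ {x y}, y ≤ x → f x y = 1 := by
    intro x y h
    simp only [f, Ico_eq_empty (not_lt.2 h), hV.empty]
  have hfm : ∀ {x y z}, x ≤ y → y ≤ z → f x z = f x y * f y z := fun h h' => hV.Ico_mul h h'
  let right : X → M := fun x =>
    if h : ∃ z, x < z ∧ R' x z ∧ factorRank (f x z) = k + 1 then f x h.choose else 1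
  let left : X → M := fun y =>
    if h : ∃ z, z < y ∧ R' z y ∧ factorRank (f z y) = k + 1 then f h.choose y else 1
  have hright : ∀ x y, x < y → R' x y → factorRank (f x y) = k + 1 →
      (∃ s, f x y * s = right x) ∧ ∃ s, right x * s = f x y := by
    intro x y hxy hxy' hrk
    have hex : ∃ z, x < z ∧ R' x z ∧ factorRank (f x z) = k + 1 := ⟨y, hxy, hxy', hrk⟩
    have hdef : right x = f x hex.choose := dif_pos hex
    obtain ⟨h1, h2, h3⟩ := hex.choose_spec
    rw [hdef]
    generalize hex.choose = z at h1 h2 h3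
    rcases le_total y z with h | h
    · refine ⟨⟨f y z, (hfm hxy.le h).symm⟩, ?_⟩
      rw [hfm hxy.le h]
      exact exists_mul_eq_of_factorRank (by rw [← hfm hxy.le h, h3, hrk])
    · refine ⟨?_, ⟨f z y, (hfm h1.le h).symm⟩⟩
      rw [hfm h1.le h]
      exact exists_mul_eq_of_factorRank (by rw [← hfm h1.le h, h3, hrk])
  have hleft : ∀ x y, x < y → R' x y → factorRank (f x y) = k + 1 →
      (∃ s, s * f x y = left y) ∧ ∃ s, s * left y = f x y := by
    intro x y hxy hxy' hrk
    have hex : ∃ z, z < y ∧ R' z y ∧ factorRank (f z y) = k + 1 := ⟨x, hxy, hxy', hrk⟩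
    have hdef : left y = f hex.choose y := dif_pos hex
    obtain ⟨h1, h2, h3⟩ := hex.choose_spec
    rw [hdef]
    generalize hex.choose = z at h1 h2 h3
    rcases le_total z x with h | h
    · refine ⟨⟨f z x, (hfm h hxy.le).symm⟩, ?_⟩
      rw [hfm h hxy.le]
      exact exists_mul_eq_of_factorRank' (by rw [← hfm h hxy.le, h3, hrk])
    · refine ⟨?_, ⟨f x z, (hfm h h1.le).symm⟩⟩
      rw [hfm h h1.le]
      exact exists_mul_eq_of_factorRank' (by rw [← hfm h h1.le, h3, hrk])
  let l : X → Label M := fun x =>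
    ((V ({t | R x t} ∩ Ici x), V ({t | R x t} ∩ Iio x),
      V {t | ∃ z, x < z ∧ ¬ R x z ∧ MeetsTwo R x z ∧ R z t}),
      (decide (o x ≤ x), f (o x) x * f x (o x), right x, left x))
  refine ⟨l, fun x y x' y' hxy hxy' h1 h1' h2 h2' htype hlx hly => ?_⟩
  simp only [l, Prod.mk.injEq, decide_eq_decide] at hlx hly
  obtain ⟨⟨hs, -, hnx⟩, hside, hax, hrx, -⟩ := hlx
  obtain ⟨⟨-, hp, -⟩, hside', hay, -, hly⟩ := hly
  by_cases hm2 : MeetsTwo R x y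
  · rw [hV.Ico_eq_of_meetsTwo hR hxy h2 hm2,
      hV.Ico_eq_of_meetsTwo hR hxy' h2' (htype.1.1 hm2), hs, hp]
  by_cases hm3 : MeetsThree R x y
  · rw [hV.Ico_eq_of_meetsThree hR hm2 hm3, hV.Ico_eq_of_meetsThree hR
      (fun h => hm2 (htype.1.2 h)) (htype.2.1 hm3), hs, hp, hnx]
  have hrank : ∀ {x y}, x < y → R' x y → ¬ MeetsThree R x y → factorRank (f x y) = k + 1 := by
    intro x y hxy h1 h3
    refine le_antisymm (hle x y hxy h1) ?_
    by_contra hlt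
    exact h3 (hthree x y hxy (by simp only [f] at hlt ⊢; omega))
  have hrk := hrank hxy h1 hm3
  have hrk' := hrank hxy' h1' fun h => hm3 (htype.2.2 h)
  have ho := (ho2 x y).1 h1
  have ho' := (ho2 x' y').1 h1'
  have hle' : ∀ {x y}, x ≤ y → R' x y → factorRank (f x y) ≤ k + 1 := by
    intro x y h h'
    rcases h.eq_or_lt with rfl | h
    · rw [hf0 le_rfl]
      have h3 := factorRank_le_mul_left (f x' y') 1
      rw [mul_one, hrk'] at h3
      exact h3
    · exact hle x y h h'
  change f x y = f x' y'
  by_cases hox : o x ≤ x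
  · have hoy : o y ≤ y := by rw [← ho]; exact hox.trans hxy.le
    have hox' := hside.1 hox
    have hoy' := hside'.1 hoy
    rw [hf0 hox, hf0 hox', mul_one, mul_one] at hax
    rw [hf0 hoy, hf0 hoy', mul_one, mul_one, ← ho, ← ho', hfm hox hxy.le, hfm hox' hxy'.le,
      ← hax] at hay
    refine eq_of_mul_left_eq hay ?_ (hright x y hxy h1 hrk).1
      (hrx ▸ (hright x' y' hxy' h1' hrk').2)
    rw [← hfm hox hxy.le, hrk]
    exact hle' (hox.trans hxy.le) (hR'.trans (hR'.symm (ho1 x)) h1)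
  · by_cases hoy : o y ≤ y
    · have hox' := fun h => hox (hside.2 h)
      have hoy' := hside'.1 hoy
      rw [hf0 hoy, hf0 hoy', mul_one, mul_one] at hay
      rw [hf0 (not_le.1 hox).le, hf0 (not_le.1 hox').le, one_mul, one_mul] at hax
      rw [hfm (not_le.1 hox).le (ho ▸ hoy), hfm (not_le.1 hox').le (ho' ▸ hoy'), hax, ho, hay, ho']
    · have hox' := not_le.1 fun h => hox (hside.2 h)
      have hoy' := not_le.1 fun h => hoy (hside'.2 h)
      have hox := not_le.1 hox
      have hoy := not_le.1 hoy
      rw [hf0 hoy.le, hf0 hoy'.le, one_mul, one_mul] at hay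
      rw [hf0 hox.le, hf0 hox'.le, one_mul, one_mul, ho, ho', hfm hxy.le hoy.le,
        hfm hxy'.le hoy'.le, ← hay] at hax
      refine eq_of_mul_right_eq hax ?_ (hleft x y hxy h1 hrk).1
        (hly ▸ (hleft x' y' hxy' h1' hrk').2)
      rw [← hfm hxy.le hoy.le, hrk]
      exact hle' (hxy.le.trans hoy.le) (hR'.trans h1 (ho1 y))

theorem exists_levels {V : Set X → M} (hV : IsAdditive V) :
    ∃ E : ℕ → X → X → Prop, (∀ k, ConvexEquiv (E k)) ∧
      (∀ x y, E 0 x y → x = y) ∧ (∀ x y, E (Nat.card M) x y) ∧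
      (∀ k x y, x < y → E k x y → factorRank (V (Ico x y)) ≤ k) ∧
      (∀ k x y, x < y → factorRank (V (Ico x y)) ≤ k → MeetsThree (E k) x y) := by
  let g : ℕ → X → X → Prop := fun k x y => factorRank (V (Ico x y)) ≤ k
  have hg : ∀ k x x' y' y, x ≤ x' → x' ≤ y' → y' ≤ y → g k x y → g k x' y' := by
    intro k x x' y' y h1 h2 h3 h
    refine le_trans ?_ h
    rw [hV.Ico_mul h1 (h2.trans h3), hV.Ico_mul h2 h3, ← mul_assoc]
    exact factorRank_le _ _ _
  choose E h1 h2 h3 h4 using fun k => exists_maximal_convexEquiv (hg k)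
  refine ⟨E, h1, fun x y h => ?_, h4 _ fun x y => factorRank_le_card _, h2, h3⟩
  have hpos : ∀ x y, ¬ g 0 x y := fun x y h => (factorRank_pos (V (Ico x y))).not_ge h
  rcases lt_trichotomy x y with hlt | rfl | hlt
  · exact absurd (h2 0 x y hlt h) (hpos x y)
  · rfl
  · exact absurd (h2 0 y x hlt ((h1 0).symm h)) (hpos y x)

end Labels

/-! ### Building blocks for first-order formulas -/

namespace MSO

/-- The true formula. -/
def verum : MSO ℕ := not falsum

/-- Implication. -/
def imp (φ ψ : MSO ℕ) : MSO ℕ := or (not φ) ψ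

/-- The formula `x ≤ y`. -/
def le (x y : ℕ) : MSO ℕ := not (lt y x)

/-- The disjunction of the formulas `f i` for `i < n`. -/
def bigOr (n : ℕ) (f : ℕ → MSO ℕ) : MSO ℕ :=
  (List.range n).foldr (fun i φ => or (f i) φ) falsum

/-- The conjunction of the formulas `f i` for `i < n`. -/
def bigAnd (n : ℕ) (f : ℕ → MSO ℕ) : MSO ℕ :=
  (List.range n).foldr (fun i φ => and (f i) φ) verum

/-- The formula `φ` if `p` holds, and the false formula otherwise. -/
def guard (p : Prop) [Decidable p] (φ : MSO ℕ) : MSO ℕ := if p then φ else falsum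

section Sat

variable {w : Word ℕ} {ν : ℕ → Option w.dom} {μ : ℕ → Set w.dom} {φ ψ : MSO ℕ}

@[simp] theorem sat_falsum : Sat w falsum ν μ ↔ False := Iff.rfl

@[simp] theorem sat_verum : Sat w verum ν μ ↔ True := by simp [verum, Sat]

@[simp] theorem sat_not : Sat w (not φ) ν μ ↔ ¬ Sat w φ ν μ := Iff.rfl

@[simp] theorem sat_and : Sat w (and φ ψ) ν μ ↔ Sat w φ ν μ ∧ Sat w ψ ν μ := Iff.rfl

@[simp] theorem sat_or : Sat w (or φ ψ) ν μ ↔ Sat w φ ν μ ∨ Sat w ψ ν μ := Iff.rfl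

@[simp] theorem sat_imp : Sat w (imp φ ψ) ν μ ↔ (Sat w φ ν μ → Sat w ψ ν μ) := by
  simp only [imp, sat_or, sat_not]; tauto

@[simp] theorem sat_ex {x : ℕ} :
    Sat w (ex x φ) ν μ ↔ ∃ p : w.dom, Sat w φ (Function.update ν x (some p)) μ := Iff.rfl

@[simp] theorem sat_all {x : ℕ} :
    Sat w (all x φ) ν μ ↔ ∀ p : w.dom, Sat w φ (Function.update ν x (some p)) μ := Iff.rfl

@[simp] theorem sat_guard {p : Prop} [Decidable p] :
    Sat w (guard p φ) ν μ ↔ p ∧ Sat w φ ν μ := by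
  unfold guard; split_ifs with h <;> simp [h]

@[simp] theorem sat_bigOr {n : ℕ} {f : ℕ → MSO ℕ} :
    Sat w (bigOr n f) ν μ ↔ ∃ i < n, Sat w (f i) ν μ := by
  have : ∀ l : List ℕ, Sat w (l.foldr (fun i φ => or (f i) φ) falsum) ν μ ↔
      ∃ i ∈ l, Sat w (f i) ν μ := by
    intro l
    induction l with
    | nil => simp
    | cons a l ih => simp [ih]
  simp [bigOr, this]

@[simp] theorem sat_bigAnd {n : ℕ} {f : ℕ → MSO ℕ} :
    Sat w (bigAnd n f) ν μ ↔ ∀ i < n, Sat w (f i) ν μ := by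
  have : ∀ l : List ℕ, Sat w (l.foldr (fun i φ => and (f i) φ) verum) ν μ ↔
      ∀ i ∈ l, Sat w (f i) ν μ := by
    intro l
    induction l with
    | nil => simp
    | cons a l ih => simp [ih]
  simp [bigAnd, this]

variable {x y : ℕ} {p q : w.dom}

theorem sat_lt (hx : ν x = some p) (hy : ν y = some q) : Sat w (lt x y) ν μ ↔ p < q := by
  simp [Sat, hx, hy]

theorem sat_le (hx : ν x = some p) (hy : ν y = some q) : Sat w (le x y) ν μ ↔ p ≤ q := by
  simp [le, Sat, hx, hy]

theorem sat_eq (hx : ν x = some p) (hy : ν y = some q) : Sat w (eq x y) ν μ ↔ p = q := by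
  simp [Sat, hx, hy, eq_comm]

theorem sat_mem (hx : ν x = some p) {Y : ℕ} : Sat w (mem x Y) ν μ ↔ p ∈ μ Y := by
  simp [Sat, hx]

theorem sat_letter (hx : ν x = some p) {a : ℕ} : Sat w (letter a x) ν μ ↔ w.letter p = a := by
  simp [Sat, hx]

end Sat

/-! ### The guessed relation -/

/-- The formula expressing that the sets `S` and `T` colour the interval between `x` and `y`
uniformly. -/
def same (S T x y : ℕ) : MSO ℕ :=
  all 30 (imp (or (and (le x 30) (le 30 y)) (and (le y 30) (le 30 x)))
    (and (and (imp (mem 30 S) (mem x S)) (imp (mem x S) (mem 30 S)))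
      (and (imp (mem 30 T) (mem x T)) (imp (mem x T) (mem 30 T)))))

/-- The formula expressing that `[x, y]` meets at most two classes. -/
def two (S T x y : ℕ) : MSO ℕ :=
  all 31 (imp (le x 31) (imp (le 31 y) (or (same S T x 31) (same S T 31 y))))

/-- The formula expressing that `[x, y]` meets at most three classes. -/
def three (S T x y : ℕ) : MSO ℕ :=
  ex 32 (and (le x 32) (and (le 32 y) (all 31 (imp (le x 31) (imp (le 31 y)
    (or (same S T x 31) (or (same S T 31 y) (same S T 32 31))))))))

/-- Names of the existentially quantified set variables. -/
def setVar (tag a b c d : ℕ) : ℕ :=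
  5 + Nat.pair tag (Nat.pair a (Nat.pair b (Nat.pair c d)))

/-- The number of labels for a monoid with `n` elements. -/
def labels (n : ℕ) : ℕ := (n * (n * n)) * (2 * (n * (n * n)))

/-- The formula expressing that, up to labels, `[x, y)` has the value `v` at level `k` and type
`t`. -/
def look (n k t v x y : ℕ) : MSO ℕ :=
  bigOr (labels n) fun l => and (mem x (setVar 2 k t l v)) (mem y (setVar 1 k l 0 0))

/-- The formula expressing that the guessed value of `[x, y)` is `v`. -/
def guess (n v x y : ℕ) : MSO ℕ :=
  bigOr n fun k =>
    and (same (setVar 0 (k + 1) 0 0 0) (setVar 0 (k + 1) 1 0 0) x y)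
      (and (not (same (setVar 0 k 0 0 0) (setVar 0 k 1 0 0) x y))
        (or (and (two (setVar 0 k 0 0 0) (setVar 0 k 1 0 0) x y) (look n k 0 v x y))
          (or (and (not (two (setVar 0 k 0 0 0) (setVar 0 k 1 0 0) x y))
              (and (three (setVar 0 k 0 0 0) (setVar 0 k 1 0 0) x y) (look n k 1 v x y)))
            (and (not (three (setVar 0 k 0 0 0) (setVar 0 k 1 0 0) x y)) (look n k 2 v x y)))))

/-- The convex equivalence relation of level `k` coded by a set valuation. -/
def level {X : Type*} [LinearOrder X] (μ : ℕ → Set X) (k : ℕ) : X → X → Prop :=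
  SameColour (μ (setVar 0 k 0 0 0)) (μ (setVar 0 k 1 0 0))

/-- The relation coded by a set valuation and described by the formulas `guess`. -/
def Guess {X : Type*} [LinearOrder X] (μ : ℕ → Set X) (n v : ℕ) (x y : X) : Prop :=
  ∃ k < n, level μ (k + 1) x y ∧ ¬ level μ k x y ∧
    ∃ t < 3, (t = 0 ∧ MeetsTwo (level μ k) x y ∨
      t = 1 ∧ ¬ MeetsTwo (level μ k) x y ∧ MeetsThree (level μ k) x y ∨
      t = 2 ∧ ¬ MeetsThree (level μ k) x y) ∧
      ∃ l < labels n, x ∈ μ (setVar 2 k t l v) ∧ y ∈ μ (setVar 1 k l 0 0)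

section Sat

variable {w : Word ℕ} {ν : ℕ → Option w.dom} {μ : ℕ → Set w.dom} {x y : ℕ} {p q : w.dom}

theorem sat_same {S T : ℕ} (hx : ν x = some p) (hy : ν y = some q) (hx30 : x ≠ 30)
    (hy30 : y ≠ 30) : Sat w (same S T x y) ν μ ↔ SameColour (μ S) (μ T) p q := by
  unfold same SameColour
  simp only [sat_all]
  refine forall_congr' fun t => ?_
  have h1 : Function.update ν 30 (some t) x = some p := by rw [Function.update_of_ne hx30, hx]
  have h2 : Function.update ν 30 (some t) y = some q := by rw [Function.update_of_ne hy30, hy]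
  have h3 : Function.update ν 30 (some t) 30 = some t := Function.update_self ..
  simp only [sat_imp, sat_or, sat_and, sat_le h1 h3, sat_le h3 h2, sat_le h2 h3, sat_le h3 h1,
    sat_mem h3, sat_mem h1]
  tauto

theorem sat_two {S T : ℕ} (hx : ν x = some p) (hy : ν y = some q) (hx30 : x < 30)
    (hy30 : y < 30) : Sat w (two S T x y) ν μ ↔ MeetsTwo (SameColour (μ S) (μ T)) p q := by
  unfold two MeetsTwo
  simp only [sat_all]
  refine forall_congr' fun t => ?_
  have h1 : Function.update ν 31 (some t) x = some p := by
    rw [Function.update_of_ne (by omega), hx]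
  have h2 : Function.update ν 31 (some t) y = some q := by
    rw [Function.update_of_ne (by omega), hy]
  have h3 : Function.update ν 31 (some t) 31 = some t := Function.update_self ..
  simp only [sat_imp, sat_or, sat_le h1 h3, sat_le h3 h2,
    sat_same h1 h3 (by omega : x ≠ 30) (by omega), sat_same h3 h2 (by omega) (by omega : y ≠ 30)]

theorem sat_three {S T : ℕ} (hx : ν x = some p) (hy : ν y = some q) (hx30 : x < 30)
    (hy30 : y < 30) : Sat w (three S T x y) ν μ ↔ MeetsThree (SameColour (μ S) (μ T)) p q := by
  unfold three MeetsThree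
  simp only [sat_ex]
  refine exists_congr fun z => ?_
  have h1 : Function.update ν 32 (some z) x = some p := by
    rw [Function.update_of_ne (by omega), hx]
  have h2 : Function.update ν 32 (some z) y = some q := by
    rw [Function.update_of_ne (by omega), hy]
  have h3 : Function.update ν 32 (some z) 32 = some z := Function.update_self ..
  generalize Function.update ν 32 (some z) = ν' at h1 h2 h3
  simp only [sat_and, sat_le h1 h3, sat_le h3 h2, sat_all]
  refine and_congr_right fun _ => and_congr_right fun _ => forall_congr' fun t => ?_
  have h1 : Function.update ν' 31 (some t) x = some p := by
    rw [Function.update_of_ne (by omega), h1]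
  have h2 : Function.update ν' 31 (some t) y = some q := by
    rw [Function.update_of_ne (by omega), h2]
  have h3 : Function.update ν' 31 (some t) 32 = some z := by
    rw [Function.update_of_ne (by omega), h3]
  have h4 : Function.update ν' 31 (some t) 31 = some t := Function.update_self ..
  simp only [sat_imp, sat_or, sat_le h1 h4, sat_le h4 h2,
    sat_same h1 h4 (by omega : x ≠ 30) (by omega), sat_same h4 h2 (by omega) (by omega : y ≠ 30),
    sat_same h3 h4 (by omega) (by omega)]

theorem sat_look {n k t v : ℕ} (hx : ν x = some p) (hy : ν y = some q) :
    Sat w (look n k t v x y) ν μ ↔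
      ∃ l < labels n, p ∈ μ (setVar 2 k t l v) ∧ q ∈ μ (setVar 1 k l 0 0) := by
  simp only [look, sat_bigOr, sat_and, sat_mem hx, sat_mem hy]

theorem sat_guess {n v : ℕ} (hx : ν x = some p) (hy : ν y = some q) (hx30 : x < 30)
    (hy30 : y < 30) : Sat w (guess n v x y) ν μ ↔ Guess μ n v p q := by
  unfold guess Guess level
  simp only [sat_bigOr, sat_and, sat_or, sat_not, sat_look hx hy, sat_two hx hy hx30 hy30,
    sat_three hx hy hx30 hy30, sat_same hx hy (by omega : x ≠ 30) (by omega : y ≠ 30)]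
  refine exists_congr fun k => and_congr_right fun _ => and_congr_right fun _ =>
    and_congr_right fun _ => ?_
  constructor
  · rintro (⟨h1, h2⟩ | ⟨h1, h2, h3⟩ | ⟨h1, h2⟩)
    · exact ⟨0, by omega, Or.inl ⟨rfl, h1⟩, h2⟩
    · exact ⟨1, by omega, Or.inr (Or.inl ⟨rfl, h1, h2⟩), h3⟩
    · exact ⟨2, by omega, Or.inr (Or.inr ⟨rfl, h1⟩), h2⟩
  · rintro ⟨t, -, ⟨rfl, h1⟩ | ⟨rfl, h1, h2⟩ | ⟨rfl, h1⟩, h3⟩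
    · exact Or.inl ⟨h1, h3⟩
    · exact Or.inr (Or.inl ⟨h1, h2, h3⟩)
    · exact Or.inr (Or.inr ⟨h1, h3⟩)

end Sat

/-- Every additive function with values in a finite monoid is described by some guess. -/
theorem exists_guess {M : Type*} [Monoid M] {n : ℕ} (eM : M ≃ Fin n) {X : Type*} [LinearOrder X]
    [Countable X] {V : Set X → M} (hV : IsAdditive V) :
    ∃ μ : ℕ → Set X, ∀ x y, x < y → ∀ m, Guess μ n (eM m) x y ↔ V (Ico x y) = m := by
  have : Finite M := Finite.of_equiv _ eM.symm
  have hcard : Nat.card M = n := by rw [Nat.card_congr eM, Nat.card_fin]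
  obtain ⟨E, hE, hE0, hEn, hErk, hE3⟩ := exists_levels hV
  choose S T hST using fun k => (hE k).exists_sameColour
  choose lab hlab using fun k => exists_label hV (hE k) (hE (k + 1)) (hErk (k + 1)) (hE3 k)
  have hcardL : Nat.card (Label M) = labels n := by
    simp only [Label, labels, Nat.card_prod, hcard, Nat.card_eq_fintype_card (α := Bool),
      Fintype.card_bool]
  let eL : Label M ≃ Fin (labels n) := hcardL ▸ Finite.equivFin (Label M)
  let typ : ℕ → ℕ → X → X → Prop := fun k t x y => t = 0 ∧ MeetsTwo (E k) x y ∨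
      t = 1 ∧ ¬ MeetsTwo (E k) x y ∧ MeetsThree (E k) x y ∨ t = 2 ∧ ¬ MeetsThree (E k) x y
  let tab : ℕ → ℕ → ℕ → ℕ → ℕ → Set X := fun tag a b c d =>
    if tag = 0 then (if b = 0 then S a else T a)
    else if tag = 1 then {y | eL (lab a y) = b}
    else {x | ∃ x' y', x' < y' ∧ E (a + 1) x' y' ∧ ¬ E a x' y' ∧ typ a b x' y' ∧
      lab a x' = lab a x ∧ eL (lab a y') = c ∧ ∃ m, eM m = d ∧ V (Ico x' y') = m}
  let μ : ℕ → Set X := fun i => tab (i - 5).unpair.1 (i - 5).unpair.2.unpair.1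
    (i - 5).unpair.2.unpair.2.unpair.1 (i - 5).unpair.2.unpair.2.unpair.2.unpair.1
    (i - 5).unpair.2.unpair.2.unpair.2.unpair.2
  have hμ : ∀ tag a b c d, μ (setVar tag a b c d) = tab tag a b c d := by
    intro tag a b c d
    simp [μ, setVar]
  have hlev : ∀ k, level μ k = E k := by
    intro k
    rw [hST k]
    unfold level
    rw [hμ, hμ]
    rfl
  have htwo : ∀ k x y, x < y → MeetsTwo (E k) x y → MeetsThree (E k) x y := fun k x y hxy h =>
    ⟨x, le_rfl, hxy.le, fun u h1 h2 => (h u h1 h2).imp_right Or.inl⟩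
  have htyp : ∀ k t x y x' y', x < y → x' < y' → typ k t x y → typ k t x' y' →
      SameType (E k) x y x' y' := by
    intro k t x y x' y' hxy hxy' h h'
    have key : ∀ {A B A' B' : Prop}, (A → B) → (A' → B') →
        (t = 0 ∧ A ∨ t = 1 ∧ ¬ A ∧ B ∨ t = 2 ∧ ¬ B) →
        (t = 0 ∧ A' ∨ t = 1 ∧ ¬ A' ∧ B' ∨ t = 2 ∧ ¬ B') → (A ↔ A') ∧ (B ↔ B') := by
      grind
    exact key (htwo k x y hxy) (htwo k x' y' hxy') h h'
  refine ⟨μ, fun x y hxy m => ?_⟩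
  unfold Guess
  simp only [hlev, hμ]
  have hmem : ∀ k t l v, x ∈ tab 2 k t l v ↔ ∃ x' y', x' < y' ∧ E (k + 1) x' y' ∧ ¬ E k x' y' ∧
      typ k t x' y' ∧ lab k x' = lab k x ∧ eL (lab k y') = l ∧ ∃ m, eM m = v ∧ V (Ico x' y') = m :=
    fun k t l v => Iff.rfl
  have hmem' : ∀ k l, y ∈ tab 1 k l 0 0 ↔ eL (lab k y) = l := fun k l => Iff.rfl
  constructor
  · rintro ⟨k, -, h1, h2, t, -, h3, l, -, h4, h5⟩
    rw [hmem] at h4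
    rw [hmem'] at h5
    obtain ⟨x', y', hxy', h1', h2', h3', hx, hy, m', hm', hV'⟩ := h4
    have hm : m' = m := eM.injective (Fin.ext hm')
    rw [← hm, ← hV']
    refine hlab k x y x' y' hxy hxy' h1 h1' h2 h2' (htyp k t x y x' y' hxy hxy' h3 h3') hx.symm ?_
    exact eL.injective (Fin.ext (h5.trans hy.symm))
  · intro hval
    obtain ⟨k, hk1, hk2, hk3⟩ : ∃ k < n, E (k + 1) x y ∧ ¬ E k x y := by
      classical
      have hex : ∃ k, E k x y := ⟨_, hEn x y⟩
      rcases Nat.exists_eq_succ_of_ne_zero (n := Nat.find hex) (fun h => by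
        have := Nat.find_spec hex
        rw [h] at this
        exact hxy.ne (hE0 x y this)) with ⟨k, hk⟩
      have hle : Nat.find hex ≤ n := Nat.find_min' hex (hcard ▸ hEn x y)
      refine ⟨k, by omega, ?_, Nat.find_min hex (by omega)⟩
      have := Nat.find_spec hex
      rwa [hk] at this
    obtain ⟨t, ht, ht'⟩ : ∃ t < 3, typ k t x y := by
      by_cases h1 : MeetsTwo (E k) x y
      · exact ⟨0, by omega, Or.inl ⟨rfl, h1⟩⟩
      by_cases h2 : MeetsThree (E k) x y
      · exact ⟨1, by omega, Or.inr (Or.inl ⟨rfl, h1, h2⟩)⟩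
      · exact ⟨2, by omega, Or.inr (Or.inr ⟨rfl, h2⟩)⟩
    refine ⟨k, hk1, hk2, hk3, t, ht, ht', eL (lab k y), (eL (lab k y)).2, ?_, ?_⟩
    · rw [hmem]
      exact ⟨x, y, hxy, hk2, hk3, ht', rfl, rfl, m, rfl, hval⟩
    · rw [hmem']

end MSO

/-! ### The tables of a presentation as functions -/

namespace Presentation

variable (d : Presentation)

/-- Entry of the multiplication table. -/
def mulT (a b : ℕ) : ℕ := d.mul.getD (d.size * a + b) 0

/-- Entry of the table of `τ`. -/
def tauT (a : ℕ) : ℕ := d.tau.getD a 0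

/-- Entry of the table of `τ*`. -/
def tauRevT (a : ℕ) : ℕ := d.tauRev.getD a 0

/-- Entry of the table of `κ`, made an element of the algebra in any case. -/
def kappaT (i : ℕ) : ℕ := d.kappa.getD i 0 % d.size

/-- Entry of the table of images of letters. -/
def imageT (a : ℕ) : ℕ := d.image.getD a 0

/-- The element `p` is in the set with index `i`. -/
abbrev Bit (i p : ℕ) : Prop := i / 2 ^ p % 2 = 1

/-- The tables of `d` are those of `C`, with `K` giving the values of shuffles. -/
structure Tabulates {M : Type v} (eM : M ≃ Fin d.size) (C : CountableMonoid M)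
    (K : Set M → M) (Acc : Set M) : Prop where
  one : d.one = (eM C.one : ℕ)
  mul : ∀ a b, d.mulT (eM a) (eM b) = eM (C.mul a b)
  tau : ∀ a, d.tauT (eM a) = eM (C.tau a)
  tauRev : ∀ a, d.tauRevT (eM a) = eM (C.tauRev a)
  kappa : ∀ i < 2 ^ d.size, d.kappaT i = eM (K {a | Bit i (eM a)})
  exists_index : ∀ P : Set M, ∃ i < 2 ^ d.size, P = {a | Bit i (eM a)}
  accept : ∀ a, (∃ j < d.accept.length, d.accept.getD j 0 = eM a) ↔ a ∈ Acc

end Presentation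

theorem exists_lt_iff_exists {M : Type*} {n : ℕ} (eM : M ≃ Fin n) {p : ℕ → Prop} :
    (∃ i < n, p i) ↔ ∃ m : M, p (eM m) := by
  constructor
  · rintro ⟨i, hi, h⟩
    exact ⟨eM.symm ⟨i, hi⟩, by simpa using h⟩
  · rintro ⟨m, h⟩
    exact ⟨eM m, (eM m).2, h⟩

theorem forall_lt_iff_forall {M : Type*} {n : ℕ} (eM : M ≃ Fin n) {p : ℕ → Prop} :
    (∀ i < n, p i) ↔ ∀ m : M, p (eM m) := by
  constructor
  · intro h m
    exact h _ (eM m).2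
  · intro h i hi
    simpa using h (eM.symm ⟨i, hi⟩)

theorem coe_equiv_inj {M : Type*} {n : ℕ} (eM : M ≃ Fin n) {a b : M} :
    (eM a : ℕ) = eM b ↔ a = b := by
  rw [Fin.val_inj, eM.injective.eq_iff]

namespace MSO

/-! ### The formulas for the consistency conditions -/

variable (d : Presentation)

/-- The formula expressing that the guessed value of `[x, y)`, possibly empty, is `v`. -/
def closed (v x y : ℕ) : MSO ℕ :=
  or (and (eq x y) (guard (v = d.one) verum)) (and (lt x y) (guess d.size v x y))

/-- The formula expressing that the image of the letter at `x` is `v`. -/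
def image (v x : ℕ) : MSO ℕ :=
  bigOr d.letters fun a => guard (d.imageT a = v) (letter a x)

/-- The formula for `LeftVal`; membership in the convex set is given by `inS`. -/
def left (inS : ℕ → MSO ℕ) (Z x v : ℕ) : MSO ℕ :=
  or (ex 20 (and (inS 20) (and (all 21 (imp (inS 21) (le 20 21))) (closed d v 20 x))))
    (and (all 20 (imp (inS 20) (ex 21 (and (inS 21) (and (mem 21 Z) (lt 21 20))))))
      (bigOr d.size fun e => and
        (all 20 (imp (inS 20) (imp (mem 20 Z) (all 21 (imp (inS 21) (imp (mem 21 Z)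
          (imp (lt 20 21) (guess d.size e 20 21))))))))
        (bigOr d.size fun b => guard (d.mulT (d.tauRevT e) b = v)
          (ex 20 (and (inS 20) (and (mem 20 Z) (and (lt 20 x) (guess d.size b 20 x))))))))

/-- The formula for `RightVal`; membership in the convex set is given by `inS`. -/
def right (inS : ℕ → MSO ℕ) (Z x v : ℕ) : MSO ℕ :=
  or (ex 20 (and (inS 20) (and (all 21 (imp (inS 21) (le 21 20)))
      (bigOr d.size fun b => bigOr d.size fun c => guard (d.mulT b c = v)
        (and (image d c 20) (closed d b x 20))))))
    (and (all 20 (imp (inS 20) (ex 21 (and (inS 21) (and (mem 21 Z) (lt 20 21))))))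
      (bigOr d.size fun e => and
        (all 20 (imp (inS 20) (imp (mem 20 Z) (all 21 (imp (inS 21) (imp (mem 21 Z)
          (imp (lt 20 21) (guess d.size e 20 21))))))))
        (bigOr d.size fun b => guard (d.mulT b (d.tauT e) = v)
          (ex 20 (and (inS 20) (and (mem 20 Z) (and (lt x 20) (guess d.size b x 20))))))))

/-- The formula for `ClassVal`. -/
def classVal (z v : ℕ) : MSO ℕ :=
  bigOr d.size fun a => bigOr d.size fun b => guard (d.mulT a b = v)
    (and (left d (fun t => same 1 2 z t) 3 z a) (right d (fun t => same 1 2 z t) 4 z b))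

/-- The formula for `ShuffleBetween` the points `0` and `1`. -/
def shuffleBetween (i : ℕ) : MSO ℕ :=
  and (all 2 (imp (lt 0 2) (imp (lt 2 1) (imp (not (same 1 2 0 2)) (imp (not (same 1 2 2 1))
      (bigOr d.size fun v => guard (Presentation.Bit i v) (classVal d 2 v)))))))
    (all 3 (all 4 (imp (le 0 3) (imp (lt 3 4) (imp (le 4 1) (imp (not (same 1 2 3 4))
      (bigAnd d.size fun v => imp (guard (Presentation.Bit i v) verum)
        (ex 2 (and (lt 3 2) (and (lt 2 4) (and (not (same 1 2 3 2)) (and (not (same 1 2 2 4))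
          (classVal d 2 v)))))))))))))

/-- The formula for the condition `unique`. -/
def uniqueF : MSO ℕ :=
  all 0 (all 1 (imp (lt 0 1) (bigAnd d.size fun a => bigAnd d.size fun b =>
    imp (guess d.size a 0 1) (imp (guess d.size b 0 1) (guard (a = b) verum)))))

/-- The formula for the condition `add`. -/
def addF : MSO ℕ :=
  all 0 (all 1 (all 2 (imp (lt 0 1) (imp (lt 1 2) (bigAnd d.size fun a => bigAnd d.size fun b =>
    imp (guess d.size a 0 1) (imp (guess d.size b 1 2) (guess d.size (d.mulT a b) 0 2)))))))

/-- The formula for the condition `cut`. -/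
def cutF : MSO ℕ :=
  imp (all 0 (all 1 (imp (mem 1 0) (imp (lt 0 1) (mem 0 0)))))
    (all 0 (imp (mem 0 0) (all 1 (imp (not (mem 1 0))
      (bigAnd d.size fun a => bigAnd d.size fun b => imp (right d (fun t => mem t 0) 4 0 a)
        (imp (left d (fun t => not (mem t 0)) 3 1 b) (guess d.size (d.mulT a b) 0 1)))))))

/-- The formula for the condition `shuffle`. -/
def shuffleF : MSO ℕ :=
  all 0 (all 1 (imp (lt 0 1) (imp (not (same 1 2 0 1)) (bigAnd (2 ^ d.size) fun i =>
    imp (bigOr d.size fun v => guard (Presentation.Bit i v) verum) (imp (shuffleBetween d i)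
      (bigAnd d.size fun a => bigAnd d.size fun b =>
        imp (right d (fun t => same 1 2 0 t) 4 0 a) (imp (left d (fun t => same 1 2 1 t) 3 1 b)
          (guess d.size (d.mulT a (d.mulT (d.kappaT i) b)) 0 1))))))))

/-- The formula expressing that `v` is accepting. -/
def accepting (v : ℕ) : MSO ℕ :=
  bigOr d.accept.length fun j => guard (d.accept.getD j 0 = v) verum

/-- The formula for the condition `accept`. -/
def acceptF : MSO ℕ :=
  all 0 (bigAnd d.size fun a => bigAnd d.size fun b => imp (left d (fun _ => verum) 3 0 a)
    (imp (right d (fun _ => verum) 4 0 b) (accepting d (d.mulT a b))))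

/-- The conjunction of the consistency conditions. -/
def consistent : MSO ℕ :=
  and (uniqueF d) (and (addF d) (and (cutF d) (and (shuffleF d) (acceptF d))))

/-! ### Their semantics -/

section Sat

variable {d} {M : Type v} {eM : M ≃ Fin d.size} {C : CountableMonoid M} {K : Set M → M}
  {Acc : Set M} {X : Type} [LinearOrder X] [Countable X] {lN : X → ℕ} {lM : X → M}
  {ν : ℕ → Option X} {μ : ℕ → Set X} {x y : ℕ} {p q : X}

/-- The formulas `inS y` express membership in `S`, whatever the values of the variables from `20`
on. -/
def Interprets (lN : X → ℕ) (inS : ℕ → MSO ℕ) (ν : ℕ → Option X) (μ : ℕ → Set X) (S : Set X) :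
    Prop :=
  ∀ ν' : ℕ → Option X, (∀ i < 20, ν' i = ν i) → ∀ y p, y < 30 → ν' y = some p →
    (Sat ⟨X, lN⟩ (inS y) ν' μ ↔ p ∈ S)

theorem sat_closed (hd : d.Tabulates eM C K Acc) (hx : ν x = some p) (hy : ν y = some q)
    (hx30 : x < 30) (hy30 : y < 30) (m : M) :
    Sat ⟨X, lN⟩ (closed d (eM m) x y) ν μ ↔
      C.Closed ⟨X, lM⟩ (fun m p q => Guess μ d.size (eM m) p q) m p q := by
  unfold closed CountableMonoid.Closed
  rw [sat_or, sat_and, sat_and, sat_guard, sat_eq hx hy, sat_lt hx hy,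
    sat_guess hx hy hx30 hy30, hd.one, coe_equiv_inj]
  simp

theorem sat_image (hl : ∀ x, lN x < d.letters ∧ d.imageT (lN x) = eM (lM x)) (hx : ν x = some p)
    (m : M) : Sat ⟨X, lN⟩ (image d (eM m) x) ν μ ↔ lM p = m := by
  simp only [image, sat_bigOr, sat_guard, sat_letter (w := ⟨X, lN⟩) hx]
  constructor
  · rintro ⟨a, -, h, rfl⟩
    rwa [(hl p).2, coe_equiv_inj] at h
  · rintro rfl
    exact ⟨lN p, (hl p).1, (hl p).2, rfl⟩

/-- Updating the variables `20` and `21`. -/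
theorem Interprets.update {inS : ℕ → MSO ℕ} {S : Set X} (hS : Interprets lN inS ν μ S)
    {i : ℕ} (hi : 20 ≤ i) (a : Option X) : Interprets lN inS (Function.update ν i a) μ S :=
  fun ν' h => hS ν' fun j hj => by rw [h j hj, Function.update_of_ne (by omega)]

theorem Interprets.sat {inS : ℕ → MSO ℕ} {S : Set X} (hS : Interprets lN inS ν μ S)
    (hx : ν x = some p) (hx30 : x < 30) : Sat ⟨X, lN⟩ (inS x) ν μ ↔ p ∈ S :=
  hS ν (fun _ _ => rfl) x p hx30 hx

theorem sat_left (hd : d.Tabulates eM C K Acc) {inS : ℕ → MSO ℕ} {S : Set X}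
    (hS : Interprets lN inS ν μ S) (hx : ν x = some p) (hx20 : x < 20) (Z : ℕ) (m : M) :
    Sat ⟨X, lN⟩ (left d inS Z x (eM m)) ν μ ↔
      C.LeftVal ⟨X, lM⟩ (fun m p q => Guess μ d.size (eM m) p q) S (μ Z) p m := by
  have h20 : ∀ a : X, Function.update ν 20 (some a) 20 = some a := fun a => Function.update_self ..
  have hx1 : ∀ a : X, Function.update ν 20 (some a) x = some p := fun a => by
    rw [Function.update_of_ne (by omega), hx]
  have hS1 : ∀ a : X, Interprets lN inS (Function.update ν 20 (some a)) μ S := fun a =>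
    hS.update le_rfl _
  have h21 : ∀ a b : X, Function.update (Function.update ν 20 (some a)) 21 (some b) 21 = some b :=
    fun a b => Function.update_self ..
  have h20' : ∀ a b : X,
      Function.update (Function.update ν 20 (some a)) 21 (some b) 20 = some a := fun a b => by
    rw [Function.update_of_ne (by omega), h20]
  have hS2 : ∀ a b : X, Interprets lN inS
      (Function.update (Function.update ν 20 (some a)) 21 (some b)) μ S := fun a b =>
    (hS1 a).update (by omega) _
  unfold left CountableMonoid.LeftVal
  simp only [sat_or, sat_ex, sat_and, sat_all, sat_imp, sat_bigOr, sat_guard,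
    fun a => (hS1 a).sat (h20 a) (by omega), fun a b => (hS2 a b).sat (h21 a b) (by omega),
    fun a b => sat_le (w := ⟨X, lN⟩) (μ := μ) (h20' a b) (h21 a b),
    fun a b => sat_lt (w := ⟨X, lN⟩) (μ := μ) (h20' a b) (h21 a b),
    fun a b => sat_lt (w := ⟨X, lN⟩) (μ := μ) (h21 a b) (h20' a b),
    fun a b Y => sat_mem (w := ⟨X, lN⟩) (μ := μ) (h21 a b) (Y := Y),
    fun a Y => sat_mem (w := ⟨X, lN⟩) (μ := μ) (h20 a) (Y := Y),
    fun a => sat_lt (w := ⟨X, lN⟩) (μ := μ) (h20 a) (hx1 a),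
    fun a b n v => sat_guess (w := ⟨X, lN⟩) (μ := μ) (n := n) (v := v) (h20' a b) (h21 a b)
      (by omega) (by omega),
    fun a n v => sat_guess (w := ⟨X, lN⟩) (μ := μ) (n := n) (v := v) (h20 a) (hx1 a)
      (by omega) (by omega : x < 30),
    fun a m => sat_closed (lN := lN) (lM := lM) (μ := μ) hd (h20 a) (hx1 a) (by omega)
      (by omega : x < 30) m,
    exists_lt_iff_exists eM, hd.tauRev, hd.mul, coe_equiv_inj]

theorem sat_right (hd : d.Tabulates eM C K Acc)
    (hl : ∀ x, lN x < d.letters ∧ d.imageT (lN x) = eM (lM x)) {inS : ℕ → MSO ℕ} {S : Set X}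
    (hS : Interprets lN inS ν μ S) (hx : ν x = some p) (hx20 : x < 20) (Z : ℕ) (m : M) :
    Sat ⟨X, lN⟩ (right d inS Z x (eM m)) ν μ ↔
      C.RightVal ⟨X, lM⟩ (fun m p q => Guess μ d.size (eM m) p q) S (μ Z) p m := by
  have h20 : ∀ a : X, Function.update ν 20 (some a) 20 = some a := fun a => Function.update_self ..
  have hx1 : ∀ a : X, Function.update ν 20 (some a) x = some p := fun a => by
    rw [Function.update_of_ne (by omega), hx]
  have hS1 : ∀ a : X, Interprets lN inS (Function.update ν 20 (some a)) μ S := fun a =>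
    hS.update le_rfl _
  have h21 : ∀ a b : X, Function.update (Function.update ν 20 (some a)) 21 (some b) 21 = some b :=
    fun a b => Function.update_self ..
  have h20' : ∀ a b : X,
      Function.update (Function.update ν 20 (some a)) 21 (some b) 20 = some a := fun a b => by
    rw [Function.update_of_ne (by omega), h20]
  have hS2 : ∀ a b : X, Interprets lN inS
      (Function.update (Function.update ν 20 (some a)) 21 (some b)) μ S := fun a b =>
    (hS1 a).update (by omega) _
  have hswap : ∀ (y : X) (b : M) (G : Prop), (∃ c, C.mul b c = m ∧ lM y = c ∧ G) ↔
      (C.mul b (lM y) = m ∧ G) := by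
    intro y b G
    constructor
    · rintro ⟨c, h1, rfl, h2⟩
      exact ⟨h1, h2⟩
    · rintro ⟨h1, h2⟩
      exact ⟨_, h1, rfl, h2⟩
  unfold right CountableMonoid.RightVal
  simp only [sat_or, sat_ex, sat_and, sat_all, sat_imp, sat_bigOr, sat_guard,
    fun a => (hS1 a).sat (h20 a) (by omega), fun a b => (hS2 a b).sat (h21 a b) (by omega),
    fun a b => sat_le (w := ⟨X, lN⟩) (μ := μ) (h21 a b) (h20' a b),
    fun a b => sat_lt (w := ⟨X, lN⟩) (μ := μ) (h20' a b) (h21 a b),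
    fun a b Y => sat_mem (w := ⟨X, lN⟩) (μ := μ) (h21 a b) (Y := Y),
    fun a Y => sat_mem (w := ⟨X, lN⟩) (μ := μ) (h20 a) (Y := Y),
    fun a => sat_lt (w := ⟨X, lN⟩) (μ := μ) (hx1 a) (h20 a),
    fun a b n v => sat_guess (w := ⟨X, lN⟩) (μ := μ) (n := n) (v := v) (h20' a b) (h21 a b)
      (by omega) (by omega),
    fun a n v => sat_guess (w := ⟨X, lN⟩) (μ := μ) (n := n) (v := v) (hx1 a) (h20 a)
      (by omega : x < 30) (by omega),
    fun a m => sat_closed (lN := lN) (lM := lM) (μ := μ) hd (hx1 a) (h20 a) (by omega : x < 30)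
      (by omega) m,
    fun a m => sat_image (μ := μ) hl (h20 a) m,
    exists_lt_iff_exists eM, hd.tau, hd.mul, coe_equiv_inj, hswap]

theorem interprets_same {z : ℕ} (hz : ν z = some p) (hz20 : z < 20) :
    Interprets lN (fun t => same 1 2 z t) ν μ {t | SameColour (μ 1) (μ 2) p t} := by
  intro ν' h y q hy hyq
  exact sat_same (w := ⟨X, lN⟩) ((h z hz20).trans hz) hyq (by omega) (by omega)

theorem sat_classVal (hd : d.Tabulates eM C K Acc)
    (hl : ∀ x, lN x < d.letters ∧ d.imageT (lN x) = eM (lM x)) (hx : ν x = some p)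
    (hx20 : x < 20) (m : M) :
    Sat ⟨X, lN⟩ (classVal d x (eM m)) ν μ ↔
      C.ClassVal ⟨X, lM⟩ (fun m p q => Guess μ d.size (eM m) p q) (μ 1) (μ 2) (μ 3) (μ 4) p m := by
  have hS := interprets_same (lN := lN) (μ := μ) hx hx20
  simp only [classVal, CountableMonoid.ClassVal, sat_bigOr, sat_guard, sat_and,
    exists_lt_iff_exists eM, hd.mul, coe_equiv_inj, sat_left (lM := lM) hd hS hx hx20,
    sat_right hd hl hS hx hx20]

theorem sat_shuffleBetween (hd : d.Tabulates eM C K Acc)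
    (hl : ∀ x, lN x < d.letters ∧ d.imageT (lN x) = eM (lM x)) (h0 : ν 0 = some p)
    (h1 : ν 1 = some q) (i : ℕ) :
    Sat ⟨X, lN⟩ (shuffleBetween d i) ν μ ↔
      C.ShuffleBetween ⟨X, lM⟩ (fun m p q => Guess μ d.size (eM m) p q) (μ 1) (μ 2) (μ 3) (μ 4)
        {a | Presentation.Bit i (eM a)} p q := by
  unfold shuffleBetween CountableMonoid.ShuffleBetween
  rw [sat_and]
  refine and_congr ?_ ?_
  · rw [sat_all]
    refine forall_congr' fun z => ?_
    have g0 : Function.update ν 2 (some z) 0 = some p := by simp [h0]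
    have g1 : Function.update ν 2 (some z) 1 = some q := by simp [h1]
    have g2 : Function.update ν 2 (some z) 2 = some z := by simp
    simp only [sat_imp, sat_not, sat_lt (w := ⟨X, lN⟩) g0 g2, sat_lt (w := ⟨X, lN⟩) g2 g1,
      sat_same (w := ⟨X, lN⟩) g0 g2 (by omega) (by omega),
      sat_same (w := ⟨X, lN⟩) g2 g1 (by omega) (by omega), sat_bigOr, sat_guard,
      exists_lt_iff_exists eM, sat_classVal (lM := lM) hd hl g2 (by omega), mem_ofPred_eq]
  · rw [sat_all]
    refine forall_congr' fun u => ?_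
    rw [sat_all]
    refine forall_congr' fun v => ?_
    have g0 : Function.update (Function.update ν 3 (some u)) 4 (some v) 0 = some p := by simp [h0]
    have g1 : Function.update (Function.update ν 3 (some u)) 4 (some v) 1 = some q := by simp [h1]
    have g3 : Function.update (Function.update ν 3 (some u)) 4 (some v) 3 = some u := by simp
    have g4 : Function.update (Function.update ν 3 (some u)) 4 (some v) 4 = some v := by simp
    generalize Function.update (Function.update ν 3 (some u)) 4 (some v) = ν' at g0 g1 g3 g4
    have k3 : ∀ z : X, Function.update ν' 2 (some z) 3 = some u := fun z => by simp [g3]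
    have k4 : ∀ z : X, Function.update ν' 2 (some z) 4 = some v := fun z => by simp [g4]
    have k2 : ∀ z : X, Function.update ν' 2 (some z) 2 = some z := fun z => by simp
    simp only [sat_imp, sat_not, sat_and, sat_ex, sat_bigAnd, sat_guard, sat_verum, and_true,
      sat_le (w := ⟨X, lN⟩) g0 g3, sat_lt (w := ⟨X, lN⟩) g3 g4, sat_le (w := ⟨X, lN⟩) g4 g1,
      sat_same (w := ⟨X, lN⟩) g3 g4 (by omega) (by omega), forall_lt_iff_forall eM,
      fun z => sat_lt (w := ⟨X, lN⟩) (μ := μ) (k3 z) (k2 z),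
      fun z => sat_lt (w := ⟨X, lN⟩) (μ := μ) (k2 z) (k4 z),
      fun z S T => sat_same (w := ⟨X, lN⟩) (μ := μ) (S := S) (T := T) (k3 z) (k2 z) (by omega)
        (by omega),
      fun z S T => sat_same (w := ⟨X, lN⟩) (μ := μ) (S := S) (T := T) (k2 z) (k4 z) (by omega)
        (by omega),
      fun z m => sat_classVal (lM := lM) (μ := μ) hd hl (k2 z) (by omega) m, mem_ofPred_eq]

theorem sat_accepting (hd : d.Tabulates eM C K Acc) (m : M) :
    Sat ⟨X, lN⟩ (accepting d (eM m)) ν μ ↔ m ∈ Acc := by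
  simp only [accepting, sat_bigOr, sat_guard, sat_verum, and_true, hd.accept]

theorem sat_consistent (hd : d.Tabulates eM C K Acc)
    (hl : ∀ x, lN x < d.letters ∧ d.imageT (lN x) = eM (lM x)) :
    Sat ⟨X, lN⟩ (consistent d) ν μ ↔
      C.Consistent ⟨X, lM⟩ (fun m p q => Guess μ d.size (eM m) p q) (μ 0) (μ 1) (μ 2) (μ 3) (μ 4)
        K Acc := by
  have e0 : ∀ x y : X, Function.update (Function.update ν 0 (some x)) 1 (some y) 0 = some x :=
    fun x y => by simp
  have e1 : ∀ x y : X, Function.update (Function.update ν 0 (some x)) 1 (some y) 1 = some y :=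
    fun x y => by simp
  have hunique : Sat ⟨X, lN⟩ (uniqueF d) ν μ ↔ ∀ x y : X, x < y → ∀ m m' : M,
      Guess μ d.size (eM m) x y → Guess μ d.size (eM m') x y → m = m' := by
    simp only [uniqueF, sat_all]
    refine forall_congr' fun x => forall_congr' fun y => ?_
    simp only [sat_imp, sat_lt (w := ⟨X, lN⟩) (e0 x y) (e1 x y), sat_bigAnd, sat_guard, sat_verum,
      and_true, forall_lt_iff_forall eM, coe_equiv_inj,
      sat_guess (w := ⟨X, lN⟩) (e0 x y) (e1 x y) (by omega) (by omega)]
  have hadd : Sat ⟨X, lN⟩ (addF d) ν μ ↔ ∀ x y z : X, x < y → y < z → ∀ a b : M,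
      Guess μ d.size (eM a) x y → Guess μ d.size (eM b) y z →
        Guess μ d.size (eM (C.mul a b)) x z := by
    simp only [addF, sat_all]
    refine forall_congr' fun x => forall_congr' fun y => forall_congr' fun z => ?_
    have f0 : Function.update (Function.update (Function.update ν 0 (some x)) 1 (some y)) 2
      (some z) 0 = some x := by simp
    have f1 : Function.update (Function.update (Function.update ν 0 (some x)) 1 (some y)) 2
      (some z) 1 = some y := by simp
    have f2 : Function.update (Function.update (Function.update ν 0 (some x)) 1 (some y)) 2
      (some z) 2 = some z := by simp
    simp only [sat_imp, sat_lt (w := ⟨X, lN⟩) f0 f1, sat_lt (w := ⟨X, lN⟩) f1 f2, sat_bigAnd,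
      forall_lt_iff_forall eM, hd.mul, sat_guess (w := ⟨X, lN⟩) f0 f1 (by omega) (by omega),
      sat_guess (w := ⟨X, lN⟩) f1 f2 (by omega) (by omega),
      sat_guess (w := ⟨X, lN⟩) f0 f2 (by omega) (by omega)]
  have hcut : Sat ⟨X, lN⟩ (cutF d) ν μ ↔ ((∀ x y : X, y ∈ μ 0 → x < y → x ∈ μ 0) → ∀ x : X,
      x ∈ μ 0 → ∀ y : X, y ∉ μ 0 → ∀ a b,
      C.RightVal ⟨X, lM⟩ (fun m p q => Guess μ d.size (eM m) p q) (μ 0) (μ 4) x a →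
      C.LeftVal ⟨X, lM⟩ (fun m p q => Guess μ d.size (eM m) p q) (μ 0)ᶜ (μ 3) y b →
      Guess μ d.size (eM (C.mul a b)) x y) := by
    have g0 : ∀ x : X, Function.update ν 0 (some x) 0 = some x := fun x => by simp
    have hS1 : ∀ ν : ℕ → Option X, Interprets lN (fun t => mem t 0) ν μ (μ 0) :=
      fun ν ν' h y p hy hyp => sat_mem (w := ⟨X, lN⟩) hyp
    have hS2 : ∀ ν : ℕ → Option X, Interprets lN (fun t => not (mem t 0)) ν μ (μ 0)ᶜ :=
      fun ν ν' h y p hy hyp => not_congr (sat_mem (w := ⟨X, lN⟩) hyp)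
    simp only [cutF, sat_imp, sat_all, sat_not, sat_bigAnd, forall_lt_iff_forall eM, hd.mul,
      fun x Y => sat_mem (w := ⟨X, lN⟩) (μ := μ) (g0 x) (Y := Y),
      fun x y Y => sat_mem (w := ⟨X, lN⟩) (μ := μ) (e0 x y) (Y := Y),
      fun x y Y => sat_mem (w := ⟨X, lN⟩) (μ := μ) (e1 x y) (Y := Y),
      fun x y => sat_lt (w := ⟨X, lN⟩) (μ := μ) (e0 x y) (e1 x y),
      fun x y n v => sat_guess (w := ⟨X, lN⟩) (μ := μ) (n := n) (v := v) (e0 x y) (e1 x y)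
        (by omega) (by omega),
      fun x y => sat_right (μ := μ) hd hl (hS1 _) (e0 x y) (by omega),
      fun x y => sat_left (μ := μ) (lM := lM) hd (hS2 _) (e1 x y) (by omega)]
  have hshuffle : Sat ⟨X, lN⟩ (shuffleF d) ν μ ↔ ∀ x y : X, x < y →
      ¬ SameColour (μ 1) (μ 2) x y → ∀ P : Set M, P.Nonempty →
      C.ShuffleBetween ⟨X, lM⟩ (fun m p q => Guess μ d.size (eM m) p q) (μ 1) (μ 2) (μ 3) (μ 4)
        P x y → ∀ a b,
      C.RightVal ⟨X, lM⟩ (fun m p q => Guess μ d.size (eM m) p q)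
        {t | SameColour (μ 1) (μ 2) x t} (μ 4) x a →
      C.LeftVal ⟨X, lM⟩ (fun m p q => Guess μ d.size (eM m) p q)
        {t | SameColour (μ 1) (μ 2) y t} (μ 3) y b →
      Guess μ d.size (eM (C.mul a (C.mul (K P) b))) x y := by
    simp only [shuffleF, sat_all]
    refine forall_congr' fun x => forall_congr' fun y => ?_
    simp only [sat_imp, sat_not, sat_bigAnd, sat_bigOr, sat_guard, sat_verum, and_true,
      sat_lt (w := ⟨X, lN⟩) (e0 x y) (e1 x y), forall_lt_iff_forall eM, exists_lt_iff_exists eM,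
      sat_same (w := ⟨X, lN⟩) (e0 x y) (e1 x y) (by omega) (by omega),
      sat_shuffleBetween (lM := lM) hd hl (e0 x y) (e1 x y),
      sat_right hd hl (interprets_same (e0 x y) (by omega)) (e0 x y) (by omega),
      sat_left (lM := lM) hd (interprets_same (e1 x y) (by omega)) (e1 x y) (by omega),
      sat_guess (w := ⟨X, lN⟩) (e0 x y) (e1 x y) (by omega) (by omega)]
    refine imp_congr_right fun _ => imp_congr_right fun _ => ?_
    constructor
    · intro h P hP hsh a b ha hb
      obtain ⟨i, hi, rfl⟩ := hd.exists_index P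
      have := h i hi hP hsh a b ha hb
      rwa [hd.kappa i hi, hd.mul, hd.mul] at this
    · intro h i hi hP hsh a b ha hb
      rw [hd.kappa i hi, hd.mul, hd.mul]
      exact h _ hP hsh a b ha hb
  have haccept : Sat ⟨X, lN⟩ (acceptF d) ν μ ↔ ∀ (x : X) a b,
      C.LeftVal ⟨X, lM⟩ (fun m p q => Guess μ d.size (eM m) p q) univ (μ 3) x a →
      C.RightVal ⟨X, lM⟩ (fun m p q => Guess μ d.size (eM m) p q) univ (μ 4) x b →
      C.mul a b ∈ Acc := by
    have g0 : ∀ x : X, Function.update ν 0 (some x) 0 = some x := fun x => by simp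
    have hS : ∀ ν : ℕ → Option X, Interprets lN (fun _ => verum) ν μ univ :=
      fun ν ν' h y p hy hyp => by simp
    simp only [acceptF, sat_all, sat_imp, sat_bigAnd, forall_lt_iff_forall eM, hd.mul,
      sat_accepting hd, fun x => sat_right (μ := μ) hd hl (hS _) (g0 x) (by omega),
      fun x => sat_left (μ := μ) (lM := lM) hd (hS _) (g0 x) (by omega)]
  rw [consistent, sat_and, sat_and, sat_and, sat_and, hunique, hadd, hcut, hshuffle, haccept]
  exact ⟨fun ⟨h1, h2, h3, h4, h5⟩ => ⟨h1, h2, h3, h4, h5⟩,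
    fun ⟨h1, h2, h3, h4, h5⟩ => ⟨h1, h2, h3, h4, h5⟩⟩

end Sat

end MSO

namespace MSO

/-! ### The defining sentence -/

/-- Universal closure over all variable names up to the code of the formula. -/
@[irreducible] def closeAll (φ : MSO ℕ) : MSO ℕ := (List.range (φ.code + 1)).foldr all φ

/-- Existential closure over all names of set variables up to the code of the formula. -/
@[irreducible] def closeExSet (φ : MSO ℕ) : MSO ℕ := (List.range (φ.code + 1)).foldr exSet φ

/-- The first-order part of the defining sentence. -/
def matrix (d : Presentation) : MSO ℕ :=
  and (closeAll (consistent d)) (or (ex 0 verum) (accepting d d.one))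

/-- Universal quantification over the five set parameters. -/
def forallSets {A : Type u} (φ : MSO A) : MSO A :=
  allSet 0 (allSet 1 (allSet 2 (allSet 3 (allSet 4 φ))))

/-- The sentence defining the language presented by `d`. -/
def sentence (d : Presentation) : MSO ℕ := closeExSet (forallSets (matrix d))

/-! ### Free variables -/

theorem le_code_of_mem_freeVar {φ : MSO ℕ} {x : ℕ} (h : x ∈ φ.freeVar) : x ≤ φ.code := by
  induction φ with
  | falsum => simp [freeVar] at h
  | letter a y =>
    simp only [freeVar, Finset.mem_singleton] at h
    subst h
    exact (Nat.right_le_pair _ _).trans (Nat.right_le_pair _ _)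
  | lt y z | eq y z =>
    simp only [freeVar, Finset.mem_insert, Finset.mem_singleton] at h
    rcases h with rfl | rfl
    · exact (Nat.left_le_pair _ _).trans (Nat.right_le_pair _ _)
    · exact (Nat.right_le_pair _ _).trans (Nat.right_le_pair _ _)
  | mem y Y =>
    simp only [freeVar, Finset.mem_singleton] at h
    subst h
    exact (Nat.left_le_pair _ _).trans (Nat.right_le_pair _ _)
  | not φ ih => exact (ih h).trans (Nat.right_le_pair _ _)
  | and φ ψ ih1 ih2 | or φ ψ ih1 ih2 =>
    simp only [freeVar, Finset.mem_union] at h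
    rcases h with h | h
    · exact ((ih1 h).trans (Nat.left_le_pair _ _)).trans (Nat.right_le_pair _ _)
    · exact ((ih2 h).trans (Nat.right_le_pair _ _)).trans (Nat.right_le_pair _ _)
  | ex y φ ih | all y φ ih =>
    exact ((ih (Finset.mem_of_mem_erase h)).trans (Nat.right_le_pair _ _)).trans
      (Nat.right_le_pair _ _)
  | exSet y φ ih | allSet y φ ih =>
    exact ((ih h).trans (Nat.right_le_pair _ _)).trans (Nat.right_le_pair _ _)

theorem le_code_of_mem_freeSetVar {φ : MSO ℕ} {x : ℕ} (h : x ∈ φ.freeSetVar) : x ≤ φ.code := by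
  induction φ with
  | mem y Y =>
    simp only [freeSetVar, Finset.mem_singleton] at h
    subst h
    exact (Nat.right_le_pair _ _).trans (Nat.right_le_pair _ _)
  | not φ ih => exact (ih h).trans (Nat.right_le_pair _ _)
  | and φ ψ ih1 ih2 | or φ ψ ih1 ih2 =>
    simp only [freeSetVar, Finset.mem_union] at h
    rcases h with h | h
    · exact ((ih1 h).trans (Nat.left_le_pair _ _)).trans (Nat.right_le_pair _ _)
    · exact ((ih2 h).trans (Nat.right_le_pair _ _)).trans (Nat.right_le_pair _ _)
  | ex y φ ih | all y φ ih =>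
    exact ((ih h).trans (Nat.right_le_pair _ _)).trans (Nat.right_le_pair _ _)
  | exSet y φ ih | allSet y φ ih =>
    exact ((ih (Finset.mem_of_mem_erase h)).trans (Nat.right_le_pair _ _)).trans
      (Nat.right_le_pair _ _)
  | _ => simp [freeSetVar] at h

theorem freeVar_foldr_all (l : List ℕ) (φ : MSO ℕ) :
    (l.foldr all φ).freeVar = φ.freeVar \ l.toFinset := by
  induction l with
  | nil => simp
  | cons a l ih =>
    ext x
    simp only [List.foldr_cons, freeVar, ih, Finset.mem_erase, Finset.mem_sdiff, List.mem_toFinset,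
      List.mem_cons]
    tauto

theorem freeVar_foldr_exSet (l : List ℕ) (φ : MSO ℕ) :
    (l.foldr exSet φ).freeVar = φ.freeVar := by
  induction l with
  | nil => simp
  | cons a l ih => simpa [freeVar] using ih

theorem freeSetVar_foldr_exSet (l : List ℕ) (φ : MSO ℕ) :
    (l.foldr exSet φ).freeSetVar = φ.freeSetVar \ l.toFinset := by
  induction l with
  | nil => simp
  | cons a l ih =>
    ext x
    simp only [List.foldr_cons, freeSetVar, ih, Finset.mem_erase, Finset.mem_sdiff,
      List.mem_toFinset, List.mem_cons]
    tauto

theorem freeVar_accepting (d : Presentation) (v : ℕ) : (accepting d v).freeVar = ∅ := by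
  have : ∀ l : List ℕ, (l.foldr (fun j φ => or (guard (d.accept.getD j 0 = v) verum) φ)
      falsum).freeVar = ∅ := by
    intro l
    induction l with
    | nil => rfl
    | cons a l ih =>
      rw [List.foldr_cons, freeVar, ih, guard]
      split_ifs <;> rfl
  exact this _

theorem freeVar_closeAll (φ : MSO ℕ) : (closeAll φ).freeVar = ∅ := by
  rw [closeAll, freeVar_foldr_all, Finset.sdiff_eq_empty_iff_subset]
  intro x hx
  rw [List.mem_toFinset, List.mem_range]
  exact Nat.lt_succ_of_le (le_code_of_mem_freeVar hx)

theorem freeVar_closeExSet (φ : MSO ℕ) : (closeExSet φ).freeVar = φ.freeVar := by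
  rw [closeExSet, freeVar_foldr_exSet]

theorem freeSetVar_closeExSet (φ : MSO ℕ) : (closeExSet φ).freeSetVar = ∅ := by
  rw [closeExSet, freeSetVar_foldr_exSet, Finset.sdiff_eq_empty_iff_subset]
  intro x hx
  rw [List.mem_toFinset, List.mem_range]
  exact Nat.lt_succ_of_le (le_code_of_mem_freeSetVar hx)

theorem isSentence_sentence (d : Presentation) : (sentence d).IsSentence := by
  refine ⟨?_, freeSetVar_closeExSet _⟩
  rw [sentence, freeVar_closeExSet]
  simp only [forallSets, matrix, freeVar, freeVar_closeAll, freeVar_accepting]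
  rfl

/-! ### Semantics of the sentence -/

theorem sat_congr_set {w : Word ℕ} {φ : MSO ℕ} {ν : ℕ → Option w.dom} {μ μ' : ℕ → Set w.dom}
    (h : ∀ Y ∈ φ.freeSetVar, μ Y = μ' Y) : Sat w φ ν μ ↔ Sat w φ ν μ' := by
  induction φ generalizing ν μ μ' with
  | mem x Y => simp only [Sat, h Y (by simp [freeSetVar])]
  | not φ ih => exact not_congr (ih h)
  | and φ ψ ih1 ih2 =>
    exact and_congr (ih1 fun Y hY => h Y (Finset.mem_union_left _ hY))
      (ih2 fun Y hY => h Y (Finset.mem_union_right _ hY))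
  | or φ ψ ih1 ih2 =>
    exact or_congr (ih1 fun Y hY => h Y (Finset.mem_union_left _ hY))
      (ih2 fun Y hY => h Y (Finset.mem_union_right _ hY))
  | ex x φ ih => exact exists_congr fun p => ih h
  | all x φ ih => exact forall_congr' fun p => ih h
  | exSet X φ ih =>
    refine exists_congr fun P => ih fun Y hY => ?_
    by_cases hYX : Y = X
    · subst hYX; simp
    · simp [hYX, h Y (Finset.mem_erase.2 ⟨hYX, hY⟩)]
  | allSet X φ ih =>
    refine forall_congr' fun P => ih fun Y hY => ?_
    by_cases hYX : Y = X
    · subst hYX; simp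
    · simp [hYX, h Y (Finset.mem_erase.2 ⟨hYX, hY⟩)]
  | _ => exact Iff.rfl

theorem sat_foldr_exSet {w : Word ℕ} {φ : MSO ℕ} {ν : ℕ → Option w.dom} (l : List ℕ)
    {μ : ℕ → Set w.dom} : Sat w (l.foldr exSet φ) ν μ ↔
      ∃ μ' : ℕ → Set w.dom, (∀ Y, Y ∉ l → μ' Y = μ Y) ∧ Sat w φ ν μ' := by
  induction l generalizing μ with
  | nil =>
    constructor
    · exact fun h => ⟨μ, fun _ _ => rfl, h⟩
    · rintro ⟨μ', h, h'⟩
      rwa [← show μ' = μ from funext fun Y => h Y (by simp)]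
  | cons a l ih =>
    change (∃ P, Sat w (l.foldr exSet φ) ν (Function.update μ a P)) ↔ _
    simp only [ih]
    constructor
    · rintro ⟨P, μ', h, h'⟩
      refine ⟨μ', fun Y hY => ?_, h'⟩
      rw [List.mem_cons, not_or] at hY
      rw [h Y hY.2, Function.update_of_ne hY.1]
    · rintro ⟨μ', h, h'⟩
      refine ⟨μ' a, μ', fun Y hY => ?_, h'⟩
      by_cases hYa : Y = a
      · subst hYa; simp
      · rw [Function.update_of_ne hYa, h Y (by simp [hYa, hY])]

theorem sat_closeExSet {w : Word ℕ} {φ : MSO ℕ} {ν : ℕ → Option w.dom} {μ : ℕ → Set w.dom} :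
    Sat w (closeExSet φ) ν μ ↔ ∃ μ' : ℕ → Set w.dom, Sat w φ ν μ' := by
  rw [closeExSet, sat_foldr_exSet]
  constructor
  · rintro ⟨μ', -, h⟩
    exact ⟨μ', h⟩
  · rintro ⟨μ', h⟩
    refine ⟨fun Y => if Y ≤ φ.code then μ' Y else μ Y, fun Y hY => ?_, ?_⟩
    · rw [List.mem_range, not_lt] at hY
      exact if_neg (by omega)
    · rw [← sat_congr_set (μ := μ')]
      · exact h
      · intro Y hY
        exact (if_pos (le_code_of_mem_freeSetVar hY)).symm

theorem sat_closeAll {w : Word ℕ} {φ : MSO ℕ} {μ : ℕ → Set w.dom} {p : Prop}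
    (h : ∀ ν : ℕ → Option w.dom, Sat w φ ν μ ↔ p) (ν : ℕ → Option w.dom) :
    Sat w (closeAll φ) ν μ ↔ (Nonempty w.dom → p) := by
  by_cases hne : Nonempty w.dom
  · have : ∀ (l : List ℕ) (ν : ℕ → Option w.dom), Sat w (l.foldr all φ) ν μ ↔ p := by
      intro l
      induction l with
      | nil => exact h
      | cons a l ih => intro ν; simp [ih]
    simp [closeAll, this, hne]
  · rw [not_nonempty_iff] at hne
    simp [closeAll, List.range_succ_eq_map]

theorem guess_congr {X : Type*} [LinearOrder X] {μ μ' : ℕ → Set X} (h : ∀ i, 5 ≤ i → μ i = μ' i)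
    (n v : ℕ) (x y : X) : Guess μ n v x y ↔ Guess μ' n v x y := by
  have hs : ∀ t a b c d, μ (setVar t a b c d) = μ' (setVar t a b c d) := fun t a b c d =>
    h _ (Nat.le_add_right _ _)
  simp only [Guess, level, hs]

theorem models_sentence {d : Presentation} {M : Type v} {eM : M ≃ Fin d.size}
    {C : CountableMonoid M} {K : Set M → M} {Acc : Set M} (hd : d.Tabulates eM C K Acc)
    (hK : ∀ P : Set M, P.Nonempty → ∀ W : Word M, W.IsShuffle P → K P = C.prod W)
    {X : Type} [LinearOrder X] [Countable X] {lN : X → ℕ} {lM : X → M}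
    (hl : ∀ x, lN x < d.letters ∧ d.imageT (lN x) = eM (lM x)) :
    Models ⟨X, lN⟩ (sentence d) ↔ C.prod ⟨X, lM⟩ ∈ Acc := by
  have : Finite M := Finite.of_equiv _ eM.symm
  unfold Models sentence
  rw [sat_closeExSet]
  have hmat : ∀ (ν : ℕ → Option X) (μ : ℕ → Set X), Sat ⟨X, lN⟩ (matrix d) ν μ ↔
      (Nonempty X → C.Consistent ⟨X, lM⟩ (fun m p q => Guess μ d.size (eM m) p q)
        (μ 0) (μ 1) (μ 2) (μ 3) (μ 4) K Acc) ∧ (Nonempty X ∨ C.one ∈ Acc) := by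
    intro ν μ
    have hacc := sat_accepting (lN := lN) (ν := ν) (μ := μ) hd C.one
    rw [matrix, sat_and, sat_or, hd.one, hacc,
      sat_closeAll (w := ⟨X, lN⟩) (fun ν => sat_consistent (ν := ν) (μ := μ) hd hl)]
    simp only [sat_ex, sat_verum, exists_const_iff, and_true]
  have hsets : ∀ (ν : ℕ → Option X) (μ : ℕ → Set X), Sat ⟨X, lN⟩ (forallSets (matrix d)) ν μ ↔
      (Nonempty X → ∀ X₀ Y₁ Y₂ Z₁ Z₂, C.Consistent ⟨X, lM⟩
        (fun m p q => Guess μ d.size (eM m) p q) X₀ Y₁ Y₂ Z₁ Z₂ K Acc) ∧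
      (Nonempty X ∨ C.one ∈ Acc) := by
    intro ν μ
    change (∀ X₀ Y₁ Y₂ Z₁ Z₂ : Set X, Sat ⟨X, lN⟩ (matrix d) ν (Function.update (Function.update
      (Function.update (Function.update (Function.update μ 0 X₀) 1 Y₁) 2 Y₂) 3 Z₁) 4 Z₂)) ↔ _
    have hg : ∀ (X₀ Y₁ Y₂ Z₁ Z₂ : Set X) (n v : ℕ) (x y : X), Guess (Function.update
        (Function.update (Function.update (Function.update (Function.update μ 0 X₀) 1 Y₁) 2 Y₂)
          3 Z₁) 4 Z₂) n v x y ↔ Guess μ n v x y := by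
      intro X₀ Y₁ Y₂ Z₁ Z₂ n v x y
      refine guess_congr (fun i hi => ?_) n v x y
      rw [Function.update_of_ne (by omega), Function.update_of_ne (by omega),
        Function.update_of_ne (by omega), Function.update_of_ne (by omega),
        Function.update_of_ne (by omega)]
    simp only [hmat, hg]
    simp only [Function.update_self, Function.update_of_ne (show (0 : ℕ) ≠ 4 by omega),
      Function.update_of_ne (show (0 : ℕ) ≠ 3 by omega),
      Function.update_of_ne (show (0 : ℕ) ≠ 2 by omega),
      Function.update_of_ne (show (0 : ℕ) ≠ 1 by omega),
      Function.update_of_ne (show (1 : ℕ) ≠ 4 by omega),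
      Function.update_of_ne (show (1 : ℕ) ≠ 3 by omega),
      Function.update_of_ne (show (1 : ℕ) ≠ 2 by omega),
      Function.update_of_ne (show (2 : ℕ) ≠ 4 by omega),
      Function.update_of_ne (show (2 : ℕ) ≠ 3 by omega),
      Function.update_of_ne (show (3 : ℕ) ≠ 4 by omega)]
    constructor
    · exact fun h => ⟨fun hne a b c d e => (h a b c d e).1 hne, (h ∅ ∅ ∅ ∅ ∅).2⟩
    · exact fun h a b c d e => ⟨fun hne => h.1 hne a b c d e, h.2⟩
  have hempty : ¬ Nonempty X → C.prod ⟨X, lM⟩ = C.one := by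
    intro hne
    rw [not_nonempty_iff] at hne
    rw [← C.val_univ, ← C.val_empty ⟨X, lM⟩]
    congr 1
    exact Set.eq_empty_of_isEmpty (α := X) _
  constructor
  · rintro ⟨μ, h⟩
    rw [hsets] at h
    by_cases hne : Nonempty X
    · exact CountableMonoid.prod_mem_of_consistent (w := ⟨X, lM⟩) hK (h.1 hne)
    · rw [hempty hne]
      exact h.2.resolve_left hne
  · intro hacc
    let _ : Monoid M := C.toMonoid
    obtain ⟨μ, hμ⟩ := exists_guess eM (V := fun S : Set X => C.val ⟨X, lM⟩ S)
      ⟨C.val_empty ⟨X, lM⟩, C.val_union ⟨X, lM⟩⟩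
    refine ⟨μ, (hsets _ μ).2 ⟨fun _ X₀ Y₁ Y₂ Z₁ Z₂ => ?_, ?_⟩⟩
    · have hF : C.Correct ⟨X, lM⟩ (fun m p q => Guess μ d.size (eM m) p q) univ :=
        fun x _ y _ hxy m => hμ x y hxy m
      exact hF.consistent X₀ Y₁ Y₂ Z₁ Z₂ hK hacc
    · by_cases hne : Nonempty X
      · exact Or.inl hne
      · rw [hempty hne] at hacc
        exact Or.inr hacc

/-! ### Transfer to other alphabets -/

/-- First-order formulas all of whose letters are less than `N`. -/
def IsFirstOrderOn (N : ℕ) : MSO ℕ → Prop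
  | falsum => True
  | letter a _ => a < N
  | lt _ _ => True
  | eq _ _ => True
  | mem _ _ => True
  | not φ => φ.IsFirstOrderOn N
  | and φ ψ => φ.IsFirstOrderOn N ∧ ψ.IsFirstOrderOn N
  | or φ ψ => φ.IsFirstOrderOn N ∧ ψ.IsFirstOrderOn N
  | ex _ φ => φ.IsFirstOrderOn N
  | all _ φ => φ.IsFirstOrderOn N
  | exSet _ _ => False
  | allSet _ _ => False

theorem IsFirstOrderOn.exists_mapLetter {N : ℕ} {A : Type u} {f : A → ℕ}
    (hf : ∀ i < N, ∃ a, f a = i) {φ : MSO ℕ} (h : φ.IsFirstOrderOn N) :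
    ∃ ψ : MSO A, ψ.mapLetter f = φ ∧ ψ.IsFirstOrder := by
  induction φ with
  | falsum => exact ⟨falsum, rfl, trivial⟩
  | letter i x =>
    obtain ⟨a, rfl⟩ := hf i h
    exact ⟨letter a x, rfl, trivial⟩
  | lt x y => exact ⟨lt x y, rfl, trivial⟩
  | eq x y => exact ⟨eq x y, rfl, trivial⟩
  | mem x y => exact ⟨mem x y, rfl, trivial⟩
  | not φ ih =>
    obtain ⟨ψ, rfl, h'⟩ := ih h
    exact ⟨not ψ, rfl, h'⟩
  | and φ φ' ih ih' =>
    obtain ⟨ψ, rfl, h1⟩ := ih h.1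
    obtain ⟨ψ', rfl, h2⟩ := ih' h.2
    exact ⟨and ψ ψ', rfl, h1, h2⟩
  | or φ φ' ih ih' =>
    obtain ⟨ψ, rfl, h1⟩ := ih h.1
    obtain ⟨ψ', rfl, h2⟩ := ih' h.2
    exact ⟨or ψ ψ', rfl, h1, h2⟩
  | ex x φ ih =>
    obtain ⟨ψ, rfl, h'⟩ := ih h
    exact ⟨ex x ψ, rfl, h'⟩
  | all x φ ih =>
    obtain ⟨ψ, rfl, h'⟩ := ih h
    exact ⟨all x ψ, rfl, h'⟩
  | exSet x φ ih => exact h.elim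
  | allSet x φ ih => exact h.elim

theorem mapLetter_foldr_exSet {A : Type u} (f : A → ℕ) (l : List ℕ) (φ : MSO A) :
    (l.foldr exSet φ).mapLetter f = l.foldr exSet (φ.mapLetter f) := by
  induction l with
  | nil => rfl
  | cons a l ih => simp [mapLetter, ih]

theorem isExistsForall_foldr_exSet {A : Type u} (l : List ℕ) {φ : MSO A} (h : φ.IsForall) :
    (l.foldr exSet φ).IsExistsForall := by
  induction l with
  | nil => exact .base h
  | cons a l ih => exact .exSet ih

theorem freeVar_mapLetter {A : Type u} (f : A → ℕ) (φ : MSO A) :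
    (φ.mapLetter f).freeVar = φ.freeVar := by
  induction φ <;> simp_all [mapLetter, freeVar]

theorem freeSetVar_mapLetter {A : Type u} (f : A → ℕ) (φ : MSO A) :
    (φ.mapLetter f).freeSetVar = φ.freeSetVar := by
  induction φ <;> simp_all [mapLetter, freeSetVar]

theorem sat_mapLetter {A : Type u} {f : A → ℕ} (hf : Function.Injective f) (w : Word A)
    (φ : MSO A) (ν : ℕ → Option w.dom) (μ : ℕ → Set w.dom) :
    Sat ⟨w.dom, fun x => f (w.letter x)⟩ (φ.mapLetter f) ν μ ↔ Sat w φ ν μ := by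
  induction φ generalizing ν μ with
  | letter a x => simp [mapLetter, Sat, hf.eq_iff]
  | not φ ih => exact not_congr (ih ν μ)
  | and φ ψ ih1 ih2 => exact and_congr (ih1 ν μ) (ih2 ν μ)
  | or φ ψ ih1 ih2 => exact or_congr (ih1 ν μ) (ih2 ν μ)
  | ex x φ ih => exact exists_congr fun p => ih _ _
  | all x φ ih => exact forall_congr' fun p => ih _ _
  | exSet X φ ih => exact exists_congr fun p => ih _ _
  | allSet X φ ih => exact forall_congr' fun p => ih _ _
  | _ => exact Iff.rfl

section FirstOrder

variable {N : ℕ} {φ ψ : MSO ℕ}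

theorem isFirstOrderOn_and :
    (and φ ψ).IsFirstOrderOn N ↔ φ.IsFirstOrderOn N ∧ ψ.IsFirstOrderOn N := Iff.rfl

@[simp] theorem isFirstOrderOn_imp :
    (imp φ ψ).IsFirstOrderOn N ↔ φ.IsFirstOrderOn N ∧ ψ.IsFirstOrderOn N := Iff.rfl

@[simp] theorem isFirstOrderOn_le (x y : ℕ) : (le x y).IsFirstOrderOn N := trivial

theorem isFirstOrderOn_guard {p : Prop} [Decidable p] (h : φ.IsFirstOrderOn N) :
    (guard p φ).IsFirstOrderOn N := by
  unfold guard; split_ifs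
  · exact h
  · trivial

theorem isFirstOrderOn_bigOr {n : ℕ} {f : ℕ → MSO ℕ} (h : ∀ i < n, (f i).IsFirstOrderOn N) :
    (bigOr n f).IsFirstOrderOn N := by
  have : ∀ l : List ℕ, (∀ i ∈ l, (f i).IsFirstOrderOn N) →
      (l.foldr (fun i φ => or (f i) φ) falsum).IsFirstOrderOn N := by
    intro l
    induction l with
    | nil => exact fun _ => trivial
    | cons a l ih => exact fun h => ⟨h a (by simp), ih fun i hi => h i (by simp [hi])⟩
  exact this _ fun i hi => h i (List.mem_range.1 hi)

theorem isFirstOrderOn_bigAnd {n : ℕ} {f : ℕ → MSO ℕ} (h : ∀ i < n, (f i).IsFirstOrderOn N) :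
    (bigAnd n f).IsFirstOrderOn N := by
  have : ∀ l : List ℕ, (∀ i ∈ l, (f i).IsFirstOrderOn N) →
      (l.foldr (fun i φ => and (f i) φ) verum).IsFirstOrderOn N := by
    intro l
    induction l with
    | nil => exact fun _ => trivial
    | cons a l ih => exact fun h => ⟨h a (by simp), ih fun i hi => h i (by simp [hi])⟩
  exact this _ fun i hi => h i (List.mem_range.1 hi)

theorem isFirstOrderOn_closeAll (h : φ.IsFirstOrderOn N) : (closeAll φ).IsFirstOrderOn N := by
  have : ∀ l : List ℕ, (l.foldr all φ).IsFirstOrderOn N := by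
    intro l
    induction l with
    | nil => exact h
    | cons a l ih => exact ih
  rw [closeAll]
  exact this _

theorem isFirstOrderOn_same (S T x y : ℕ) : (same S T x y).IsFirstOrderOn N := by
  simp [same, IsFirstOrderOn]

theorem isFirstOrderOn_guess (n v x y : ℕ) : (guess n v x y).IsFirstOrderOn N := by
  have hlook : ∀ k t, (look n k t v x y).IsFirstOrderOn N := fun k t =>
    isFirstOrderOn_bigOr fun _ _ => ⟨trivial, trivial⟩
  refine isFirstOrderOn_bigOr fun k _ => ?_
  simp [two, three, IsFirstOrderOn, hlook, isFirstOrderOn_same]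

variable (d : Presentation) {inS : ℕ → MSO ℕ}

theorem isFirstOrderOn_closed (v x y : ℕ) : (closed d v x y).IsFirstOrderOn N :=
  ⟨⟨trivial, isFirstOrderOn_guard trivial⟩, trivial, isFirstOrderOn_guess _ _ _ _⟩

theorem isFirstOrderOn_left (h : ∀ x, (inS x).IsFirstOrderOn N) (Z x v : ℕ) :
    (left d inS Z x v).IsFirstOrderOn N := by
  refine ⟨?_, ?_, isFirstOrderOn_bigOr fun e _ => ⟨?_, isFirstOrderOn_bigOr fun b _ =>
    isFirstOrderOn_guard ?_⟩⟩ <;>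
  simp [IsFirstOrderOn, h, isFirstOrderOn_guess, isFirstOrderOn_closed]

theorem isFirstOrderOn_right (h : ∀ x, (inS x).IsFirstOrderOn d.letters) (Z x v : ℕ) :
    (right d inS Z x v).IsFirstOrderOn d.letters := by
  have himage : ∀ c x, (image d c x).IsFirstOrderOn d.letters := fun c x =>
    isFirstOrderOn_bigOr fun a ha => isFirstOrderOn_guard ha
  have hb : ∀ x, (bigOr d.size fun b => bigOr d.size fun c => guard (d.mulT b c = v)
      (and (image d c 20) (closed d b x 20))).IsFirstOrderOn d.letters := fun x =>
    isFirstOrderOn_bigOr fun b _ => isFirstOrderOn_bigOr fun c _ =>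
      isFirstOrderOn_guard ⟨himage c 20, isFirstOrderOn_closed d b x 20⟩
  refine ⟨?_, ?_, isFirstOrderOn_bigOr fun e _ => ⟨?_, isFirstOrderOn_bigOr fun b _ =>
    isFirstOrderOn_guard ?_⟩⟩ <;>
  simp [IsFirstOrderOn, h, isFirstOrderOn_guess, hb]

theorem isFirstOrderOn_classVal (z v : ℕ) : (classVal d z v).IsFirstOrderOn d.letters :=
  isFirstOrderOn_bigOr fun _ _ => isFirstOrderOn_bigOr fun _ _ => isFirstOrderOn_guard
    ⟨isFirstOrderOn_left d (fun _ => isFirstOrderOn_same _ _ _ _) _ _ _,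
      isFirstOrderOn_right d (fun _ => isFirstOrderOn_same _ _ _ _) _ _ _⟩

theorem isFirstOrderOn_shuffleBetween (i : ℕ) :
    (shuffleBetween d i).IsFirstOrderOn d.letters := by
  have h1 : (bigOr d.size fun v => guard (Presentation.Bit i v)
      (classVal d 2 v)).IsFirstOrderOn d.letters :=
    isFirstOrderOn_bigOr fun _ _ => isFirstOrderOn_guard (isFirstOrderOn_classVal d _ _)
  have h2 : (bigAnd d.size fun v => imp (guard (Presentation.Bit i v) verum)
        (ex 2 (and (lt 3 2) (and (lt 2 4) (and (not (same 1 2 3 2)) (and (not (same 1 2 2 4))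
          (classVal d 2 v))))))).IsFirstOrderOn d.letters :=
    isFirstOrderOn_bigAnd fun _ _ => ⟨isFirstOrderOn_guard trivial, trivial, trivial,
      isFirstOrderOn_same _ _ _ _, isFirstOrderOn_same _ _ _ _, isFirstOrderOn_classVal d _ _⟩
  simp [shuffleBetween, IsFirstOrderOn, isFirstOrderOn_same, h1, h2]

theorem isFirstOrderOn_accepting (v : ℕ) : (accepting d v).IsFirstOrderOn N :=
  isFirstOrderOn_bigOr fun _ _ => isFirstOrderOn_guard trivial

theorem isFirstOrderOn_consistent : (consistent d).IsFirstOrderOn d.letters := by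
  have hguess := fun v x y => isFirstOrderOn_guess (N := d.letters) d.size v x y
  have hmem : ∀ x : ℕ, (mem x 0).IsFirstOrderOn d.letters := fun _ => trivial
  have hnot : ∀ x : ℕ, (not (mem x 0)).IsFirstOrderOn d.letters := fun _ => trivial
  have htrue : ℕ → verum.IsFirstOrderOn d.letters := fun _ => trivial
  have hsame := fun x y => isFirstOrderOn_same (N := d.letters) 1 2 x y
  refine ⟨?_, ?_, ?_, ?_, ?_⟩
  · exact ⟨trivial, isFirstOrderOn_bigAnd fun a _ => isFirstOrderOn_bigAnd fun b _ =>
      ⟨hguess a 0 1, hguess b 0 1, isFirstOrderOn_guard trivial⟩⟩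
  · exact ⟨trivial, trivial, isFirstOrderOn_bigAnd fun a _ => isFirstOrderOn_bigAnd fun b _ =>
      ⟨hguess a 0 1, hguess b 1 2, hguess _ 0 2⟩⟩
  · exact ⟨⟨trivial, trivial, trivial⟩, trivial, trivial,
      isFirstOrderOn_bigAnd fun a _ => isFirstOrderOn_bigAnd fun b _ =>
      isFirstOrderOn_imp.2 ⟨isFirstOrderOn_right d hmem 4 0 a,
        isFirstOrderOn_imp.2 ⟨isFirstOrderOn_left d hnot 3 1 b, hguess _ 0 1⟩⟩⟩
  · exact ⟨trivial, hsame 0 1, isFirstOrderOn_bigAnd fun i _ =>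
      isFirstOrderOn_imp.2 ⟨isFirstOrderOn_bigOr fun _ _ => isFirstOrderOn_guard trivial,
      isFirstOrderOn_imp.2 ⟨isFirstOrderOn_shuffleBetween d i,
        isFirstOrderOn_bigAnd fun a _ => isFirstOrderOn_bigAnd fun b _ =>
        isFirstOrderOn_imp.2 ⟨isFirstOrderOn_right d (hsame 0) 4 0 a,
          isFirstOrderOn_imp.2 ⟨isFirstOrderOn_left d (hsame 1) 3 1 b, hguess _ 0 1⟩⟩⟩⟩⟩
  · exact isFirstOrderOn_bigAnd fun a _ => isFirstOrderOn_bigAnd fun b _ =>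
      isFirstOrderOn_imp.2 ⟨isFirstOrderOn_left d htrue 3 0 a,
        isFirstOrderOn_imp.2 ⟨isFirstOrderOn_right d htrue 4 0 b, isFirstOrderOn_accepting d _⟩⟩

theorem isFirstOrderOn_matrix : (matrix d).IsFirstOrderOn d.letters :=
  isFirstOrderOn_and.2 ⟨isFirstOrderOn_closeAll (isFirstOrderOn_consistent d), trivial,
    isFirstOrderOn_accepting d _⟩

end FirstOrder

/-- The sentence `sentence d` over the alphabet `A` it is meant for. -/
theorem exists_mapLetter_eq_sentence (d : Presentation) {A : Type u} (eA : A ≃ Fin d.letters) :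
    ∃ φ : MSO A, sentence d = φ.mapLetter (fun a => (eA a : ℕ)) ∧ φ.IsExistsForall ∧
      φ.IsSentence := by
  obtain ⟨ψ, hψ, hfo⟩ := (isFirstOrderOn_matrix d).exists_mapLetter (f := fun a => (eA a : ℕ))
    fun i hi => ⟨eA.symm ⟨i, hi⟩, by simp⟩
  have heq : sentence d = ((List.range ((forallSets (matrix d)).code + 1)).foldr exSet
      (forallSets ψ)).mapLetter (fun a => (eA a : ℕ)) := by
    rw [mapLetter_foldr_exSet, sentence, closeExSet]
    simp only [forallSets, mapLetter, hψ]
  refine ⟨_, heq, isExistsForall_foldr_exSet _ ?_, ?_⟩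
  · exact .allSet (.allSet (.allSet (.allSet (.allSet (.base hfo)))))
  · have h := isSentence_sentence d
    rw [heq] at h
    exact ⟨(freeVar_mapLetter _ _).symm.trans h.1, (freeSetVar_mapLetter _ _).symm.trans h.2⟩

end MSO

/-! ### Computability of the defining sentence -/

theorem Primrec.two_pow : Primrec fun n : ℕ => 2 ^ n :=
  (Primrec.nat_rec₁ 1 (Primrec.nat_mul.comp Primrec.snd (Primrec.const 2)).to₂).of_eq fun n => by
    induction n with
    | zero => rfl
    | succ n ih => rw [pow_succ, ← ih]

namespace Presentation

theorem primrec_equivProd : Primrec equivProd := Primrec.of_equiv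

theorem primrec_letters : Primrec letters :=
  (Primrec.fst.comp primrec_equivProd).of_eq fun _ => rfl

theorem primrec_size : Primrec size :=
  (Primrec.fst.comp (Primrec.snd.comp primrec_equivProd)).of_eq fun _ => rfl

theorem primrec_one : Primrec one :=
  (Primrec.fst.comp (Primrec.snd.comp (Primrec.snd.comp primrec_equivProd))).of_eq fun _ => rfl

theorem primrec_tables : Primrec fun d : Presentation =>
    (d.mul, d.tau, d.tauRev, d.kappa, d.image, d.accept) :=
  (Primrec.snd.comp (Primrec.snd.comp (Primrec.snd.comp primrec_equivProd))).of_eq fun _ => rfl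

theorem primrec_mul : Primrec mul := (Primrec.fst.comp primrec_tables).of_eq fun _ => rfl

theorem primrec_tau : Primrec tau :=
  (Primrec.fst.comp (Primrec.snd.comp primrec_tables)).of_eq fun _ => rfl

theorem primrec_tauRev : Primrec tauRev :=
  (Primrec.fst.comp (Primrec.snd.comp (Primrec.snd.comp primrec_tables))).of_eq fun _ => rfl

theorem primrec_kappa : Primrec kappa :=
  (Primrec.fst.comp (Primrec.snd.comp (Primrec.snd.comp (Primrec.snd.comp
    primrec_tables)))).of_eq fun _ => rfl

theorem primrec_image : Primrec image :=
  (Primrec.fst.comp (Primrec.snd.comp (Primrec.snd.comp (Primrec.snd.comp (Primrec.snd.comp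
    primrec_tables))))).of_eq fun _ => rfl

theorem primrec_accept : Primrec accept :=
  (Primrec.snd.comp (Primrec.snd.comp (Primrec.snd.comp (Primrec.snd.comp (Primrec.snd.comp
    primrec_tables))))).of_eq fun _ => rfl

variable {α : Type*} [Primcodable α] {d : α → Presentation} {f g : α → ℕ}

theorem primrec_mulT (hd : Primrec d) (hf : Primrec f) (hg : Primrec g) :
    Primrec fun a => (d a).mulT (f a) (g a) :=
  (Primrec.list_getD 0).comp (primrec_mul.comp hd)
    (Primrec.nat_add.comp (Primrec.nat_mul.comp (primrec_size.comp hd) hf) hg)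

theorem primrec_tauT (hd : Primrec d) (hf : Primrec f) : Primrec fun a => (d a).tauT (f a) :=
  (Primrec.list_getD 0).comp (primrec_tau.comp hd) hf

theorem primrec_tauRevT (hd : Primrec d) (hf : Primrec f) :
    Primrec fun a => (d a).tauRevT (f a) :=
  (Primrec.list_getD 0).comp (primrec_tauRev.comp hd) hf

theorem primrec_kappaT (hd : Primrec d) (hf : Primrec f) : Primrec fun a => (d a).kappaT (f a) :=
  Primrec.nat_mod.comp ((Primrec.list_getD 0).comp (primrec_kappa.comp hd) hf)
    (primrec_size.comp hd)

theorem primrec_imageT (hd : Primrec d) (hf : Primrec f) : Primrec fun a => (d a).imageT (f a) :=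
  (Primrec.list_getD 0).comp (primrec_image.comp hd) hf

theorem primrecPred_bit (hf : Primrec f) (hg : Primrec g) :
    PrimrecPred fun a => Bit (f a) (g a) :=
  Primrec.eq.comp (Primrec.nat_mod.comp (Primrec.nat_div.comp hf (Primrec.two_pow.comp hg))
    (Primrec.const 2)) (Primrec.const 1)

end Presentation

namespace MSO

variable {α : Type*} [Primcodable α]

/-- The formula `F a` is computed from `a` by a primitive recursive function. -/
def PrimrecFormula (F : α → MSO ℕ) : Prop := Primrec fun a => (F a).code

theorem primrec_natPair {f g : α → ℕ} (hf : Primrec f) (hg : Primrec g) :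
    Primrec fun a => Nat.pair (f a) (g a) := Primrec₂.natPair.comp hf hg

theorem primrec_setVar (tag : ℕ) {a b c e : α → ℕ} (ha : Primrec a) (hb : Primrec b)
    (hc : Primrec c) (he : Primrec e) :
    Primrec fun i => setVar tag (a i) (b i) (c i) (e i) :=
  Primrec.nat_add.comp (Primrec.const 5) (primrec_natPair (Primrec.const tag)
    (primrec_natPair ha (primrec_natPair hb (primrec_natPair hc he))))

theorem primrec_labels : Primrec labels := by
  have h : Primrec fun n : ℕ => n * (n * n) :=
    Primrec.nat_mul.comp .id (Primrec.nat_mul.comp .id .id)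
  exact Primrec.nat_mul.comp h (Primrec.nat_mul.comp (Primrec.const 2) h)

namespace PrimrecFormula

variable {F G : α → MSO ℕ} {f n : α → ℕ}

theorem const (φ : MSO ℕ) : PrimrecFormula fun _ : α => φ := Primrec.const φ.code

theorem letter (hf : Primrec f) (x : ℕ) : PrimrecFormula fun a => letter (f a) x :=
  primrec_natPair (Primrec.const 1) (primrec_natPair hf (Primrec.const x))

theorem mem (x : ℕ) (hf : Primrec f) : PrimrecFormula fun a => mem x (f a) :=
  primrec_natPair (Primrec.const 4) (primrec_natPair (Primrec.const x) hf)

theorem not (hF : PrimrecFormula F) : PrimrecFormula fun a => not (F a) :=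
  primrec_natPair (Primrec.const 5) hF

theorem and (hF : PrimrecFormula F) (hG : PrimrecFormula G) :
    PrimrecFormula fun a => and (F a) (G a) :=
  primrec_natPair (Primrec.const 6) (primrec_natPair hF hG)

theorem or (hF : PrimrecFormula F) (hG : PrimrecFormula G) :
    PrimrecFormula fun a => or (F a) (G a) :=
  primrec_natPair (Primrec.const 7) (primrec_natPair hF hG)

theorem imp (hF : PrimrecFormula F) (hG : PrimrecFormula G) :
    PrimrecFormula fun a => imp (F a) (G a) := hF.not.or hG

theorem ex (x : ℕ) (hF : PrimrecFormula F) : PrimrecFormula fun a => ex x (F a) :=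
  primrec_natPair (Primrec.const 8) (primrec_natPair (Primrec.const x) hF)

theorem all (x : ℕ) (hF : PrimrecFormula F) : PrimrecFormula fun a => all x (F a) :=
  primrec_natPair (Primrec.const 9) (primrec_natPair (Primrec.const x) hF)

theorem allSet (hF : PrimrecFormula F) (x : ℕ) : PrimrecFormula fun a => allSet x (F a) :=
  primrec_natPair (Primrec.const 11) (primrec_natPair (Primrec.const x) hF)

theorem guard {p : α → Prop} [DecidablePred p] (hp : PrimrecPred p) (hF : PrimrecFormula F) :
    PrimrecFormula fun a => guard (p a) (F a) :=
  (Primrec.ite hp hF (Primrec.const falsum.code)).of_eq fun a => by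
    simp only [MSO.guard]; split_ifs <;> rfl

theorem guard_eq {g : α → ℕ} (hf : Primrec f) (hg : Primrec g) (hF : PrimrecFormula F) :
    PrimrecFormula fun a => MSO.guard (f a = g a) (F a) :=
  guard (p := fun a => f a = g a) (Primrec.eq.comp hf hg) hF

/-- Formulas built by folding a constructor are primitive recursive. -/
theorem foldr {op : α → ℕ → MSO ℕ → MSO ℕ} {h : α → ℕ × ℕ → ℕ}
    (hop : ∀ a i φ, (op a i φ).code = h a (i, φ.code)) (hh : Primrec₂ h) (hn : Primrec n)
    (hG : PrimrecFormula G) :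
    PrimrecFormula fun a => (List.range (n a)).foldr (op a) (G a) :=
  (Primrec.list_foldr (Primrec.list_range.comp hn) hG hh).of_eq fun a => by
    beta_reduce
    induction List.range (n a) with
    | nil => rfl
    | cons i l ih => rw [List.foldr_cons, List.foldr_cons, hop, ih]

theorem bigOr {H : α → ℕ → MSO ℕ} (hn : Primrec n) (hH : PrimrecFormula fun p : α × ℕ => H p.1 p.2) :
    PrimrecFormula fun a => bigOr (n a) (H a) :=
  foldr (op := fun a i φ => MSO.or (H a i) φ)
    (h := fun a p => Nat.pair 7 (Nat.pair (H a p.1).code p.2)) (fun _ _ _ => rfl)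
    (primrec_natPair (Primrec.const 7) (primrec_natPair
      (hH.comp (Primrec.pair Primrec.fst (Primrec.fst.comp Primrec.snd)))
      (Primrec.snd.comp Primrec.snd))).to₂ hn (const falsum)

theorem bigAnd {H : α → ℕ → MSO ℕ} (hn : Primrec n)
    (hH : PrimrecFormula fun p : α × ℕ => H p.1 p.2) :
    PrimrecFormula fun a => bigAnd (n a) (H a) :=
  foldr (op := fun a i φ => MSO.and (H a i) φ)
    (h := fun a p => Nat.pair 6 (Nat.pair (H a p.1).code p.2)) (fun _ _ _ => rfl)
    (primrec_natPair (Primrec.const 6) (primrec_natPair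
      (hH.comp (Primrec.pair Primrec.fst (Primrec.fst.comp Primrec.snd)))
      (Primrec.snd.comp Primrec.snd))).to₂ hn (const verum)

theorem closeAll (hF : PrimrecFormula F) : PrimrecFormula fun a => closeAll (F a) := by
  simp only [MSO.closeAll]
  exact foldr (op := fun _ => MSO.all) (h := fun _ p => Nat.pair 9 (Nat.pair p.1 p.2))
    (fun _ _ _ => rfl) (primrec_natPair (Primrec.const 9) (primrec_natPair
      (Primrec.fst.comp Primrec.snd) (Primrec.snd.comp Primrec.snd))).to₂
    (Primrec.succ.comp hF) hF

theorem closeExSet (hF : PrimrecFormula F) : PrimrecFormula fun a => closeExSet (F a) := by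
  simp only [MSO.closeExSet]
  exact foldr (op := fun _ => MSO.exSet) (h := fun _ p => Nat.pair 10 (Nat.pair p.1 p.2))
    (fun _ _ _ => rfl) (primrec_natPair (Primrec.const 10) (primrec_natPair
      (Primrec.fst.comp Primrec.snd) (Primrec.snd.comp Primrec.snd))).to₂
    (Primrec.succ.comp hF) hF

theorem same {S T : α → ℕ} (hS : Primrec S) (hT : Primrec T) (x y : ℕ) :
    PrimrecFormula fun a => same (S a) (T a) x y :=
  all _ <| imp (const _) <| and
    (and (imp (mem _ hS) (mem _ hS)) (imp (mem _ hS) (mem _ hS)))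
    (and (imp (mem _ hT) (mem _ hT)) (imp (mem _ hT) (mem _ hT)))

theorem two {S T : α → ℕ} (hS : Primrec S) (hT : Primrec T) (x y : ℕ) :
    PrimrecFormula fun a => two (S a) (T a) x y :=
  all _ <| imp (const _) <| imp (const _) <| or (same hS hT _ _) (same hS hT _ _)

theorem three {S T : α → ℕ} (hS : Primrec S) (hT : Primrec T) (x y : ℕ) :
    PrimrecFormula fun a => three (S a) (T a) x y :=
  ex _ <| and (const _) <| and (const _) <| all _ <| imp (const _) <| imp (const _) <|
    or (same hS hT _ _) (or (same hS hT _ _) (same hS hT _ _))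

open Presentation

theorem look {n k v : α → ℕ} (hn : Primrec n) (hk : Primrec k) (hv : Primrec v)
    (t x y : ℕ) : PrimrecFormula fun a => look (n a) (k a) t (v a) x y :=
  bigOr (primrec_labels.comp hn) <| and
    (mem _ (primrec_setVar 2 (hk.comp .fst) (.const t) .snd (hv.comp .fst)))
    (mem _ (primrec_setVar 1 (hk.comp .fst) .snd (.const 0) (.const 0)))

theorem guess {n v : α → ℕ} (hn : Primrec n) (hv : Primrec v) (x y : ℕ) :
    PrimrecFormula fun a => guess (n a) (v a) x y := by
  have h0 : Primrec fun p : α × ℕ => setVar 0 p.2 0 0 0 :=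
    primrec_setVar 0 .snd (.const 0) (.const 0) (.const 0)
  have h1 : Primrec fun p : α × ℕ => setVar 0 p.2 1 0 0 :=
    primrec_setVar 0 .snd (.const 1) (.const 0) (.const 0)
  have h2 : Primrec fun p : α × ℕ => setVar 0 (p.2 + 1) 0 0 0 :=
    primrec_setVar 0 (Primrec.succ.comp .snd) (.const 0) (.const 0) (.const 0)
  have h3 : Primrec fun p : α × ℕ => setVar 0 (p.2 + 1) 1 0 0 :=
    primrec_setVar 0 (Primrec.succ.comp .snd) (.const 1) (.const 0) (.const 0)
  have hl := fun t => look (hn.comp (Primrec.fst (β := ℕ))) .snd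
    (hv.comp Primrec.fst) t x y
  exact bigOr hn <| and (same h2 h3 x y) <| and (same h0 h1 x y).not <|
    or (and (two h0 h1 x y) (hl 0)) <| or (and (two h0 h1 x y).not (and (three h0 h1 x y) (hl 1)))
      (and (three h0 h1 x y).not (hl 2))

variable {d : α → Presentation} {v : α → ℕ}

theorem closed (hd : Primrec d) (hv : Primrec v) (x y : ℕ) :
    PrimrecFormula fun a => closed (d a) (v a) x y :=
  or (and (const _) (guard_eq hv (primrec_one.comp hd) (const _)))
    (and (const _) (guess (primrec_size.comp hd) hv x y))

theorem image (hd : Primrec d) (hv : Primrec v) (x : ℕ) :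
    PrimrecFormula fun a => image (d a) (v a) x :=
  bigOr (primrec_letters.comp hd) <|
    guard_eq (primrec_imageT (hd.comp .fst) .snd) (hv.comp .fst) (letter .snd x)

theorem left (hd : Primrec d) (hv : Primrec v) (inS : ℕ → MSO ℕ) (Z x : ℕ) :
    PrimrecFormula fun a => left (d a) inS Z x (v a) := by
  have hs := primrec_size.comp hd
  have hs' := hs.comp (Primrec.fst (α := α) (β := ℕ))
  refine or (ex _ <| and (const _) <| and (const _) (closed hd hv _ _)) <|
    and (const _) <| bigOr hs <| and ?_ <| bigOr hs' <| guard_eq (primrec_mulT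
      ((hd.comp .fst).comp .fst) (primrec_tauRevT ((hd.comp .fst).comp .fst)
        (Primrec.snd.comp .fst)) .snd) ((hv.comp .fst).comp .fst) ?_
  · exact all _ <| imp (const _) <| imp (const _) <| all _ <| imp (const _) <| imp (const _) <|
      imp (const _) <| guess hs' .snd _ _
  · exact ex _ <| and (const _) <| and (const _) <| and (const _) <|
      guess (hs'.comp .fst) .snd _ _

theorem right (hd : Primrec d) (hv : Primrec v) (inS : ℕ → MSO ℕ) (Z x : ℕ) :
    PrimrecFormula fun a => right (d a) inS Z x (v a) := by
  have hs := primrec_size.comp hd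
  have hs' := hs.comp (Primrec.fst (α := α) (β := ℕ))
  have hd' : Primrec fun p : (α × ℕ) × ℕ => d p.1.1 := (hd.comp .fst).comp .fst
  have hv' : Primrec fun p : (α × ℕ) × ℕ => v p.1.1 := (hv.comp .fst).comp .fst
  have he : Primrec fun p : (α × ℕ) × ℕ => p.1.2 := Primrec.snd.comp .fst
  refine or (ex _ <| and (const _) <| and (const _) <| bigOr hs <| bigOr hs' <|
      guard_eq (primrec_mulT hd' he .snd) hv' <| and (image hd' .snd _)
        (closed hd' he _ _)) <|
    and (const _) <| bigOr hs <| and ?_ <| bigOr hs' <| guard_eq (primrec_mulT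
      hd' .snd (primrec_tauT hd' he)) hv' ?_
  · exact all _ <| imp (const _) <| imp (const _) <| all _ <| imp (const _) <| imp (const _) <|
      imp (const _) <| guess hs' .snd _ _
  · exact ex _ <| and (const _) <| and (const _) <| and (const _) <|
      guess (hs'.comp .fst) .snd _ _

theorem classVal (hd : Primrec d) (hv : Primrec v) (z : ℕ) :
    PrimrecFormula fun a => classVal (d a) z (v a) := by
  have hs := primrec_size.comp hd
  have hd' : Primrec fun p : (α × ℕ) × ℕ => d p.1.1 := (hd.comp .fst).comp .fst
  have hv' : Primrec fun p : (α × ℕ) × ℕ => v p.1.1 := (hv.comp .fst).comp .fst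
  have he : Primrec fun p : (α × ℕ) × ℕ => p.1.2 := Primrec.snd.comp .fst
  exact bigOr hs <| bigOr (hs.comp .fst) <| guard_eq (primrec_mulT hd' he .snd) hv' <|
    and (left hd' he _ _ _) (right hd' .snd _ _ _)

theorem shuffleBetween (hd : Primrec d) (hv : Primrec v) :
    PrimrecFormula fun a => shuffleBetween (d a) (v a) := by
  have hs := primrec_size.comp hd
  have hbit : PrimrecPred fun p : α × ℕ => Bit (v p.1) p.2 :=
    primrecPred_bit (hv.comp .fst) .snd
  have hc : PrimrecFormula fun p : α × ℕ => MSO.classVal (d p.1) 2 p.2 :=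
    classVal (hd.comp .fst) .snd 2
  exact and (all _ <| imp (const _) <| imp (const _) <| imp (const _) <| imp (const _) <|
      bigOr hs <| guard hbit hc)
    (all _ <| all _ <| imp (const _) <| imp (const _) <| imp (const _) <| imp (const _) <|
      bigAnd hs <| imp (guard hbit (const _)) <| ex _ <| and (const _) <| and (const _) <|
      and (const _) <| and (const _) hc)

theorem accepting (hd : Primrec d) (hv : Primrec v) :
    PrimrecFormula fun a => accepting (d a) (v a) :=
  bigOr (Primrec.list_length.comp (primrec_accept.comp hd)) <|
    guard_eq ((Primrec.list_getD 0).comp ((primrec_accept.comp hd).comp .fst) .snd)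
      (hv.comp .fst) (const _)

theorem consistent : PrimrecFormula consistent := by
  have hs := primrec_size
  have hs1 := hs.comp (Primrec.fst (β := ℕ))
  have hs2 : Primrec fun p : (Presentation × ℕ) × ℕ => p.1.1.size := hs1.comp .fst
  have hd2 : Primrec fun p : (Presentation × ℕ) × ℕ => p.1.1 := Primrec.fst.comp .fst
  have ha2 : Primrec fun p : (Presentation × ℕ) × ℕ => p.1.2 := Primrec.snd.comp .fst
  have hb2 : Primrec fun p : (Presentation × ℕ) × ℕ => p.2 := Primrec.snd
  have hm := primrec_mulT hd2 ha2 hb2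
  have hunique : PrimrecFormula uniqueF := all _ <| all _ <| imp (const _) <| bigAnd hs <|
    bigAnd hs1 <| imp (guess hs2 ha2 _ _) <|
    imp (guess hs2 hb2 _ _) <| guard_eq ha2 hb2 (const _)
  have hadd : PrimrecFormula addF := all _ <| all _ <| all _ <| imp (const _) <|
    imp (const _) <| bigAnd hs <| bigAnd hs1 <| imp (guess hs2 ha2 _ _) <|
    imp (guess hs2 hb2 _ _) <| guess hs2 hm _ _
  have hcut : PrimrecFormula cutF := imp (const _) <| all _ <| imp (const _) <| all _ <|
    imp (const _) <| bigAnd hs <| bigAnd hs1 <| imp (right hd2 ha2 _ _ _) <|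
    imp (left hd2 hb2 _ _ _) <| guess hs2 hm _ _
  have hshuffle : PrimrecFormula shuffleF := by
    have hd3 : Primrec fun p : ((Presentation × ℕ) × ℕ) × ℕ => p.1.1.1 := hd2.comp .fst
    have ha3 : Primrec fun p : ((Presentation × ℕ) × ℕ) × ℕ => p.1.1.2 := ha2.comp .fst
    have hb3 : Primrec fun p : ((Presentation × ℕ) × ℕ) × ℕ => p.1.2 := hb2.comp .fst
    exact all _ <| all _ <| imp (const _) <| imp (const _) <| bigAnd (Primrec.two_pow.comp hs) <|
      imp (bigOr hs1 <| guard (primrecPred_bit ha2 hb2) (const _)) <|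
      imp (shuffleBetween .fst .snd) <| bigAnd hs1 <| bigAnd hs2 <|
      imp (right hd3 hb3 _ _ _) <| imp (left hd3 .snd _ _ _) <|
      guess (hs2.comp .fst) (primrec_mulT hd3 hb3
        (primrec_mulT hd3 (primrec_kappaT hd3 ha3) .snd)) _ _
  have haccept : PrimrecFormula acceptF := all _ <| bigAnd hs <| bigAnd hs1 <|
    imp (left hd2 ha2 _ _ _) <| imp (right hd2 hb2 _ _ _) <|
    accepting hd2 hm
  exact and hunique <| and hadd <| and hcut <| and hshuffle haccept

end PrimrecFormula

theorem primrec_code_sentence : Primrec fun d => (sentence d).code :=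
  (((((((PrimrecFormula.closeAll PrimrecFormula.consistent).and ((PrimrecFormula.const _).or (PrimrecFormula.accepting .id
    Presentation.primrec_one))).allSet 4).allSet 3).allSet 2).allSet 1).allSet 0).closeExSet

end MSO

namespace Presentation

/-! ### From presentations to tables -/

theorem bit_iff_mem_bitIndices {i p : ℕ} : Bit i p ↔ p ∈ i.bitIndices := by
  rw [Nat.mem_bitIndices, Nat.testBit_eq_decide_div_mod_eq, decide_eq_true_iff]

section Index

variable {M : Type v} {n : ℕ} (eM : M ≃ Fin n)

theorem sum_two_pow_eq (P : Finset M) :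
    ∑ a ∈ P, 2 ^ (eM a : ℕ) = ∑ i ∈ P.map (eM.toEmbedding.trans Fin.valEmbedding), 2 ^ i := by
  rw [Finset.sum_map]
  rfl

theorem bit_sum_two_pow (P : Finset M) (a : M) :
    Bit (∑ a ∈ P, 2 ^ (eM a : ℕ)) (eM a) ↔ a ∈ P := by
  rw [bit_iff_mem_bitIndices, sum_two_pow_eq, ← List.mem_toFinset,
    Finset.toFinset_bitIndices_sum_two_pow]
  exact Finset.mem_map' (eM.toEmbedding.trans Fin.valEmbedding) (a := a)

theorem sum_two_pow_lt (P : Finset M) : ∑ a ∈ P, 2 ^ (eM a : ℕ) < 2 ^ n := by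
  rw [sum_two_pow_eq]
  refine Nat.geomSum_lt le_rfl fun k hk => ?_
  obtain ⟨a, -, rfl⟩ := Finset.mem_map.1 hk
  exact (eM a).2

theorem sum_two_pow_bit {i : ℕ} (hi : i < 2 ^ n) {P : Finset M}
    (hP : (P : Set M) = {a | Bit i (eM a)}) : ∑ a ∈ P, 2 ^ (eM a : ℕ) = i := by
  rw [sum_two_pow_eq]
  conv_rhs => rw [← Finset.sum_toFinset_bitIndices_two_pow i]
  congr 1
  ext k
  rw [Finset.mem_map, List.mem_toFinset]
  constructor
  · rintro ⟨a, ha, rfl⟩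
    rw [← Finset.mem_coe, hP] at ha
    exact bit_iff_mem_bitIndices.1 ha
  · intro hk
    have hkn : k < n := (Nat.pow_lt_pow_iff_right (by norm_num)).1
      ((Nat.two_pow_le_of_mem_bitIndices hk).trans_lt hi)
    refine ⟨eM.symm ⟨k, hkn⟩, ?_, by simp⟩
    rw [← Finset.mem_coe, hP]
    simpa using bit_iff_mem_bitIndices.2 hk

end Index

theorem getD_eq_of_getElem? {l : List ℕ} {i x : ℕ} (h : l[i]? = some x) : l.getD i 0 = x := by
  rw [List.getD_eq_getElem?_getD, h]
  rfl

/-- The tables of a presentation of a recognizer determine its values of shuffles. -/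
theorem Presents.exists_tabulates {d : Presentation} {A : Type u} {M : Type v}
    {eA : A ≃ Fin d.letters} {eM : M ≃ Fin d.size} {C : CountableMonoid M} {h : WordMorphism A C}
    {F : Set M} (hd : d.Presents eA eM C h F) :
    ∃ K : Set M → M, d.Tabulates eM C K F ∧
      ∀ P : Set M, P.Nonempty → ∀ W : Word M, W.IsShuffle P → K P = C.prod W := by
  classical
  have : Finite M := Finite.of_equiv _ eM.symm
  have hpos : 0 < d.size := (eM C.one).pos
  refine ⟨fun P => eM.symm ⟨d.kappaT (∑ a ∈ (toFinite P).toFinset, 2 ^ (eM a : ℕ)),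
    Nat.mod_lt _ hpos⟩, ⟨hd.one, fun a b => getD_eq_of_getElem? (hd.mul a b),
    fun a => getD_eq_of_getElem? (hd.tau a), fun a => getD_eq_of_getElem? (hd.tauRev a), ?_, ?_,
    ?_⟩, ?_⟩
  · intro i hi
    rw [Equiv.apply_symm_apply, sum_two_pow_bit eM hi (Finite.coe_toFinset _)]
  · intro P
    refine ⟨_, sum_two_pow_lt eM (toFinite P).toFinset, ?_⟩
    ext a
    rw [mem_ofPred_eq, bit_sum_two_pow, Finite.mem_toFinset]
  · intro a
    rw [← hd.accept a, List.mem_iff_getElem]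
    exact exists_congr fun j => ⟨fun ⟨hj, h⟩ => ⟨hj, by rwa [List.getD_eq_getElem _ _ hj] at h⟩,
      fun ⟨hj, h⟩ => ⟨hj, by rwa [List.getD_eq_getElem _ _ hj]⟩⟩
  · intro P hP W hW
    have hk := getD_eq_of_getElem? (hd.kappa (toFinite P).toFinset
      ((Finite.toFinset_nonempty _).2 hP) W (by rwa [Finite.coe_toFinset]))
    rw [Equiv.symm_apply_eq]
    refine Fin.ext ?_
    change d.kappa.getD _ 0 % d.size = _
    rw [hk, Nat.mod_eq_of_lt (eM (C.prod W)).2]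

/-- The sentence of a presentation defines the language presented. -/
theorem Presents.exists_defines {d : Presentation} {A : Type u} {M : Type v}
    {eA : A ≃ Fin d.letters} {eM : M ≃ Fin d.size} {C : CountableMonoid M} {h : WordMorphism A C}
    {F : Set M} (hd : d.Presents eA eM C h F) :
    ∃ φ : MSO A, MSO.sentence d = φ.mapLetter (fun a => (eA a : ℕ)) ∧ φ.IsExistsForall ∧
      φ.Defines {w | h.toFun w ∈ F} := by
  obtain ⟨K, hT, hK⟩ := hd.exists_tabulates
  obtain ⟨φ, hφ, hEA, hs⟩ := MSO.exists_mapLetter_eq_sentence d eA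
  refine ⟨φ, hφ, hEA, hs, fun w => ?_⟩
  have hinj : Function.Injective fun a => (eA a : ℕ) := Fin.val_injective.comp eA.injective
  rw [mem_ofPred_eq, h.toFun_eq_prod, ← MSO.models_sentence hT hK
    (lN := fun x => (eA (w.letter x) : ℕ))
    fun x => ⟨(eA _).2, getD_eq_of_getElem? (hd.image (w.letter x))⟩, hφ]
  exact (MSO.sat_mapLetter hinj w φ _ _).symm

end Presentation

/-! ### Uniqueness of shuffles -/

namespace Word

variable {S : Type u} {w w' : Word S}

/-- A finite partial isomorphism of words, given by its graph. -/
def IsPartialIso (w w' : Word S) (f : Finset (w.dom × w'.dom)) : Prop :=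
  (∀ p ∈ f, ∀ q ∈ f, cmp p.1 q.1 = cmp p.2 q.2) ∧ ∀ p ∈ f, w.letter p.1 = w'.letter p.2

theorem IsPartialIso.swap {f : Finset (w.dom × w'.dom)}
    (hf : IsPartialIso w w' f) :
    IsPartialIso w' w (f.map (Equiv.prodComm _ _).toEmbedding) := by
  refine ⟨fun p hp q hq => ?_, fun p hp => ?_⟩
  · obtain ⟨p, hp', rfl⟩ := Finset.mem_map.1 hp
    obtain ⟨q, hq', rfl⟩ := Finset.mem_map.1 hq
    exact (hf.1 p hp' q hq').symm
  · obtain ⟨p, hp', rfl⟩ := Finset.mem_map.1 hp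
    exact (hf.2 p hp').symm

theorem IsShuffle.exists_between_finsets {P : Set S} (hw : w.IsShuffle P) {a : S} (ha : a ∈ P)
    (lo hi : Finset w.dom) (hlt : ∀ x ∈ lo, ∀ y ∈ hi, x < y) :
    ∃ z, w.letter z = a ∧ (∀ x ∈ lo, x < z) ∧ ∀ y ∈ hi, z < y := by
  classical
  obtain ⟨e⟩ := hw.orderType
  have : DenselyOrdered w.dom := (denselyOrdered_iff_of_orderIsoClass e).2 inferInstance
  have : NoMaxOrder w.dom := ⟨fun x => by
    obtain ⟨y, hy⟩ := exists_gt (e x)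
    exact ⟨e.symm y, e.lt_symm_apply.2 hy⟩⟩
  have : NoMinOrder w.dom := ⟨fun x => by
    obtain ⟨y, hy⟩ := exists_lt (e x)
    exact ⟨e.symm y, e.symm_apply_lt.2 hy⟩⟩
  have : Nonempty w.dom := ⟨e.symm 0⟩
  obtain ⟨x, hx1, hx2⟩ := Order.exists_between_finsets lo hi hlt
  obtain ⟨y, hy1, hy2⟩ := Order.exists_between_finsets (insert x lo) hi (by
    intro s hs t ht
    rcases Finset.mem_insert.1 hs with rfl | hs
    · exact hx2 t ht
    · exact hlt s hs t ht)
  obtain ⟨z, hz1, hz2, hz⟩ := hw.dense a ha x y (hy1 x (Finset.mem_insert_self _ _))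
  exact ⟨z, hz, fun s hs => (hx1 s hs).trans hz1, fun t ht => hz2.trans (hy2 t ht)⟩

theorem IsPartialIso.exists_insert [DecidableEq w.dom] [DecidableEq w'.dom] {P : Set S}
    (hw : w.IsShuffle P) (hw' : w'.IsShuffle P) {f : Finset (w.dom × w'.dom)}
    (hf : IsPartialIso w w' f) (x : w.dom) : ∃ y, IsPartialIso w w' (insert (x, y) f) := by
  suffices h : ∃ y, w.letter x = w'.letter y ∧ ∀ p ∈ f, cmp p.1 x = cmp p.2 y by
    obtain ⟨y, hy, hcmp⟩ := h
    refine ⟨y, fun p hp q hq => ?_, fun p hp => ?_⟩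
    · rcases Finset.mem_insert.1 hp with rfl | hp <;> rcases Finset.mem_insert.1 hq with rfl | hq
      · simp only [cmp_self_eq_eq]
      · rw [cmp_eq_cmp_symm]
        exact hcmp q hq
      · exact hcmp p hp
      · exact hf.1 p hp q hq
    · rcases Finset.mem_insert.1 hp with rfl | hp
      · exact hy
      · exact hf.2 p hp
  by_cases h : ∃ y, (x, y) ∈ f
  · obtain ⟨y, hy⟩ := h
    exact ⟨y, hf.2 _ hy, fun p hp => hf.1 p hp _ hy⟩
  obtain ⟨y, hy, hlo, hhi⟩ := hw'.exists_between_finsets (hw.letter_mem x)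
    ({p ∈ f | p.1 < x}.image Prod.snd) ({p ∈ f | x < p.1}.image Prod.snd) (by
      simp only [Finset.mem_image, Finset.mem_filter]
      rintro _ ⟨p, ⟨hp, hpx⟩, rfl⟩ _ ⟨q, ⟨hq, hqx⟩, rfl⟩
      exact (lt_iff_lt_of_cmp_eq_cmp (hf.1 p hp q hq)).1 (hpx.trans hqx))
  refine ⟨y, hy.symm, fun p hp => ?_⟩
  rcases lt_trichotomy p.1 x with hlt | heq | hgt
  · rw [(cmp_eq_lt_iff _ _).2 hlt, (cmp_eq_lt_iff _ _).2
      (hlo _ (Finset.mem_image_of_mem _ (Finset.mem_filter.2 ⟨hp, hlt⟩)))]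
  · exact (h ⟨p.2, heq ▸ hp⟩).elim
  · rw [(cmp_eq_gt_iff _ _).2 hgt, (cmp_eq_gt_iff _ _).2
      (hhi _ (Finset.mem_image_of_mem _ (Finset.mem_filter.2 ⟨hp, hgt⟩)))]

theorem IsPartialIso.mono {f g : Finset (w.dom × w'.dom)} (hg : IsPartialIso w w' g)
    (h : f ⊆ g) : IsPartialIso w w' f :=
  ⟨fun p hp q hq => hg.1 p (h hp) q (h hq), fun p hp => hg.2 p (h hp)⟩

/-- Two shuffles of the same set of letters are isomorphic. -/
theorem IsShuffle.iso {P : Set S} (hw : w.IsShuffle P) (hw' : w'.IsShuffle P) : w.Iso w' := by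
  classical
  have : Encodable w.dom := Classical.choice (nonempty_encodable _)
  have : Encodable w'.dom := Classical.choice (nonempty_encodable _)
  let Q := {f : Finset (w.dom × w'.dom) // IsPartialIso w w' f}
  let onLeft : w.dom → Order.Cofinal Q := fun x =>
    { carrier := {f | ∃ y, (x, y) ∈ f.1}
      isCofinal := fun f => by
        obtain ⟨y, hy⟩ := f.2.exists_insert hw hw' x
        exact ⟨⟨_, hy⟩, ⟨y, Finset.mem_insert_self _ _⟩, Finset.subset_insert _ _⟩ }
  let onRight : w'.dom → Order.Cofinal Q := fun y =>
    { carrier := {f | ∃ x, (x, y) ∈ f.1}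
      isCofinal := fun f => by
        obtain ⟨x, hx⟩ := f.2.swap.exists_insert hw' hw y
        have hsub : insert (x, y) f.1 ⊆ (insert (y, x) (f.1.map
            (Equiv.prodComm _ _).toEmbedding)).map (Equiv.prodComm _ _).toEmbedding := by
          intro p hp
          rcases Finset.mem_insert.1 hp with rfl | hp
          · exact Finset.mem_map_of_mem _ (Finset.mem_insert_self (y, x) _)
          · exact Finset.mem_map_of_mem _ (Finset.mem_insert_of_mem
              (Finset.mem_map_of_mem (Equiv.prodComm _ _).toEmbedding hp))
        exact ⟨⟨_, hx.swap.mono hsub⟩, ⟨x, Finset.mem_insert_self _ _⟩,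
          Finset.subset_insert _ _⟩ }
  let both : w.dom ⊕ w'.dom → Order.Cofinal Q := Sum.elim onLeft onRight
  let start : Q := ⟨∅, by simp [IsPartialIso]⟩
  let I := Order.idealOfCofinals start both
  have hleft : ∀ x, ∃ y, ∃ f ∈ I, (x, y) ∈ f.1 := fun x => by
    obtain ⟨f, ⟨y, hy⟩, hf⟩ := Order.cofinal_meets_idealOfCofinals start both (Sum.inl x)
    exact ⟨y, f, hf, hy⟩
  have hright : ∀ y, ∃ x, ∃ f ∈ I, (x, y) ∈ f.1 := fun y => by
    obtain ⟨f, ⟨x, hx⟩, hf⟩ := Order.cofinal_meets_idealOfCofinals start both (Sum.inr y)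
    exact ⟨x, f, hf, hx⟩
  choose F Ff hFf hF using hleft
  choose G Gf hGf hG using hright
  refine ⟨OrderIso.ofCmpEqCmp F G fun x y => ?_, fun x => ((Ff x).2.2 _ (hF x)).symm⟩
  obtain ⟨m, -, h1, h2⟩ := I.directed _ (hFf x) _ (hGf y)
  exact m.2.1 _ (h1 (hF x)) _ (h2 (hG y))

end Word

/-! ### Presentations of finite recognizers -/

namespace Presentation

/-- Every recognizer with a finite algebra over a finite alphabet has a presentation. -/
theorem exists_presents {A : Type u} {M : Type v} {m n : ℕ} (eA : A ≃ Fin m) (eM : M ≃ Fin n)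
    (C : CountableMonoid M) (h : WordMorphism A C) (F : Set M) :
    ∃ (d : Presentation) (eA : A ≃ Fin d.letters) (eM : M ≃ Fin d.size),
      d.Presents eA eM C h F := by
  classical
  have hA : ∀ f : A → ℕ, ∃ l : List ℕ, ∀ a, l[(eA a : ℕ)]? = some (f a) := fun f =>
    ⟨List.ofFn fun i => f (eA.symm i), fun a => by simp⟩
  have hM : ∀ f : M → ℕ, ∃ l : List ℕ, ∀ a, l[(eM a : ℕ)]? = some (f a) := fun f =>
    ⟨List.ofFn fun i => f (eM.symm i), fun a => by simp⟩
  obtain ⟨mulL, hmul⟩ : ∃ l : List ℕ, ∀ a b,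
      l[n * (eM a : ℕ) + (eM b : ℕ)]? = some (eM (C.mul a b) : ℕ) := by
    refine ⟨List.ofFn fun i : Fin (n * n) =>
      (eM (C.mul (eM.symm i.divNat) (eM.symm i.modNat)) : ℕ), fun a b => ?_⟩
    have hlt : n * (eM a : ℕ) + eM b < n * n := by
      have := (eM a).2
      have := (eM b).2
      nlinarith
    have hdiv : (⟨_, hlt⟩ : Fin (n * n)).divNat = eM a := Fin.ext (by
      simp [Fin.divNat, Nat.mul_add_div (eM a).pos])
    have hmod : (⟨_, hlt⟩ : Fin (n * n)).modNat = eM b := Fin.ext (by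
      simp [Fin.modNat, Nat.mod_eq_of_lt])
    rw [List.getElem?_ofFn, dif_pos hlt, hdiv, hmod, Equiv.symm_apply_apply,
      Equiv.symm_apply_apply]
  obtain ⟨tauL, htau⟩ := hM fun a => eM (C.tau a)
  obtain ⟨tauRevL, htauRev⟩ := hM fun a => eM (C.tauRev a)
  obtain ⟨imageL, himage⟩ := hA fun a => eM (h.toFun (Word.single a))
  obtain ⟨acceptL, haccept⟩ : ∃ l : List ℕ, ∀ a, (eM a : ℕ) ∈ l ↔ a ∈ F := by
    refine ⟨((toFinite {i : Fin n | eM.symm i ∈ F}).toFinset.toList).map Fin.val, fun a => ?_⟩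
    rw [List.mem_map_of_injective Fin.val_injective, Finset.mem_toList, Finite.mem_toFinset]
    simp
  obtain ⟨kappaL, hkappa⟩ : ∃ l : List ℕ, ∀ P : Finset M, P.Nonempty → ∀ w : Word M,
      w.IsShuffle (P : Set M) →
      l[∑ a ∈ P, 2 ^ (eM a : ℕ)]? = some (eM (C.prod w) : ℕ) := by
    let κ : Set M → ℕ := fun P => if hP : ∃ w : Word M, w.IsShuffle P
      then eM (C.prod hP.choose) else 0
    refine ⟨List.ofFn fun i : Fin (2 ^ n) => κ {a | Bit i (eM a)}, fun P _ w hw => ?_⟩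
    have hex : ∃ w : Word M, w.IsShuffle (P : Set M) := ⟨w, hw⟩
    have hP : {a | Bit (∑ a ∈ P, 2 ^ (eM a : ℕ)) (eM a)} = (P : Set M) :=
      Set.ext fun a => bit_sum_two_pow eM P a
    rw [List.getElem?_ofFn, dif_pos (sum_two_pow_lt eM P)]
    change some (κ _) = _
    rw [hP, show κ P = eM (C.prod hex.choose) from dif_pos hex,
      C.prod_iso _ _ (hex.choose_spec.iso hw)]
  exact ⟨⟨m, n, eM C.one, mulL, tauL, tauRevL, kappaL, imageL, acceptL⟩, eA, eM,
    ⟨rfl, hmul, htau, htauRev, hkappa, himage, haccept⟩⟩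

end Presentation

theorem mainTheorem4 :
    -- effectiveness: one algorithm computes, from a finite presentation of a recognizer, a
    -- defining sentence in the `∃∀`-fragment
    (∃ Φ : Presentation → MSO ℕ, Computable (fun d => (Φ d).code) ∧
      ∀ (d : Presentation) (A : Type u) (M : Type v)
        (eA : A ≃ Fin d.letters) (eM : M ≃ Fin d.size)
        (C : CountableMonoid M) (h : WordMorphism A C) (F : Set M),
        d.Presents eA eM C h F →
        ∃ φ : MSO A, Φ d = φ.mapLetter (fun a => (eA a : ℕ)) ∧
          φ.IsExistsForall ∧ φ.Defines {w | h.toFun w ∈ F}) ∧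
    -- definability
    (∀ (A : Type u) [Finite A] (L : Set (Word A)), IsRecognizable L →
      ∃ φ : MSO A, φ.IsExistsForall ∧ φ.Defines L) := by
  refine ⟨⟨MSO.sentence, MSO.primrec_code_sentence.to_comp,
    fun d A M eA eM C h F hd => hd.exists_defines⟩, ?_⟩
  rintro A _ L ⟨M, _, C, h, F, rfl⟩
  obtain ⟨d, eA, eM, hd⟩ :=
    Presentation.exists_presents (Finite.equivFin A) (Finite.equivFin M) C h F
  obtain ⟨φ, -, hφ⟩ := hd.exists_defines
  exact ⟨φ, hφ⟩
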